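/- Let $\Bbbk$ be an algebraically closed field. A $\Bbbk$-linear category is *finite* if it is linearly equivalent to the category of finite-dimensional modules over a finite-dimensional $\Bbbk$-algebra. Let $\mathcal A$ be a finite tensor category (a finite linear rigid monoidal category with bilinear tensor product and $\mathrm{End}(\mathbf 1)=\Bbbk$). Right duals come with $a^\vee\otimes a\to\mathbf 1\to a\otimes a^\vee$, left duals with $a\otimes{}^\vee a\to\mathbf 1\to{}^\vee a\otimes a$. Let $\mathcal M$ be an exact left $\mathcal A$-module category: a finite linear category with a bilinear action $(a,m)\mapsto a.m$, exact in $a$, such that $p.m$ is projective whenever $p\in\mathcal A$ is projective. For a finite linear category $\mathcal X$ put $$N^l_{\mathcal X}=\int_{x\in\mathcal X}\mathrm{Hom}(x,-)\otimes x,\qquad N^r_{\mathcal X}=\int^{x\in\mathcal X}\mathrm{Hom}(-,x)^*\otimes x .$$ Let $D=N^l_{\mathcal A}(\mathbf 1)$ be the distinguished object of $\mathcal A$. The inner Hom $\underline{\mathrm{Hom}}$ of $\mathcal M$ is defined by natural isomorphisms $\mathrm{Hom}_{\mathcal M}(a.m,n)\cong\mathrm{Hom}_{\mathcal A}(a,\underline{\mathrm{Hom}}(m,n))$.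 A left (right) relative Serre functor is an endofunctor $S^l$ ($S^r$) of $\mathcal M$ with isomorphisms $${}^\vee\underline{\mathrm{Hom}}(m,n)\cong\underline{\mathrm{Hom}}(S^l(n),m)\qquad\bigl(\underline{\mathrm{Hom}}(m,n)^\vee\cong\underline{\mathrm{Hom}}(n,S^r(m))\bigr)$$ natural in $m,n$. It is called *module natural* if these isomorphisms are moreover compatible with the action of $\mathcal A$ on $m$ (respectively on $n$), i.e. with the canonical isomorphisms $\underline{\mathrm{Hom}}(m,a.n)\cong a\otimes\underline{\mathrm{Hom}}(m,n)$ and $\underline{\mathrm{Hom}}(a.m,n)\cong\underline{\mathrm{Hom}}(m,n)\otimes a^\vee$. Then the functors $N^l$, $N^r$ of $\mathcal A$ and of $\mathcal M$, the inner Hom, and module natural left and right relative Serre functors of $\mathcal M$ exist; $D$ is invertible with inverse $D^{-1}=N^r_{\mathcal A}(\mathbf 1)$; and for all left and right relative Serre functors $S^l,S^r$ there are natural isomorphisms $$N^l_{\mathcal M}\cong D.S^l,\qquad N^r_{\mathcal M}\cong D^{-1}.S^r .$$ If $S^l$ (respectively $S^r$) is module natural, then the isomorphism can be chosen as an isomorphism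 of twisted module endofunctors, i.e. compatible with the canonical isomorphisms $$N^l_{\mathcal M}(a.m)\cong a^{\vee\vee}.N^l_{\mathcal M}(m),\qquad D.S^l(a.m)\cong D.{}^{\vee\vee}a.S^l(m)\cong a^{\vee\vee}.D.S^l(m),$$ $$N^r_{\mathcal M}(a.m)\cong{}^{\vee\vee}a.N^r_{\mathcal M}(m),\qquad D^{-1}.S^r(a.m)\cong D^{-1}.a^{\vee\vee}.S^r(m)\cong{}^{\vee\vee}a.D^{-1}.S^r(m).$$ Here the isomorphisms for $N^l_{\mathcal M}$ and $N^r_{\mathcal M}$ are induced by the universal property of the (co)end and the duality adjunctions; those for $S^l(a.m)\cong{}^{\vee\vee}a.S^l(m)$ and $S^r(a.m)\cong a^{\vee\vee}.S^r(m)$ are induced by the defining isomorphisms of the relative Serre functors; and $D\otimes{}^{\vee\vee}a\cong a^{\vee\vee}\otimes D$ and $D^{-1}\otimes a^{\vee\vee}\cong{}^{\vee\vee}a\otimes D^{-1}$ are obtained from the two isomorphisms $N^l_{\mathcal A}(\mathbf 1\otimes a)\cong D\otimes{}^{\vee\vee}a$, $N^l_{\mathcal A}(a\otimes\mathbf 1)\cong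 a^{\vee\vee}\otimes D$, respectively from $N^r_{\mathcal A}(\mathbf 1\otimes a)\cong D^{-1}\otimes a^{\vee\vee}$, $N^r_{\mathcal A}(a\otimes\mathbf 1)\cong{}^{\vee\vee}a\otimes D^{-1}$. -/

import Mathlib

open CategoryTheory MonoidalCategory Limits Opposite
open scoped MonoidalLeftAction

noncomputable section

namespace NakayamaSerre

universe w v v' u u'

/-! ### Finite linear categories -/

/-- A `k`-linear category is *finite* if it is equivalent, as a linear category, to the category
of finite-dimensional modules over a finite-dimensional `k`-algebra. -/
class IsFiniteLinear (k : Type w) [Field k] (C : Type u) [Category.{v} C] [Preadditive C]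
    [Linear k C] : Prop where
  exists_equivalence : ∃ (B : Type w) (_ : Ring B) (_ : Algebra k B)
    (_ : FiniteDimensional k B) (e : C ≌ FGModuleCat.{w} B),
      e.functor.Additive ∧ e.functor.Linear k

/-- Morphism spaces of a finite linear category are finite-dimensional. -/
instance finiteDimensional_hom (k : Type w) [Field k] (C : Type u) [Category.{v} C]
    [Preadditive C] [Linear k C] [IsFiniteLinear k C] (x y : C) :
    FiniteDimensional k (x ⟶ y) := by
  obtain ⟨B, _, _, _, e, he, hl⟩ := IsFiniteLinear.exists_equivalence (k := k) (C := C)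
  let X := (e.functor.obj x).obj
  let Y := (e.functor.obj y).obj
  let _ : Module k X := Module.compHom X (algebraMap k B)
  let _ : Module k Y := Module.compHom Y (algebraMap k B)
  have : IsScalarTower k B X := IsScalarTower.of_algebraMap_smul fun _ _ => rfl
  have : IsScalarTower k B Y := IsScalarTower.of_algebraMap_smul fun _ _ => rfl
  have : Module.Finite B X := (e.functor.obj x).property
  have : Module.Finite B Y := (e.functor.obj y).property
  have : Module.Finite k X := Module.Finite.trans B X
  have : Module.Finite k Y := Module.Finite.trans B Y
  let f : (x ⟶ y) →ₗ[k] (X →ₗ[k] Y) :=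
    { toFun := fun g => (e.functor.map g).hom.hom.restrictScalars k
      map_add' := fun g h => by
        rw [e.functor.map_add]; rfl
      map_smul' := fun c g => by
        rw [e.functor.map_smul]
        ext t
        rfl }
  refine Module.Finite.of_injective f fun g h hgh => e.functor.map_injective ?_
  apply FGModuleCat.hom_ext
  ext t
  exact LinearMap.congr_fun hgh t

attribute [local instance] Abelian.hasFiniteBiproducts

/-! ### Copowers by finite-dimensional vector spaces -/

section Copower

variable (k : Type w) [Field k] {C : Type u} [Category.{v} C] [Abelian C] [Linear k C]

/-- The object `V ⊗ x` for a finite-dimensional vector space `V`: a direct sum of `dim V` copies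
of `x`. It corepresents `z ↦ Hom_k(V, Hom(x, z))`, see `copower.descEquiv`. -/
def copower (V : Type v') [AddCommGroup V] [Module k V] (x : C) : C :=
  ⨁ fun _ : Fin (Module.finrank k V) => x

namespace copower

variable {k}
variable {V : Type v'} [AddCommGroup V] [Module k V] [FiniteDimensional k V]
variable {W : Type u'} [AddCommGroup W] [Module k W] [FiniteDimensional k W]

/-- The universal linear map `V → Hom(x, V ⊗ x)`. -/
def ι (x : C) : V →ₗ[k] (x ⟶ copower k V x) :=
  (Module.finBasis k V).constr k fun i =>
    biproduct.ι (fun _ : Fin (Module.finrank k V) => x) i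

/-- The morphism `V ⊗ x ⟶ z` corresponding to a linear map `V → Hom(x, z)`. -/
def desc {x z : C} (f : V →ₗ[k] (x ⟶ z)) : copower k V x ⟶ z :=
  biproduct.desc fun i => f (Module.finBasis k V i)

lemma ι_basis (x : C) (i : Fin (Module.finrank k V)) :
    ι x (Module.finBasis k V i) = biproduct.ι (fun _ : Fin (Module.finrank k V) => x) i :=
  (Module.finBasis k V).constr_basis k _ i

@[simp]
lemma ι_desc {x z : C} (f : V →ₗ[k] (x ⟶ z)) (v : V) : ι x v ≫ desc f = f v := by
  have : (Linear.rightComp k x (desc f)).comp (ι x) = f := by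
    refine (Module.finBasis k V).ext fun i => ?_
    change ι x (Module.finBasis k V i) ≫ desc f = _
    rw [ι_basis]
    exact biproduct.ι_desc _ _
  exact LinearMap.congr_fun this v

lemma hom_ext {x z : C} {f g : copower k V x ⟶ z} (h : ∀ v : V, ι x v ≫ f = ι x v ≫ g) :
    f = g := by
  refine biproduct.hom_ext' _ _ fun i => ?_
  have := h (Module.finBasis k V i)
  rw [ι_basis] at this
  exact this

/-- The universal property of `V ⊗ x`. -/
def descEquiv (x z : C) : (V →ₗ[k] (x ⟶ z)) ≃ (copower k V x ⟶ z) where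
  toFun := desc
  invFun f := (Linear.rightComp k x f).comp (ι x)
  left_inv f := by ext v; simp
  right_inv f := hom_ext fun v => by simp

/-- Functoriality of `V ⊗ x` in both arguments. -/
def map (f : V →ₗ[k] W) {x y : C} (g : x ⟶ y) : copower k V x ⟶ copower k W y :=
  desc ((Linear.leftComp k _ g).comp ((ι y).comp f))

@[simp]
lemma ι_map (f : V →ₗ[k] W) {x y : C} (g : x ⟶ y) (v : V) :
    ι x v ≫ map f g = g ≫ ι y (f v) := by
  simp [map]

@[simp]
lemma ι_map_assoc (f : V →ₗ[k] W) {x y z : C} (g : x ⟶ y) (v : V) (h : copower k W y ⟶ z) :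
    ι x v ≫ map f g ≫ h = g ≫ ι y (f v) ≫ h := by
  rw [← Category.assoc, ι_map, Category.assoc]

end copower

end Copower

/-! ### Nakayama functors -/

section Nakayama

variable (k : Type w) [Field k] (C : Type u) [Category.{v} C] [Abelian C] [Linear k C]
  [IsFiniteLinear k C]

variable {C} in
/-- The functor `(x', x) ↦ Hom(x', y) ⊗ x`. -/
@[simps]
def homCopower (y : C) : Cᵒᵖ ⥤ C ⥤ C where
  obj x' :=
    { obj := fun x => copower k (x'.unop ⟶ y) x
      map := fun g => copower.map LinearMap.id g
      map_id := fun x => copower.hom_ext fun v => by simp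
      map_comp := fun f g => copower.hom_ext fun v => by simp }
  map f :=
    { app := fun x => copower.map (Linear.leftComp k y f.unop) (𝟙 x)
      naturality := fun x x' g => copower.hom_ext fun v => by simp }
  map_id x' := by
    ext x
    exact copower.hom_ext fun v => by simp
  map_comp f g := by
    ext x
    exact copower.hom_ext fun v => by simp

variable {C} in
/-- The functor `(x', x) ↦ Hom(y, x')^* ⊗ x`. -/
@[simps]
def dualHomCopower (y : C) : Cᵒᵖ ⥤ C ⥤ C where
  obj x' :=
    { obj := fun x => copower k (Module.Dual k (y ⟶ x'.unop)) x
      map := fun g => copower.map LinearMap.id g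
      map_id := fun x => copower.hom_ext fun v => by simp
      map_comp := fun f g => copower.hom_ext fun v => by simp }
  map f :=
    { app := fun x => copower.map (Linear.rightComp k y f.unop).dualMap (𝟙 x)
      naturality := fun x x' g => copower.hom_ext fun v => by simp }
  map_id x' := by
    ext x
    refine copower.hom_ext fun v => ?_
    have : (Linear.rightComp k y (𝟙 x'.unop)).dualMap v = v := by
      ext g; simp [LinearMap.dualMap_apply]
    simp [this]
  map_comp f g := by
    ext x
    refine copower.hom_ext fun v => ?_
    have : (Linear.rightComp k y (g.unop ≫ f.unop)).dualMap v =
        (Linear.rightComp k y g.unop).dualMap ((Linear.rightComp k y f.unop).dualMap v) := by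
      ext h; simp [LinearMap.dualMap_apply]
    simp [this]

/-- The left exact Nakayama functor `N^l = ∫_x Hom(x, -) ⊗ x`: an endofunctor whose value at `y`
is an end of `(x', x) ↦ Hom(x', y) ⊗ x`, with the induced action on morphisms. -/
structure LeftNakayama where
  /-- the underlying endofunctor -/
  functor : C ⥤ C
  /-- the structure morphisms of the end -/
  π (y x : C) : functor.obj y ⟶ copower k (x ⟶ y) x
  wedge (y : C) ⦃i j : C⦄ (f : i ⟶ j) :
    π y i ≫ ((homCopower k y).obj (op i)).map f = π y j ≫ ((homCopower k y).map f.op).app j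
  /-- the universal property of the end -/
  isLimit (y : C) : IsLimit (Wedge.mk (F := homCopower k y) (functor.obj y) (π y) (wedge y))
  naturality {y y' : C} (g : y ⟶ y') (x : C) :
    functor.map g ≫ π y' x = π y x ≫ copower.map (Linear.rightComp k x g) (𝟙 x)

/-- The Nakayama functor `N^r = ∫^x Hom(-, x)^* ⊗ x`: an endofunctor whose value at `y`
is a coend of `(x', x) ↦ Hom(y, x')^* ⊗ x`, with the induced action on morphisms. -/
structure RightNakayama where
  /-- the underlying endofunctor -/
  functor : C ⥤ C
  /-- the structure morphisms of the coend -/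
  ι (y x : C) : copower k (Module.Dual k (y ⟶ x)) x ⟶ functor.obj y
  cowedge (y : C) ⦃i j : C⦄ (f : i ⟶ j) :
    ((dualHomCopower k y).map f.op).app i ≫ ι y i =
      ((dualHomCopower k y).obj (op j)).map f ≫ ι y j
  /-- the universal property of the coend -/
  isColimit (y : C) :
    IsColimit (Cowedge.mk (F := dualHomCopower k y) (functor.obj y) (ι y) (cowedge y))
  naturality {y y' : C} (g : y ⟶ y') (x : C) :
    ι y x ≫ functor.map g = copower.map (Linear.leftComp k x g).dualMap (𝟙 x) ≫ ι y' x

variable {k C}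

/-- The component `N^l(y) ⟶ Hom(x, y) ⊗ x ⟶ x` of the structure morphism of the end obtained by
evaluating with a linear form `ξ` on `Hom(x, y)`. -/
def LeftNakayama.component (N : LeftNakayama k C) {x y : C} (ξ : Module.Dual k (x ⟶ y)) :
    N.functor.obj y ⟶ x :=
  N.π y x ≫ copower.desc (ξ.smulRight (𝟙 x))

/-- The component `x ⟶ Hom(y, x)^* ⊗ x ⟶ N^r(y)` of the structure morphism of the coend at a
linear form `ξ` on `Hom(y, x)`. -/
def RightNakayama.component (N : RightNakayama k C) {x y : C} (ξ : Module.Dual k (y ⟶ x)) :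
    x ⟶ N.functor.obj y :=
  copower.ι x ξ ≫ N.ι y x

end Nakayama

/-! ### Finite tensor categories and their module categories -/

/-- A finite tensor category over `k`: a finite linear rigid monoidal category with bilinear
tensor product and with `End(𝟙) = k`. -/
class FiniteTensorCategory (k : Type w) [Field k] (A : Type u) [Category.{v} A] [Abelian A]
    [Linear k A] [MonoidalCategory A] [MonoidalPreadditive A] [MonoidalLinear k A]
    [RigidCategory A] : Prop extends IsFiniteLinear k A where
  finrank_end_unit : Module.finrank k (𝟙_ A ⟶ 𝟙_ A) = 1

/-- The action of `A` on `M` is bilinear. -/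
class BilinearAction (k : Type w) [Field k] (A : Type u) [Category.{v} A] [Preadditive A]
    [Linear k A] [MonoidalCategory A] (M : Type u') [Category.{v'} M] [Preadditive M]
    [Linear k M] [MonoidalLeftAction A M] : Prop where
  add_actionHomLeft {a b : A} (f g : a ⟶ b) (m : M) : (f + g) ⊵ₗ m = f ⊵ₗ m + g ⊵ₗ m
  smul_actionHomLeft (c : k) {a b : A} (f : a ⟶ b) (m : M) : (c • f) ⊵ₗ m = c • (f ⊵ₗ m)
  actionHomRight_add (a : A) {m n : M} (f g : m ⟶ n) : a ⊴ₗ (f + g) = a ⊴ₗ f + a ⊴ₗ g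
  actionHomRight_smul (a : A) (c : k) {m n : M} (f : m ⟶ n) : a ⊴ₗ (c • f) = c • (a ⊴ₗ f)

/-- A (left) module category over `A`: a finite linear category with a bilinear action of `A`
that is exact in the first variable. -/
class ModuleCategory (k : Type w) [Field k] (A : Type u) [Category.{v} A] [Preadditive A]
    [Linear k A] [MonoidalCategory A] (M : Type u') [Category.{v'} M] [Preadditive M]
    [Linear k M] [IsFiniteLinear k M] [MonoidalLeftAction A M] : Prop
    extends BilinearAction k A M where
  preservesFiniteLimits (m : M) : PreservesFiniteLimits (MonoidalLeftAction.actionRight A m)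
  preservesFiniteColimits (m : M) : PreservesFiniteColimits (MonoidalLeftAction.actionRight A m)

/-- A module category is *exact* if acting with a projective object gives projective objects. -/
def IsExactModuleCategory (A : Type u) [Category.{v} A] [MonoidalCategory A] (M : Type u')
    [Category.{v'} M] [MonoidalLeftAction A M] : Prop :=
  ∀ p : A, Projective p → ∀ m : M, Projective (p ⊙ₗ m)

/-- The action of a monoidal linear category on itself is bilinear. -/
instance bilinearAction_self (k : Type w) [Field k] (A : Type u) [Category.{v} A] [Preadditive A]
    [Linear k A] [MonoidalCategory A] [MonoidalPreadditive A] [MonoidalLinear k A] :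
    BilinearAction k A A where
  add_actionHomLeft f g m := MonoidalPreadditive.add_whiskerRight f g
  smul_actionHomLeft c _ _ f m := MonoidalLinear.smul_whiskerRight c f m
  actionHomRight_add a _ _ f g := MonoidalPreadditive.whiskerLeft_add f g
  actionHomRight_smul a c _ _ f := MonoidalLinear.whiskerLeft_smul a c f

/-! ### Duality and actions -/

section Duality

variable {A : Type u} [Category.{v} A] [MonoidalCategory A]

/-- The double right dual `a^∨∨`; here `a^∨` carries `a^∨ ⊗ a ⟶ 𝟙` and `𝟙 ⟶ a ⊗ a^∨`. -/
abbrev rr [RigidCategory A] (a : A) : A := HasRightDual.rightDual (HasRightDual.rightDual a)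

/-- The double left dual `^∨∨a`; here `^∨a` carries `a ⊗ ^∨a ⟶ 𝟙` and `𝟙 ⟶ ^∨a ⊗ a`. -/
abbrev ll [RigidCategory A] (a : A) : A := HasLeftDual.leftDual (HasLeftDual.leftDual a)

variable {M : Type u'} [Category.{v'} M] [MonoidalLeftAction A M]

/-- For `Y` a right dual of `X`: the unit `m ⟶ X.(Y.m)`. -/
def actUnit (X Y : A) [ExactPairing X Y] (m : M) : m ⟶ X ⊙ₗ Y ⊙ₗ m :=
  (λₗ[A] m).inv ≫ η_ X Y ⊵ₗ m ≫ (αₗ X Y m).hom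

/-- For `Y` a right dual of `X`: the counit `Y.(X.m) ⟶ m`. -/
def actCounit (X Y : A) [ExactPairing X Y] (m : M) : Y ⊙ₗ X ⊙ₗ m ⟶ m :=
  (αₗ Y X m).inv ≫ ε_ X Y ⊵ₗ m ≫ (λₗ[A] m).hom

/-- For `Y` a right dual of `X`: the unit `x ⟶ (x ⊗ X) ⊗ Y`. -/
def tensorUnit (X Y : A) [ExactPairing X Y] (x : A) : x ⟶ (x ⊗ X) ⊗ Y :=
  (ρ_ x).inv ≫ x ◁ η_ X Y ≫ (α_ x X Y).inv

/-- For `Y` a right dual of `X`: the counit `(x ⊗ Y) ⊗ X ⟶ x`. -/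
def tensorCounit (X Y : A) [ExactPairing X Y] (x : A) : (x ⊗ Y) ⊗ X ⟶ x :=
  (α_ x Y X).hom ≫ x ◁ ε_ X Y ≫ (ρ_ x).hom

variable (k : Type w) [Field k] [Preadditive A] [Linear k A]

/-- For `Y` a right dual of `X`: the linear map `Hom(Y.z, m) → Hom(z, X.m)`. -/
def actCurry [Preadditive M] [Linear k M] [BilinearAction k A M] (X Y : A) [ExactPairing X Y]
    (z m : M) : (Y ⊙ₗ z ⟶ m) →ₗ[k] (z ⟶ X ⊙ₗ m) where
  toFun h := actUnit X Y z ≫ X ⊴ₗ h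
  map_add' f g := by rw [BilinearAction.actionHomRight_add k, Preadditive.comp_add]
  map_smul' c f := by
    rw [BilinearAction.actionHomRight_smul, Linear.comp_smul, RingHom.id_apply]

/-- For `Y` a right dual of `X`: the linear map `Hom(m, X.z) → Hom(Y.m, z)`. -/
def actUncurry [Preadditive M] [Linear k M] [BilinearAction k A M] (X Y : A) [ExactPairing X Y]
    (m z : M) : (m ⟶ X ⊙ₗ z) →ₗ[k] (Y ⊙ₗ m ⟶ z) where
  toFun h := Y ⊴ₗ h ≫ actCounit X Y z
  map_add' f g := by rw [BilinearAction.actionHomRight_add k, Preadditive.add_comp]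
  map_smul' c f := by
    rw [BilinearAction.actionHomRight_smul, Linear.smul_comp, RingHom.id_apply]

/-- For `Y` a right dual of `X`: the linear map `Hom(z ⊗ X, x) → Hom(z, x ⊗ Y)`. -/
def tensorCurry [MonoidalPreadditive A] [MonoidalLinear k A] (X Y : A) [ExactPairing X Y]
    (z x : A) : (z ⊗ X ⟶ x) →ₗ[k] (z ⟶ x ⊗ Y) where
  toFun h := tensorUnit X Y z ≫ h ▷ Y
  map_add' f g := by rw [MonoidalPreadditive.add_whiskerRight, Preadditive.comp_add]
  map_smul' c f := by
    rw [MonoidalLinear.smul_whiskerRight, Linear.comp_smul, RingHom.id_apply]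

/-- For `Y` a right dual of `X`: the linear map `Hom(x, z ⊗ Y) → Hom(x ⊗ X, z)`. -/
def tensorUncurry [MonoidalPreadditive A] [MonoidalLinear k A] (X Y : A) [ExactPairing X Y]
    (x z : A) : (x ⟶ z ⊗ Y) →ₗ[k] (x ⊗ X ⟶ z) where
  toFun h := h ▷ X ≫ tensorCounit X Y z
  map_add' f g := by rw [MonoidalPreadditive.add_whiskerRight, Preadditive.add_comp]
  map_smul' c f := by
    rw [MonoidalLinear.smul_whiskerRight, Linear.smul_comp, RingHom.id_apply]

end Duality

/-! ### Twisted module structures of the Nakayama functors -/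

section NakayamaModule

variable {k : Type w} [Field k]
variable {A : Type u} [Category.{v} A] [Abelian A] [Linear k A] [MonoidalCategory A]
  [RigidCategory A]
variable {M : Type u'} [Category.{v'} M] [Abelian M] [Linear k M] [IsFiniteLinear k M]
  [MonoidalLeftAction A M] [BilinearAction k A M]

/-- The canonical isomorphisms `a^∨∨.N^l(m) ≅ N^l(a.m)`. They are uniquely determined by `spec`:
the component at `z` of the composite into `∫_z Hom(z, a.m) ⊗ z` is
`a^∨∨.N^l(m) ⟶ Hom(a^∨.z, m) ⊗ a^∨∨.a^∨.z ≅ Hom(z, a.m) ⊗ a^∨∨.a^∨.z ⟶ Hom(z, a.m) ⊗ z`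
(evaluated at linear forms on `Hom(z, a.m)`). -/
structure LeftNakayama.ModuleStr (A : Type u) [Category.{v} A] [Abelian A] [Linear k A]
    [MonoidalCategory A] [RigidCategory A] [MonoidalLeftAction A M] [BilinearAction k A M]
    (N : LeftNakayama k M) where
  /-- the structure isomorphisms -/
  iso (a : A) (m : M) : rr a ⊙ₗ N.functor.obj m ≅ N.functor.obj (a ⊙ₗ m)
  spec (a : A) (m z : M) (ξ : Module.Dual k (z ⟶ a ⊙ₗ m)) :
    (iso a m).hom ≫ N.component ξ =
      rr a ⊴ₗ N.component (ξ.comp (actCurry k a (HasRightDual.rightDual a) z m)) ≫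
        actCounit (HasRightDual.rightDual a) (rr a) z

/-- The canonical isomorphisms `N^r(a.m) ≅ ^∨∨a.N^r(m)`. They are uniquely determined by `spec`:
the component at `z` of the composite out of `∫^z Hom(a.m, z)^* ⊗ z` is
`Hom(a.m, z)^* ⊗ z ⟶ Hom(a.m, z)^* ⊗ ^∨∨a.^∨a.z ≅ Hom(m, ^∨a.z)^* ⊗ ^∨∨a.^∨a.z ⟶ ^∨∨a.N^r(m)`
(at linear forms on `Hom(a.m, z)`). -/
structure RightNakayama.ModuleStr (A : Type u) [Category.{v} A] [Abelian A] [Linear k A]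
    [MonoidalCategory A] [RigidCategory A] [MonoidalLeftAction A M] [BilinearAction k A M]
    (N : RightNakayama k M) where
  /-- the structure isomorphisms -/
  iso (a : A) (m : M) : N.functor.obj (a ⊙ₗ m) ≅ ll a ⊙ₗ N.functor.obj m
  spec (a : A) (m z : M) (ξ : Module.Dual k (a ⊙ₗ m ⟶ z)) :
    N.component ξ ≫ (iso a m).hom =
      actUnit (ll a) (HasLeftDual.leftDual a) z ≫
        ll a ⊴ₗ N.component (ξ.comp (actUncurry k (HasLeftDual.leftDual a) a m z))

variable [MonoidalPreadditive A] [MonoidalLinear k A] [IsFiniteLinear k A]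

/-- For `A` as a right module over itself: the canonical isomorphisms
`N^l(x) ⊗ ^∨∨b ≅ N^l(x ⊗ b)`. -/
structure LeftNakayama.RightModuleStr (N : LeftNakayama k A) where
  /-- the structure isomorphisms -/
  iso (x b : A) : N.functor.obj x ⊗ ll b ≅ N.functor.obj (x ⊗ b)
  spec (x b z : A) (ξ : Module.Dual k (z ⟶ x ⊗ b)) :
    (iso x b).hom ≫ N.component ξ =
      N.component (ξ.comp (tensorCurry k (HasLeftDual.leftDual b) b z x)) ▷ ll b ≫
        tensorCounit (ll b) (HasLeftDual.leftDual b) z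

/-- For `A` as a right module over itself: the canonical isomorphisms
`N^r(x ⊗ b) ≅ N^r(x) ⊗ b^∨∨`. -/
structure RightNakayama.RightModuleStr (N : RightNakayama k A) where
  /-- the structure isomorphisms -/
  iso (x b : A) : N.functor.obj (x ⊗ b) ≅ N.functor.obj x ⊗ rr b
  spec (x b z : A) (ξ : Module.Dual k (x ⊗ b ⟶ z)) :
    N.component ξ ≫ (iso x b).hom =
      tensorUnit (HasRightDual.rightDual b) (rr b) z ≫
        N.component (ξ.comp (tensorUncurry k b (HasRightDual.rightDual b) x z)) ▷ rr b

/-- The distinguished invertible object `D = N^l(𝟙) = ∫_a Hom(a, 𝟙) ⊗ a`. -/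
abbrev LeftNakayama.dist (N : LeftNakayama k A) : A := N.functor.obj (𝟙_ A)

/-- The object `N^r(𝟙) = ∫^a Hom(𝟙, a)^* ⊗ a`, the inverse of the distinguished object. -/
abbrev RightNakayama.distInv (N : RightNakayama k A) : A := N.functor.obj (𝟙_ A)

/-- The isomorphisms `a^∨∨ ⊗ D ≅ D ⊗ ^∨∨a` obtained from
`a^∨∨ ⊗ N^l(𝟙) ≅ N^l(a ⊗ 𝟙) ≅ N^l(a) ≅ N^l(𝟙 ⊗ a) ≅ N^l(𝟙) ⊗ ^∨∨a`. -/
structure LeftNakayama.Radford (N : LeftNakayama k A) where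
  /-- the left module structure of `N^l` on the regular bimodule category -/
  left : N.ModuleStr A
  /-- the right module structure of `N^l` on the regular bimodule category -/
  right : N.RightModuleStr
  /-- the isomorphisms `a^∨∨ ⊗ D ≅ D ⊗ ^∨∨a` -/
  iso (a : A) : rr a ⊗ N.dist ≅ N.dist ⊗ ll a
  spec (a : A) :
    (iso a).hom ≫ (right.iso (𝟙_ A) a).hom ≫ N.functor.map (λ_ a).hom =
      (left.iso a (𝟙_ A)).hom ≫ N.functor.map (ρ_ a).hom

/-- The isomorphisms `D⁻¹ ⊗ a^∨∨ ≅ ^∨∨a ⊗ D⁻¹` obtained from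
`N^r(𝟙) ⊗ a^∨∨ ≅ N^r(𝟙 ⊗ a) ≅ N^r(a) ≅ N^r(a ⊗ 𝟙) ≅ ^∨∨a ⊗ N^r(𝟙)`. -/
structure RightNakayama.Radford (N : RightNakayama k A) where
  /-- the left module structure of `N^r` on the regular bimodule category -/
  left : N.ModuleStr A
  /-- the right module structure of `N^r` on the regular bimodule category -/
  right : N.RightModuleStr
  /-- the isomorphisms `D⁻¹ ⊗ a^∨∨ ≅ ^∨∨a ⊗ D⁻¹` -/
  iso (a : A) : N.distInv ⊗ rr a ≅ ll a ⊗ N.distInv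
  spec (a : A) :
    N.functor.map (λ_ a).inv ≫ (right.iso (𝟙_ A) a).hom ≫ (iso a).hom =
      N.functor.map (ρ_ a).inv ≫ (left.iso a (𝟙_ A)).hom

end NakayamaModule

/-! ### Inner Hom and relative Serre functors -/

section Serre

variable (A : Type u) [Category.{v} A] [MonoidalCategory A]
variable (M : Type u') [Category.{v'} M] [MonoidalLeftAction A M]

/-- An inner Hom for the `A`-module category `M`: a bifunctor `IHom : Mᵒᵖ × M → A` with
isomorphisms `Hom(a.m, n) ≅ Hom(a, IHom(m, n))` natural in `a`, `m` and `n`. -/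
structure InnerHom where
  /-- the bifunctor -/
  functor : Mᵒᵖ ⥤ M ⥤ A
  /-- the natural isomorphisms -/
  adj : (MonoidalLeftAction.curriedAction A M).flip ⊣₂ functor

variable {A M}

namespace InnerHom

variable (H : InnerHom A M)

/-- The object `IHom(m, n)`. -/
abbrev hom (m n : M) : A := (H.functor.obj (op m)).obj n

/-- Contravariance in the first variable. -/
abbrev pre {m m' : M} (f : m ⟶ m') (n : M) : H.hom m' n ⟶ H.hom m n := (H.functor.map f.op).app n

/-- Covariance in the second variable. -/
abbrev post (m : M) {n n' : M} (g : n ⟶ n') : H.hom m n ⟶ H.hom m n' :=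
  (H.functor.obj (op m)).map g

/-- The bijection `Hom(a.m, n) ≃ Hom(a, IHom(m, n))`. -/
def homEquiv {a : A} {m n : M} : (a ⊙ₗ m ⟶ n) ≃ (a ⟶ H.hom m n) := H.adj.homEquiv

/-- The evaluation `IHom(m, n).m ⟶ n`. -/
def ev (m n : M) : H.hom m n ⊙ₗ m ⟶ n := H.homEquiv.symm (𝟙 _)

/-- The canonical morphism `a ⊗ IHom(m, n) ⟶ IHom(m, a.n)`. -/
def actPost (a : A) (m n : M) : a ⊗ H.hom m n ⟶ H.hom m (a ⊙ₗ n) :=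
  H.homEquiv ((αₗ a (H.hom m n) m).hom ≫ a ⊴ₗ H.ev m n)

/-- For `Y` a right dual of `X`: the canonical morphism `IHom(m, n) ⊗ Y ⟶ IHom(X.m, n)`. -/
def actPre (X Y : A) [ExactPairing X Y] (m n : M) : H.hom m n ⊗ Y ⟶ H.hom (X ⊙ₗ m) n :=
  H.homEquiv ((αₗ (H.hom m n) Y (X ⊙ₗ m)).hom ≫ H.hom m n ⊴ₗ actCounit X Y m ≫ H.ev m n)

end InnerHom

variable [RigidCategory A]

/-- A left relative Serre functor: an endofunctor `S` of `M` with isomorphisms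
`^∨IHom(m, n) ≅ IHom(S n, m)` natural in `m` and `n`. -/
structure LeftRelativeSerre (H : InnerHom A M) where
  /-- the endofunctor -/
  functor : M ⥤ M
  /-- the isomorphisms -/
  iso (m n : M) : HasLeftDual.leftDual (H.hom m n) ≅ H.hom (functor.obj n) m
  naturality_fst {m m' : M} (f : m ⟶ m') (n : M) :
    (iso m n).hom ≫ H.post (functor.obj n) f = leftAdjointMate (H.pre f n) ≫ (iso m' n).hom
  naturality_snd (m : M) {n n' : M} (g : n ⟶ n') :
    (iso m n').hom ≫ H.pre (functor.map g) m = leftAdjointMate (H.post m g) ≫ (iso m n).hom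

/-- A right relative Serre functor: an endofunctor `S` of `M` with isomorphisms
`IHom(m, n)^∨ ≅ IHom(n, S m)` natural in `m` and `n`. -/
structure RightRelativeSerre (H : InnerHom A M) where
  /-- the endofunctor -/
  functor : M ⥤ M
  /-- the isomorphisms -/
  iso (m n : M) : HasRightDual.rightDual (H.hom m n) ≅ H.hom n (functor.obj m)
  naturality_fst {m m' : M} (f : m ⟶ m') (n : M) :
    (iso m n).hom ≫ H.post n (functor.map f) = rightAdjointMate (H.pre f n) ≫ (iso m' n).hom
  naturality_snd (m : M) {n n' : M} (g : n ⟶ n') :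
    (iso m n').hom ≫ H.pre g (functor.obj m) = rightAdjointMate (H.post m g) ≫ (iso m n).hom

variable {H : InnerHom A M}

/-- The isomorphisms `^∨IHom(-, n) ≅ IHom(S n, -)` are isomorphisms of module functors, where
`^∨IHom(a.z, n) ≅ ^∨(IHom(z, n) ⊗ a^∨) ≅ a ⊗ ^∨IHom(z, n)` and
`a ⊗ IHom(S n, z) ≅ IHom(S n, a.z)`. -/
def LeftRelativeSerre.IsModuleNatural (S : LeftRelativeSerre H) : Prop :=
  ∀ (a : A) (z n : M),
    (S.iso (a ⊙ₗ z) n).hom =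
      leftAdjointMate (H.actPre a (HasRightDual.rightDual a) z n) ≫
        (leftDualIso (HasLeftDual.exact (Y := H.hom z n ⊗ HasRightDual.rightDual a))
          (ExactPairing.tensor (X₁ := a) (X₂ := HasLeftDual.leftDual (H.hom z n)))).hom ≫
        a ◁ (S.iso z n).hom ≫ H.actPost a (S.functor.obj n) z

/-- The isomorphisms `IHom(m, -)^∨ ≅ IHom(-, S m)` are isomorphisms of module functors, where
`IHom(m, a.z)^∨ ≅ (a ⊗ IHom(m, z))^∨ ≅ IHom(m, z)^∨ ⊗ a^∨` and
`IHom(z, S m) ⊗ a^∨ ≅ IHom(a.z, S m)`. -/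
def RightRelativeSerre.IsModuleNatural (S : RightRelativeSerre H) : Prop :=
  ∀ (a : A) (m z : M),
    (S.iso m (a ⊙ₗ z)).hom =
      rightAdjointMate (H.actPost a m z) ≫ (rightDualTensorIso a (H.hom m z)).hom ≫
        (S.iso m z).hom ▷ HasRightDual.rightDual a ≫
        H.actPre a (HasRightDual.rightDual a) z (S.functor.obj m)

/-- The canonical isomorphisms `^∨∨a.S(m) ≅ S(a.m)` of a left relative Serre functor. They are
uniquely determined by `spec`: the induced map `IHom(S(a.m), n) ⟶ IHom(^∨∨a.S(m), n)` is
`IHom(S(a.m), n) ≅ ^∨IHom(n, a.m) ≅ ^∨IHom(n, m) ⊗ ^∨a ≅ IHom(S m, n) ⊗ ^∨a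
≅ IHom(^∨∨a.S(m), n)`. -/
structure LeftRelativeSerre.ModuleStr (S : LeftRelativeSerre H) where
  /-- the structure isomorphisms -/
  iso (a : A) (m : M) : ll a ⊙ₗ S.functor.obj m ≅ S.functor.obj (a ⊙ₗ m)
  spec (a : A) (m n : M) :
    (S.iso n (a ⊙ₗ m)).hom ≫ H.pre (iso a m).hom n =
      leftAdjointMate (H.actPost a n m) ≫ (leftDualTensorIso a (H.hom n m)).hom ≫
        (S.iso n m).hom ▷ HasLeftDual.leftDual a ≫
        H.actPre (ll a) (HasLeftDual.leftDual a) (S.functor.obj m) n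

/-- The canonical isomorphisms `S(a.m) ≅ a^∨∨.S(m)` of a right relative Serre functor. They are
uniquely determined by `spec`: the induced map `IHom(n, S(a.m)) ⟶ IHom(n, a^∨∨.S(m))` is
`IHom(n, S(a.m)) ≅ IHom(a.m, n)^∨ ≅ a^∨∨ ⊗ IHom(m, n)^∨ ≅ a^∨∨ ⊗ IHom(n, S m)
≅ IHom(n, a^∨∨.S(m))`. -/
structure RightRelativeSerre.ModuleStr (S : RightRelativeSerre H) where
  /-- the structure isomorphisms -/
  iso (a : A) (m : M) : S.functor.obj (a ⊙ₗ m) ≅ rr a ⊙ₗ S.functor.obj m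
  spec (a : A) (m n : M) :
    (S.iso (a ⊙ₗ m) n).hom ≫ H.post n (iso a m).hom =
      rightAdjointMate (H.actPre a (HasRightDual.rightDual a) m n) ≫
        (rightDualTensorIso (H.hom m n) (HasRightDual.rightDual a)).hom ≫
        rr a ◁ (S.iso m n).hom ≫ H.actPost (rr a) n (S.functor.obj m)

end Serre

/-! ### Isomorphisms of twisted module functors -/

section ModuleIso

variable {k : Type w} [Field k]
variable {A : Type u} [Category.{v} A] [Abelian A] [Linear k A] [MonoidalCategory A]
  [MonoidalPreadditive A] [MonoidalLinear k A] [RigidCategory A] [IsFiniteLinear k A]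
variable {M : Type u'} [Category.{v'} M] [Abelian M] [Linear k M] [IsFiniteLinear k M]
  [MonoidalLeftAction A M] [BilinearAction k A M]

/-- The functor `D.S : m ↦ D.S(m)`. -/
abbrev actComp (D : A) (S : M ⥤ M) : M ⥤ M := S ⋙ MonoidalLeftAction.actionLeft M D

/-- A natural isomorphism `θ : N^l_M ≅ D.S^l_M` is compatible with the structures of the two
functors as module functors from `M` to `M` with the action twisted by the double right dual:
`a^∨∨.N^l(m) ≅ N^l(a.m)` and `a^∨∨.D.S(m) ≅ D.^∨∨a.S(m) ≅ D.S(a.m)`. -/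
def IsLeftModuleIso {N : LeftNakayama k M} {NA : LeftNakayama k A} {H : InnerHom A M}
    {S : LeftRelativeSerre H} (μ : N.ModuleStr A) (r : NA.Radford) (σ : S.ModuleStr)
    (θ : N.functor ≅ actComp NA.dist S.functor) : Prop :=
  ∀ (a : A) (m : M),
    (μ.iso a m).hom ≫ θ.hom.app (a ⊙ₗ m) =
      rr a ⊴ₗ θ.hom.app m ≫ (αₗ (rr a) NA.dist (S.functor.obj m)).inv ≫
        (r.iso a).hom ⊵ₗ S.functor.obj m ≫ (αₗ NA.dist (ll a) (S.functor.obj m)).hom ≫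
        NA.dist ⊴ₗ (σ.iso a m).hom

/-- A natural isomorphism `θ : N^r_M ≅ D⁻¹.S^r_M` is compatible with the structures of the two
functors as module functors from `M` to `M` with the action twisted by the double left dual:
`N^r(a.m) ≅ ^∨∨a.N^r(m)` and `D⁻¹.S(a.m) ≅ D⁻¹.a^∨∨.S(m) ≅ ^∨∨a.D⁻¹.S(m)`. -/
def IsRightModuleIso {N : RightNakayama k M} {NA : RightNakayama k A} {H : InnerHom A M}
    {S : RightRelativeSerre H} (δ : N.ModuleStr A) (r : NA.Radford) (σ : S.ModuleStr)
    (θ : N.functor ≅ actComp NA.distInv S.functor) : Prop :=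
  ∀ (a : A) (m : M),
    (δ.iso a m).hom ≫ ll a ⊴ₗ θ.hom.app m =
      θ.hom.app (a ⊙ₗ m) ≫ NA.distInv ⊴ₗ (σ.iso a m).hom ≫
        (αₗ NA.distInv (rr a) (S.functor.obj m)).inv ≫
        (r.iso a).hom ⊵ₗ S.functor.obj m ≫ (αₗ (ll a) NA.distInv (S.functor.obj m)).hom

end ModuleIso

end NakayamaSerre

end

open NakayamaSerre

/-!
The proof rests on the description of `N^l` and `N^r` by their components. A morphism `z ⟶ N^l(y)`
is the same as a natural family of linear maps `Hom(x, y)^* → Hom(z, x)`, and dually for `N^r`.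
Because of this, a `k`-linear functor `G` with a left adjoint that is itself left adjoint to `L`
carries Nakayama functors to Nakayama functors: `G(N^l(y)) ≅ N^l(Y)` whenever `Y` represents
`x ↦ Hom(L(x), y)` (`LeftNakayama.exists_comparison`, `RightNakayama.exists_comparison`). For `G`
the action of a double dual this gives the twisted module structures of `N^l` and `N^r`.

For the comparison with relative Serre functors, `G` is `a ↦ a.S(n)`, whose right adjoint is the
inner Hom `IHom(S(n), -)`. The isomorphisms `^∨IHom(m, n) ≅ IHom(S(n), m)` are the same as
evaluation pairings `IHom(m, n) ⊗ IHom(S(n), m) ⟶ 𝟙`. Module naturality of `S` says that the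
pairings are balanced over `A`, and then they are the composition followed by a "trace"
`τ : IHom(S(n), n) ⟶ 𝟙` (`InnerHom.IsBalanced.eq_comp`, `LeftRelativeSerre.exists_isTrace`).
Composition with such a perfect trace identifies `Hom(x, n)` with `Hom(IHom(S(n), x), 𝟙)`, so the
comparison yields `D.S(n) = N^l_A(𝟙).S(n) ≅ N^l_M(n)`
(`LeftNakayama.exists_iso_of_isPerfect`). Since everything is given by explicit components, the
compatibility with the twisted module structures can be checked on components
(`LeftRelativeSerre.IsTrace.exists_moduleIso`); a general relative Serre functor is isomorphic to
a module natural one (`LeftRelativeSerre.nonempty_iso`).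

Existence of all objects is a matter of representing left exact functors to finite-dimensional
vector spaces (`IsProjectiveSeparator.exists_universal`, `exists_couniversal`). Exactness of the
module category enters by making the inner Hom exact in both variables, so that the functors
`Hom(IHom(m, -), 𝟙)` and `Hom(IHom(-, n), 𝟙)` are left exact; the objects that represent them
carry perfect traces.

For the invertibility of `D`, there is a canonical transformation `y ⟶ N^l(N^r(y))`, invertible on
projective objects `P`, where `N^r(P)` is the Serre dual, representing `Hom(P, -)^*`. By the
comparison for the regular module category and since relative Serre functors are equivalences,
`N^l` and `N^r` are right exact, whence `𝟙 ≅ N^l(N^r(𝟙)) ≅ D ⊗ ^∨∨(D⁻¹)`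
(`nonempty_dist_tensor_distInv`).
-/

open CategoryTheory MonoidalCategory Limits Opposite
open scoped MonoidalLeftAction

noncomputable section

namespace NakayamaSerre

universe w v v' u u'

attribute [local instance] Abelian.hasFiniteBiproducts

/-! ### Copowers as powers -/

namespace copower

variable {k : Type w} [Field k] {C : Type u} [Category.{v} C] [Abelian C] [Linear k C]
variable {V : Type v'} [AddCommGroup V] [Module k V] [FiniteDimensional k V]

lemma ι_desc_assoc {x z z' : C} (f : V →ₗ[k] (x ⟶ z)) (v : V) (g : z ⟶ z') :
    ι x v ≫ desc f ≫ g = f v ≫ g := by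
  rw [← Category.assoc, ι_desc]

lemma sum_coord_ι (x : C) :
    ∑ i, desc (((Module.finBasis k V).coord i).smulRight (𝟙 x)) ≫ ι x (Module.finBasis k V i) =
      𝟙 (copower k V x) := by
  refine hom_ext fun v => ?_
  rw [Preadditive.comp_sum, Category.comp_id]
  conv_rhs => rw [← (Module.finBasis k V).sum_repr v, map_sum]
  simp [ι_desc_assoc]

/-- The morphism `z ⟶ V ⊗ x` corresponding to a linear map `V^* → Hom(z, x)`. -/
def lift {z x : C} (t : Module.Dual k V →ₗ[k] (z ⟶ x)) : z ⟶ copower k V x :=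
  ∑ i, t ((Module.finBasis k V).coord i) ≫ ι x (Module.finBasis k V i)

lemma lift_desc {z x : C} (t : Module.Dual k V →ₗ[k] (z ⟶ x)) (ξ : Module.Dual k V) :
    lift t ≫ desc (ξ.smulRight (𝟙 x)) = t ξ := by
  rw [lift, Preadditive.sum_comp]
  simp only [Category.assoc, ι_desc, LinearMap.smulRight_apply, Linear.comp_smul, Category.comp_id]
  conv_rhs => rw [← (Module.finBasis k V).sum_dual_apply_smul_coord ξ, map_sum]
  simp only [map_smul]

lemma hom_ext_desc {z x : C} {f g : z ⟶ copower k V x}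
    (h : ∀ ξ : Module.Dual k V, f ≫ desc (ξ.smulRight (𝟙 x)) = g ≫ desc (ξ.smulRight (𝟙 x))) :
    f = g := by
  rw [← Category.comp_id f, ← Category.comp_id g, ← sum_coord_ι, Preadditive.comp_sum,
    Preadditive.comp_sum]
  refine Finset.sum_congr rfl fun i _ => ?_
  rw [← Category.assoc, h, Category.assoc]

lemma map_desc {W : Type u'} [AddCommGroup W] [Module k W] [FiniteDimensional k W]
    (f : V →ₗ[k] W) {x y : C} (g : x ⟶ y) (ξ : Module.Dual k W) :
    map f g ≫ desc (ξ.smulRight (𝟙 y)) = desc ((ξ.comp f).smulRight (𝟙 x)) ≫ g :=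
  hom_ext fun v => by simp [ι_desc_assoc]

instance projective (P : C) [Projective P] : Projective (copower k V P) where
  factors f e _ :=
    ⟨desc ((Module.finBasis k V).constr k fun i =>
        Projective.factorThru (ι P (Module.finBasis k V i) ≫ f) e), hom_ext fun v => by
      rw [ι_desc_assoc]
      refine LinearMap.congr_fun (f := (Linear.rightComp k P e).comp _)
        (g := (Linear.rightComp k P f).comp (ι P)) ((Module.finBasis k V).ext fun i => ?_) v
      simp⟩

end copower

/-! ### Representable functors on finite linear categories -/

section Representability

variable {k : Type w} [Field k] {C : Type u} [Category.{v} C] [Abelian C] [Linear k C]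

/-- `P` is projective and morphisms are determined by their composites with morphisms out of `P`. -/
structure IsProjectiveSeparator (P : C) : Prop where
  projective : Projective P
  eq_zero {x y : C} (f : x ⟶ y) (h : ∀ p : P ⟶ x, p ≫ f = 0) : f = 0

/-- The regular module of a finite-dimensional algebra is a projective separator. -/
lemma exists_isProjectiveSeparator (k : Type w) [Field k] (C : Type u) [Category.{v} C] [Abelian C]
    [Linear k C] [IsFiniteLinear k C] : ∃ P : C, IsProjectiveSeparator P := by
  obtain ⟨B, _, _, _, e, he, -⟩ := IsFiniteLinear.exists_equivalence (k := k) (C := C)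
  let R : FGModuleCat.{w} B := ⟨ModuleCat.of B B, inferInstanceAs (Module.Finite B B)⟩
  have elt (X : FGModuleCat.{w} B) (t : X.obj) : ∃ f : R ⟶ X, f.hom.hom (1 : B) = t :=
    ⟨⟨ModuleCat.ofHom (LinearMap.toSpanSingleton B X.obj t)⟩, one_smul B t⟩
  have hz {X Y : FGModuleCat.{w} B} (f : X ⟶ Y) (h : ∀ p : R ⟶ X, p ≫ f = 0) : f = 0 := by
    apply FGModuleCat.hom_ext
    ext t
    obtain ⟨p, rfl⟩ := elt X t
    exact congr_arg (fun g : R ⟶ Y => g.hom.hom (1 : B)) (h p)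
  have surj {X Y : FGModuleCat.{w} B} (f : X ⟶ Y) [Epi f] (t : Y.obj) :
      ∃ s : X.obj, f.hom.hom s = t := by
    let Q : FGModuleCat.{w} B := ⟨ModuleCat.of B (Y.obj ⧸ LinearMap.range f.hom.hom),
      have : Module.Finite B Y.obj := Y.property
      inferInstanceAs (Module.Finite B (Y.obj ⧸ LinearMap.range f.hom.hom))⟩
    let q : Y ⟶ Q := ⟨ModuleCat.ofHom (LinearMap.range f.hom.hom).mkQ⟩
    have hq : q = 0 := by
      rw [← cancel_epi f, comp_zero]
      apply FGModuleCat.hom_ext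
      ext s
      exact (Submodule.Quotient.mk_eq_zero _).2 ⟨s, rfl⟩
    exact (Submodule.Quotient.mk_eq_zero _).1 (congr_arg (fun g : Y ⟶ Q => g.hom.hom t) hq)
  have hR : Projective R := ⟨fun {E X} f g hg => by
    obtain ⟨s, hs⟩ := surj g (f.hom.hom (1 : B))
    obtain ⟨p, hp⟩ := elt E s
    refine ⟨p, sub_eq_zero.1 ?_⟩
    apply FGModuleCat.hom_ext
    apply LinearMap.ext_ring
    change g.hom.hom (p.hom.hom (1 : B)) - f.hom.hom (1 : B) = 0
    rw [hp, hs, sub_self]⟩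
  refine ⟨e.inverse.obj R, e.symm.map_projective_iff R |>.2 hR, fun {x y} f h => ?_⟩
  have : e.functor.map f = 0 := hz _ fun p => by
    have := h (e.symm.toAdjunction.homEquiv _ _ |>.symm p)
    rw [← Adjunction.homEquiv_naturality_right_symm] at this
    apply (e.symm.toAdjunction.homEquiv _ _).symm.injective
    exact this.trans (by simp [Adjunction.homEquiv_counit])
  exact e.functor.map_injective (by rw [this, e.functor.map_zero])

/-- A contravariant `k`-linear functor to vector spaces that sends cokernels to kernels, given by
its values `F x` and by the bilinear maps `Hom(x, y) → Hom(F y, F x)`. -/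
structure LeftExactPresheaf (k : Type w) [Field k] (C : Type u) [Category.{v} C] [Abelian C]
    [Linear k C] (F : C → Type u') [∀ x, AddCommGroup (F x)] [∀ x, Module k (F x)] where
  /-- the action of morphisms -/
  map {x y : C} : (x ⟶ y) →ₗ[k] F y →ₗ[k] F x
  map_id (x : C) (u : F x) : map (𝟙 x) u = u
  map_comp {x y z : C} (f : x ⟶ y) (g : y ⟶ z) (u : F z) : map (f ≫ g) u = map f (map g u)
  exact {x y z : C} (f : x ⟶ y) (g : y ⟶ z) (w : f ≫ g = 0)
    (_ : IsColimit (CokernelCofork.ofπ g w)) (u : F y) (_ : map f u = 0) : ∃! v, map g v = u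

namespace LeftExactPresheaf

variable {F : C → Type u'} [∀ x, AddCommGroup (F x)] [∀ x, Module k (F x)]
  (m : LeftExactPresheaf k C F)

lemma injective_of_epi {x y : C} (g : x ⟶ y) [Epi g] : Function.Injective (m.map g) := by
  refine (injective_iff_map_eq_zero _).2 fun u hu => ?_
  have hc := Abelian.epiIsCokernelOfKernel _ (limit.isLimit (parallelPair g 0))
  obtain ⟨v, -, hv⟩ := m.exact _ g (kernel.condition g) hc 0 (map_zero _)
  exact (hv u hu).trans (hv 0 (map_zero _)).symm

lemma copower_ext {V : Type v'} [AddCommGroup V] [Module k V] [FiniteDimensional k V] {x : C}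
    {u u' : F (copower k V x)} (h : ∀ v : V, m.map (copower.ι x v) u = m.map (copower.ι x v) u') :
    u = u' := by
  rw [← m.map_id _ u, ← m.map_id _ u', ← copower.sum_coord_ι]
  simp only [map_sum, LinearMap.sum_apply, m.map_comp, h]

lemma exists_copower {V : Type v'} [AddCommGroup V] [Module k V] [FiniteDimensional k V] {x : C}
    (φ : V →ₗ[k] F x) : ∃ u : F (copower k V x), ∀ v : V, m.map (copower.ι x v) u = φ v := by
  refine ⟨∑ i, m.map (copower.desc (((Module.finBasis k V).coord i).smulRight (𝟙 x)))
    (φ (Module.finBasis k V i)), fun v => ?_⟩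
  simp only [map_sum, ← m.map_comp, copower.ι_desc, LinearMap.smulRight_apply, map_smul,
    LinearMap.smul_apply, m.map_id]
  conv_rhs => rw [← (Module.finBasis k V).sum_repr v, map_sum]
  simp

end LeftExactPresheaf

variable [∀ x y : C, FiniteDimensional k (x ⟶ y)]

namespace IsProjectiveSeparator

variable {P : C} (hP : IsProjectiveSeparator P)
include hP

lemma epi_desc (x : C) : Epi (copower.desc (LinearMap.id : (P ⟶ x) →ₗ[k] (P ⟶ x))) :=
  Preadditive.epi_of_cancel_zero _ fun f hf => hP.eq_zero f fun p => by
    have := congr_arg (copower.ι P p ≫ ·) hf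
    simpa [copower.ι_desc_assoc] using this

/-- A left exact presheaf with `F P` finite-dimensional is representable: it has a universal
element.

The representing object is the cokernel of `K ⊗ P ⟶ F P ⊗ P`, where `K` is the kernel of the
canonical map `Hom(P, F P ⊗ P) → F P`. -/
theorem exists_universal {F : C → Type u'} [∀ x, AddCommGroup (F x)] [∀ x, Module k (F x)]
    (m : LeftExactPresheaf k C F) [FiniteDimensional k (F P)] :
    ∃ (X : C) (u : F X), ∀ x, Function.Bijective fun f : x ⟶ X => m.map f u := by
  have := hP.projective
  obtain ⟨e, he⟩ := m.exists_copower (LinearMap.id : F P →ₗ[k] F P)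
  let K : Submodule k (P ⟶ copower k (F P) P) := LinearMap.ker (m.map.flip e)
  let j : copower k K P ⟶ copower k (F P) P := copower.desc K.subtype
  have hj : m.map j e = 0 := m.copower_ext fun v => by
    rw [← m.map_comp, copower.ι_desc, map_zero]
    exact v.2
  obtain ⟨u, hu, -⟩ := m.exact j _ (cokernel.condition j) (cokernelIsCokernel j) e hj
  have injP (f : P ⟶ cokernel j) (hf : m.map f u = 0) : f = 0 := by
    obtain ⟨f', rfl⟩ : ∃ f', f' ≫ cokernel.π j = f := ⟨_, Projective.factorThru_comp f _⟩
    rw [m.map_comp, hu] at hf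
    have : copower.ι P (⟨f', hf⟩ : K) ≫ j = f' := copower.ι_desc _ _
    rw [← this, Category.assoc, cokernel.condition, comp_zero]
  have inj {x : C} (f : x ⟶ cokernel j) (hf : m.map f u = 0) : f = 0 :=
    hP.eq_zero f fun p => injP _ (by rw [m.map_comp, hf, map_zero])
  let b : F P →ₗ[k] (P ⟶ cokernel j) :=
    (Linear.rightComp k P (cokernel.π j)).comp (copower.ι P)
  have hb (t : F P) : m.map (b t) u = t := by
    change m.map (copower.ι P t ≫ cokernel.π j) u = t
    rw [m.map_comp, hu, he]
    rfl
  refine ⟨cokernel j, u, fun x => ⟨fun f g hfg => ?_, fun t => ?_⟩⟩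
  · refine sub_eq_zero.1 (inj _ ?_)
    rw [map_sub, LinearMap.sub_apply, sub_eq_zero]
    exact hfg
  · let p : copower k (P ⟶ x) P ⟶ x := copower.desc LinearMap.id
    have : Epi p := hP.epi_desc x
    let g : copower k (P ⟶ x) P ⟶ cokernel j := copower.desc (b.comp (m.map.flip t))
    have hg : m.map g u = m.map p t := m.copower_ext fun h => by
      rw [← m.map_comp, ← m.map_comp, copower.ι_desc, copower.ι_desc]
      exact hb _
    have hker : kernel.ι p ≫ g = 0 := inj _ (by
      rw [m.map_comp, hg, ← m.map_comp, kernel.condition, map_zero, LinearMap.zero_apply])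
    refine ⟨Abelian.epiDesc p g hker, m.injective_of_epi p ?_⟩
    change m.map p (m.map _ u) = _
    rw [← m.map_comp, Abelian.comp_epiDesc, hg]

/-- The Serre dual of a projective object `Q` represents `x ↦ Hom(Q, x)^*`. -/
lemma exists_serreDual (Q : C) [Projective Q] : ∃ (I : C) (τ : Module.Dual k (Q ⟶ I)),
    ∀ x, Function.Bijective fun f : x ⟶ I => τ.comp (Linear.rightComp k Q f) := by
  refine hP.exists_universal (F := fun x => Module.Dual k (Q ⟶ x))
    { map := fun {x y} => LinearMap.mk₂ k (fun f u => u.comp (Linear.rightComp k Q f))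
        (fun f g u => by ext; simp) (fun c f u => by ext; simp)
        (fun f u u' => by ext; simp) (fun c f u => by ext; simp)
      map_id := fun x u => by ext; simp
      map_comp := fun f g u => by ext; simp
      exact := fun {x y z} f g w hc u hu => ?_ }
  have : Epi g := Cofork.IsColimit.epi hc
  have hs : Function.Surjective (Linear.rightComp k Q g) := fun p =>
    ⟨Projective.factorThru p g, Projective.factorThru_comp p g⟩
  have hu' : u ∈ (LinearMap.ker (Linear.rightComp k Q g)).dualAnnihilator := by
    refine (Submodule.mem_dualAnnihilator _).2 fun p hp => ?_
    have hex : (ShortComplex.mk f g w).Exact := ShortComplex.exact_of_g_is_cokernel _ hc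
    have := LinearMap.congr_fun hu (hex.liftFromProjective p hp)
    rw [← hex.liftFromProjective_comp p hp]
    simpa using this
  rw [← LinearMap.range_dualMap_eq_dualAnnihilator_ker] at hu'
  obtain ⟨t, ht⟩ := hu'
  refine ⟨t, ht, fun t' ht' => ?_⟩
  ext p
  obtain ⟨p, rfl⟩ := hs p
  exact (LinearMap.congr_fun ht' p).trans (LinearMap.congr_fun ht p).symm

end IsProjectiveSeparator

end Representability

/-- The opposite category has a projective separator as well: the Serre dual of `P`. -/
lemma IsProjectiveSeparator.exists_op (k : Type w) [Field k] {C : Type u} [Category.{v} C]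
    [Abelian C] [Linear k C] [∀ x y : C, FiniteDimensional k (x ⟶ y)] {P : C}
    (hP : IsProjectiveSeparator P) : ∃ I : Cᵒᵖ, IsProjectiveSeparator I := by
  have := hP.projective
  obtain ⟨I, τ, hτ⟩ := hP.exists_serreDual (k := k) P
  have key {x y : C} (f : x ⟶ y) (h : ∀ q : y ⟶ I, f ≫ q = 0) : f = 0 := by
    refine hP.eq_zero f fun p => ?_
    rw [← Module.forall_dual_apply_eq_zero_iff k]
    intro u
    obtain ⟨q, rfl⟩ := (hτ y).2 u
    simp [h q]
  have hI : Injective I := ⟨fun {x y} g f hf => by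
    have hinj : Function.Injective (Linear.rightComp k P f) := fun a b hab => by
      simpa [cancel_mono] using hab
    obtain ⟨t, ht⟩ := LinearMap.dualMap_surjective_of_injective hinj
      (τ.comp (Linear.rightComp k P g))
    obtain ⟨q, rfl⟩ := (hτ y).2 t
    refine ⟨q, (hτ x).1 ?_⟩
    dsimp only
    rw [← ht]
    ext; simp⟩
  exact ⟨op I, inferInstance, fun f h => Quiver.Hom.unop_inj (key f.unop fun q =>
    Quiver.Hom.op_inj (h q.op))⟩

/-- Enough projectives from a projective separator. -/
lemma IsProjectiveSeparator.enoughProjectives (k : Type w) [Field k] {C : Type u} [Category.{v} C]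
    [Abelian C] [Linear k C] [∀ x y : C, FiniteDimensional k (x ⟶ y)] {P : C}
    (hP : IsProjectiveSeparator P) : EnoughProjectives C where
  presentation x :=
    have := hP.projective
    have := hP.epi_desc (k := k) x
    ⟨{ p := copower k (P ⟶ x) P, f := copower.desc LinearMap.id }⟩

/-! ### Corepresentable functors -/

section Opposite

variable {k : Type w} [Field k] {C : Type u} [Category.{v} C] [Abelian C] [Linear k C]

/-- The opposite of a linear category is linear. -/
instance linearOp : Linear k Cᵒᵖ where
  homModule x y := Equiv.module k (opEquiv x y)
  smul_comp _ _ _ r f g := Quiver.Hom.unop_inj (Linear.comp_smul _ _ _ g.unop r f.unop)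
  comp_smul _ _ _ f r g := Quiver.Hom.unop_inj (Linear.smul_comp _ _ _ r g.unop f.unop)

/-- Passing to the opposite category is linear on morphism spaces. -/
def opLinearEquiv (x y : C) : (op y ⟶ op x) ≃ₗ[k] (x ⟶ y) where
  toFun f := f.unop
  invFun f := f.op
  map_add' _ _ := rfl
  map_smul' _ _ := rfl
  left_inv _ := rfl
  right_inv _ := rfl

/-- A covariant `k`-linear functor to vector spaces that preserves kernels, given by its
values `F x` and by the bilinear maps `Hom(x, y) → Hom(F x, F y)`. -/
structure LeftExactCopresheaf (k : Type w) [Field k] (C : Type u) [Category.{v} C] [Abelian C]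
    [Linear k C] (F : C → Type u') [∀ x, AddCommGroup (F x)] [∀ x, Module k (F x)] where
  /-- the action of morphisms -/
  map {x y : C} : (x ⟶ y) →ₗ[k] F x →ₗ[k] F y
  map_id (x : C) (u : F x) : map (𝟙 x) u = u
  map_comp {x y z : C} (f : x ⟶ y) (g : y ⟶ z) (u : F x) : map (f ≫ g) u = map g (map f u)
  exact {x y z : C} (f : x ⟶ y) (g : y ⟶ z) (w : f ≫ g = 0)
    (_ : IsLimit (KernelFork.ofι f w)) (u : F y) (_ : map g u = 0) : ∃! v, map f v = u

/-- In a finite linear category, a left exact copresheaf with finite-dimensional values is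
corepresentable. -/
theorem exists_couniversal [IsFiniteLinear k C]
    {F : C → Type u'} [∀ x, AddCommGroup (F x)] [∀ x, Module k (F x)]
    (m : LeftExactCopresheaf k C F) [∀ x, FiniteDimensional k (F x)] :
    ∃ (X : C) (u : F X), ∀ x, Function.Bijective fun f : X ⟶ x => m.map f u := by
  obtain ⟨P, hP⟩ := exists_isProjectiveSeparator k C
  obtain ⟨I, hI⟩ := hP.exists_op k
  have (x y : Cᵒᵖ) : FiniteDimensional k (x ⟶ y) :=
    (opLinearEquiv (k := k) y.unop x.unop).symm.finiteDimensional
  let m' : LeftExactPresheaf k Cᵒᵖ (fun x => F x.unop) :=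
    { map := fun {x y} => m.map.comp (opLinearEquiv (k := k) y.unop x.unop).toLinearMap
      map_id := fun x u => m.map_id _ u
      map_comp := fun f g u => m.map_comp g.unop f.unop u
      exact := fun f g w hc u hu =>
        m.exact g.unop f.unop (Quiver.Hom.op_inj w) (CokernelCofork.IsColimit.ofπUnop _ _ hc) u hu }
  have : FiniteDimensional k ((fun x : Cᵒᵖ => F x.unop) I) := inferInstanceAs
    (FiniteDimensional k (F I.unop))
  obtain ⟨X, u, h⟩ := hI.exists_universal m'
  exact ⟨X.unop, u, fun x => (h (op x)).comp (opEquiv (op x) X).symm.bijective⟩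

end Opposite

/-! ### Components of the Nakayama functors -/

section NakayamaComponents

variable {k : Type w} [Field k] {C : Type u} [Category.{v} C] [Abelian C] [Linear k C]

/-- The families of linear maps `Hom(x, y)^* → Hom(z, x)` natural in `x`. They correspond to the
morphisms from `z` into the end `∫_x Hom(x, y) ⊗ x`. -/
def leftFamilies (k : Type w) [Field k] {C : Type u} [Category.{v} C] [Abelian C] [Linear k C]
    (y z : C) : Submodule k (∀ x : C, Module.Dual k (x ⟶ y) →ₗ[k] (z ⟶ x)) where
  carrier := {t | ∀ ⦃x x' : C⦄ (f : x ⟶ x') (ξ : Module.Dual k (x ⟶ y)),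
    t x ξ ≫ f = t x' (ξ.comp (Linear.leftComp k y f))}
  add_mem' hs ht x x' f ξ := by simp [hs f ξ, ht f ξ]
  zero_mem' x x' f ξ := by simp
  smul_mem' c t ht x x' f ξ := by simp [ht f ξ]

/-- The families of linear maps `Hom(y, x)^* → Hom(x, z)` natural in `x`. They correspond to the
morphisms to `z` from the coend `∫^x Hom(y, x)^* ⊗ x`. -/
def rightFamilies (k : Type w) [Field k] {C : Type u} [Category.{v} C] [Abelian C] [Linear k C]
    (y z : C) : Submodule k (∀ x : C, Module.Dual k (y ⟶ x) →ₗ[k] (x ⟶ z)) where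
  carrier := {t | ∀ ⦃x x' : C⦄ (f : x' ⟶ x) (ξ : Module.Dual k (y ⟶ x)),
    f ≫ t x ξ = t x' (ξ.comp (Linear.rightComp k y f))}
  add_mem' hs ht x x' f ξ := by simp [hs f ξ, ht f ξ]
  zero_mem' x x' f ξ := by simp
  smul_mem' c t ht x x' f ξ := by simp [ht f ξ]

variable [IsFiniteLinear k C]

/-- Evaluating a wedge over `(x', x) ↦ Hom(x', y) ⊗ x` at linear forms. -/
def leftFamilyOfWedge {y z : C} (p : ∀ x : C, z ⟶ copower k (x ⟶ y) x)
    (hp : ∀ ⦃i j : C⦄ (f : i ⟶ j), p i ≫ copower.map LinearMap.id f =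
      p j ≫ copower.map (Linear.leftComp k y f) (𝟙 j)) : leftFamilies k y z :=
  ⟨fun x =>
    { toFun := fun ξ => p x ≫ copower.desc (ξ.smulRight (𝟙 x))
      map_add' := fun ξ ζ => by
        rw [← Preadditive.comp_add]
        congr 1
        exact copower.hom_ext fun v => by simp [add_smul]
      map_smul' := fun c ξ => by
        rw [RingHom.id_apply, ← Linear.comp_smul]
        congr 1
        exact copower.hom_ext fun v => by simp [mul_smul] },
    fun i j f ξ => by
      have h1 := copower.map_desc (LinearMap.id : (i ⟶ y) →ₗ[k] _) f ξ
      have h2 := copower.map_desc (Linear.leftComp k y f) (𝟙 j) ξ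
      rw [Category.comp_id] at h2
      rw [LinearMap.comp_id] at h1
      change (p i ≫ _) ≫ f = p j ≫ _
      rw [Category.assoc, ← h2, ← reassoc_of% hp f, h1]⟩

lemma copower_lift_wedge {y z : C} (t : leftFamilies k y z) {i j : C} (f : i ⟶ j) :
    copower.lift (t.1 i) ≫ copower.map LinearMap.id f =
      copower.lift (t.1 j) ≫ copower.map (Linear.leftComp k y f) (𝟙 j) := by
  refine copower.hom_ext_desc fun ξ => ?_
  have h1 := copower.map_desc (LinearMap.id : (i ⟶ y) →ₗ[k] _) f ξ
  have h2 := copower.map_desc (Linear.leftComp k y f) (𝟙 j) ξ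
  rw [Category.comp_id] at h2
  rw [Category.assoc, Category.assoc, h1, h2, LinearMap.comp_id, copower.lift_desc,
    ← Category.assoc, copower.lift_desc]
  exact t.2 f ξ

/-- Evaluating a cowedge under `(x', x) ↦ Hom(y, x')^* ⊗ x` at linear forms. -/
def rightFamilyOfCowedge {y z : C} (p : ∀ x : C, copower k (Module.Dual k (y ⟶ x)) x ⟶ z)
    (hp : ∀ ⦃i j : C⦄ (f : i ⟶ j), copower.map (Linear.rightComp k y f).dualMap (𝟙 i) ≫ p i =
      copower.map LinearMap.id f ≫ p j) : rightFamilies k y z :=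
  ⟨fun x => (Linear.rightComp k x (p x)).comp (copower.ι x), fun i j f ξ => by
    have h := congr_arg (copower.ι j ξ ≫ ·) (hp f)
    simp only [copower.ι_map_assoc, Category.id_comp, LinearMap.id_apply] at h
    exact h.symm⟩

lemma copower_desc_cowedge {y z : C} (t : rightFamilies k y z) {i j : C} (f : i ⟶ j) :
    copower.map (Linear.rightComp k y f).dualMap (𝟙 i) ≫ copower.desc (t.1 i) =
      copower.map LinearMap.id f ≫ copower.desc (t.1 j) := by
  refine copower.hom_ext fun ξ => ?_
  rw [copower.ι_map_assoc, copower.ι_map_assoc, copower.ι_desc, copower.ι_desc, Category.id_comp]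
  exact (t.2 f ξ).symm

namespace LeftNakayama

variable (N : LeftNakayama k C)

/-- The components of `N^l(y)` form a natural family. -/
def family (y : C) : leftFamilies k y (N.functor.obj y) :=
  leftFamilyOfWedge (N.π y) (N.wedge y)

lemma family_apply {x y : C} (ξ : Module.Dual k (x ⟶ y)) :
    (N.family y).1 x ξ = N.component ξ := rfl

lemma component_comp {x x' y : C} (ξ : Module.Dual k (x ⟶ y)) (f : x ⟶ x') :
    N.component ξ ≫ f = N.component (ξ.comp (Linear.leftComp k y f)) :=
  (N.family y).2 f ξ

lemma map_component {x y y' : C} (g : y ⟶ y') (ξ : Module.Dual k (x ⟶ y')) :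
    N.functor.map g ≫ N.component ξ = N.component (ξ.comp (Linear.rightComp k x g)) := by
  rw [component, component, ← Category.assoc, N.naturality, Category.assoc, copower.map_desc,
    Category.comp_id]

lemma hom_ext {y z : C} {f g : z ⟶ N.functor.obj y}
    (h : ∀ (x : C) (ξ : Module.Dual k (x ⟶ y)), f ≫ N.component ξ = g ≫ N.component ξ) : f = g :=
  Wedge.IsLimit.hom_ext (N.isLimit y) fun x => copower.hom_ext_desc fun ξ =>
    (Category.assoc _ _ _).trans ((h x ξ).trans (Category.assoc _ _ _).symm)

/-- Morphisms into `N^l(y)` with prescribed components exist. -/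
lemma exists_lift {y z : C} (t : leftFamilies k y z) :
    ∃ h : z ⟶ N.functor.obj y, ∀ (x : C) (ξ : Module.Dual k (x ⟶ y)),
      h ≫ N.component ξ = t.1 x ξ := by
  obtain ⟨h, hh⟩ : ∃ h : z ⟶ N.functor.obj y, ∀ x, h ≫ N.π y x = copower.lift (t.1 x) :=
    ⟨Wedge.IsLimit.lift (N.isLimit y) (fun x => copower.lift (t.1 x))
      fun i j f => copower_lift_wedge t f, Wedge.IsLimit.lift_ι (N.isLimit y) _ _⟩
  refine ⟨h, fun x ξ => ?_⟩
  rw [component, ← Category.assoc, hh, copower.lift_desc]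

/-- Universal natural families assemble into a left exact Nakayama functor: a natural family
`Hom(x, y)^* → Hom(z, x)` is the same as a wedge `z ⟶ Hom(x, y) ⊗ x`. -/
lemma nonempty_of_universal (h : ∀ y : C, ∃ (X : C) (t : leftFamilies k y X),
    ∀ (z : C) (s : leftFamilies k y z), ∃! h : z ⟶ X,
      ∀ (x : C) (ξ : Module.Dual k (x ⟶ y)), h ≫ t.1 x ξ = s.1 x ξ) :
    Nonempty (LeftNakayama k C) := by
  choose X t ht using h
  have key {y z x : C} (m : z ⟶ X y) (p : z ⟶ copower k (x ⟶ y) x)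
      (hm : m ≫ copower.lift ((t y).1 x) = p) (ξ : Module.Dual k (x ⟶ y)) :
      p ≫ copower.desc (ξ.smulRight (𝟙 x)) = m ≫ (t y).1 x ξ := by
    rw [← hm, Category.assoc, copower.lift_desc]
  have ext {y z : C} {f g : z ⟶ X y} (h : ∀ x ξ, f ≫ (t y).1 x ξ = g ≫ (t y).1 x ξ) : f = g := by
    let s : leftFamilies k y z := ⟨fun x => (Linear.leftComp k x g).comp ((t y).1 x),
      fun x x' a ξ => by simp [(t y).2 a ξ]⟩
    exact (ht y z s).unique h fun x ξ => rfl
  have hw (y : C) : ∀ ⦃i j : C⦄ (f : i ⟶ j),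
    copower.lift ((t y).1 i) ≫ ((homCopower k y).obj (op i)).map f =
      copower.lift ((t y).1 j) ≫ ((homCopower k y).map f.op).app j :=
    fun i j f => copower_lift_wedge (t y) f
  let s {y y' : C} (g : y ⟶ y') : leftFamilies k y' (X y) :=
    ⟨fun x => ((t y).1 x).comp (Linear.rightComp k x g).dualMap, fun x x' f ξ => by
      simp only [LinearMap.comp_apply, (t y).2 f]
      congr 1
      ext; simp⟩
  choose F hF using fun (y y' : C) (g : y ⟶ y') => (ht y' (X y) (s g)).exists
  refine ⟨{ functor := { obj := X, map := fun {y y'} g => F y y' g, map_id := fun y => ?_,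
                         map_comp := fun {y y' y''} g g' => ?_ }
            π := fun y x => copower.lift ((t y).1 x)
            wedge := hw
            isLimit := fun y => Multifork.IsLimit.mk _
              (fun K => ((ht y K.pt (leftFamilyOfWedge (fun x => Multifork.ι K x) fun i j f =>
                Wedge.condition K f)).exists).choose)
              (fun K x => copower.hom_ext_desc fun ξ => ?_)
              (fun K m hm => ext fun x ξ => ?_)
            naturality := fun {y y'} g x => copower.hom_ext_desc fun ξ => ?_ }⟩
  · refine ext fun x ξ => ?_
    rw [hF, Category.id_comp]
    change (t y).1 x ((Linear.rightComp k x (𝟙 y)).dualMap ξ) = _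
    congr 1
    ext; simp
  · refine ext fun x ξ => ?_
    rw [hF, Category.assoc, hF]
    change (t y).1 x ((Linear.rightComp k x (g ≫ g')).dualMap ξ) =
      F y y' g ≫ (t y').1 x ((Linear.rightComp k x g').dualMap ξ)
    rw [hF]
    change _ = (t y).1 x ((Linear.rightComp k x g).dualMap _)
    congr 1
    ext; simp
  · have h1 := ((ht y K.pt (leftFamilyOfWedge (fun x => Multifork.ι K x) fun i j f =>
      Wedge.condition K f)).exists).choose_spec x ξ
    exact (key _ _ rfl ξ).trans h1
  · have h1 := ((ht y K.pt (leftFamilyOfWedge (fun x => Multifork.ι K x) fun i j f =>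
      Wedge.condition K f)).exists).choose_spec x ξ
    exact (key m _ (hm x) ξ).symm.trans h1.symm
  · rw [Category.assoc, Category.assoc, copower.lift_desc, hF, copower.map_desc, Category.comp_id,
      copower.lift_desc]
    rfl

end LeftNakayama

namespace RightNakayama

variable (N : RightNakayama k C)

/-- The components of `N^r(y)` form a natural family. -/
def family (y : C) : rightFamilies k y (N.functor.obj y) :=
  rightFamilyOfCowedge (N.ι y) (N.cowedge y)

lemma family_apply {x y : C} (ξ : Module.Dual k (y ⟶ x)) :
    (N.family y).1 x ξ = N.component ξ := rfl

lemma comp_component {x x' y : C} (f : x' ⟶ x) (ξ : Module.Dual k (y ⟶ x)) :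
    f ≫ N.component ξ = N.component (ξ.comp (Linear.rightComp k y f)) :=
  (N.family y).2 f ξ

lemma component_map {x y y' : C} (g : y ⟶ y') (ξ : Module.Dual k (y ⟶ x)) :
    N.component ξ ≫ N.functor.map g = N.component (ξ.comp (Linear.leftComp k x g)) := by
  rw [component, component, Category.assoc, N.naturality, copower.ι_map_assoc, Category.id_comp]
  rfl

lemma component_map_assoc {x y y' : C} (g : y ⟶ y') (ξ : Module.Dual k (y ⟶ x))
    {Z : C} (h : N.functor.obj y' ⟶ Z) :
    N.component ξ ≫ N.functor.map g ≫ h = N.component (ξ ∘ₗ Linear.leftComp k x g) ≫ h := by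
  rw [reassoc_of% (N.component_map g ξ)]

lemma hom_ext {y z : C} {f g : N.functor.obj y ⟶ z}
    (h : ∀ (x : C) (ξ : Module.Dual k (y ⟶ x)), N.component ξ ≫ f = N.component ξ ≫ g) : f = g :=
  Cowedge.IsColimit.hom_ext (N.isColimit y) fun x => copower.hom_ext fun ξ =>
    (Category.assoc _ _ _).symm.trans ((h x ξ).trans (Category.assoc _ _ _))

/-- Morphisms out of `N^r(y)` with prescribed components exist. -/
lemma exists_desc {y z : C} (t : rightFamilies k y z) :
    ∃ h : N.functor.obj y ⟶ z, ∀ (x : C) (ξ : Module.Dual k (y ⟶ x)),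
      N.component ξ ≫ h = t.1 x ξ := by
  obtain ⟨h, hh⟩ : ∃ h : N.functor.obj y ⟶ z, ∀ x, N.ι y x ≫ h = copower.desc (t.1 x) :=
    ⟨Cowedge.IsColimit.desc (N.isColimit y) (fun x => copower.desc (t.1 x))
      fun i j f => copower_desc_cowedge t f, Cowedge.IsColimit.π_desc (N.isColimit y) _ _⟩
  refine ⟨h, fun x ξ => ?_⟩
  rw [component, Category.assoc, hh, copower.ι_desc]

/-- Universal natural families assemble into a right exact Nakayama functor: a natural family
`Hom(y, x)^* → Hom(x, z)` is the same as a cowedge `Hom(y, x)^* ⊗ x ⟶ z`. -/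
lemma nonempty_of_universal (h : ∀ y : C, ∃ (X : C) (t : rightFamilies k y X),
    ∀ (z : C) (s : rightFamilies k y z), ∃! h : X ⟶ z,
      ∀ (x : C) (ξ : Module.Dual k (y ⟶ x)), t.1 x ξ ≫ h = s.1 x ξ) :
    Nonempty (RightNakayama k C) := by
  choose X t ht using h
  have key {y z x : C} (m : X y ⟶ z) (p : copower k (Module.Dual k (y ⟶ x)) x ⟶ z)
      (hm : copower.desc ((t y).1 x) ≫ m = p) (ξ : Module.Dual k (y ⟶ x)) :
      (t y).1 x ξ ≫ m = copower.ι x ξ ≫ p := by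
    rw [← hm, ← Category.assoc, copower.ι_desc]
  have ext {y z : C} {f g : X y ⟶ z} (h : ∀ x ξ, (t y).1 x ξ ≫ f = (t y).1 x ξ ≫ g) : f = g := by
    let s : rightFamilies k y z := ⟨fun x => (Linear.rightComp k x g).comp ((t y).1 x),
      fun x x' a ξ => by simp [← (t y).2 a ξ]⟩
    exact (ht y z s).unique h fun x ξ => rfl
  have hw (y : C) : ∀ ⦃i j : C⦄ (f : i ⟶ j),
    ((dualHomCopower k y).map f.op).app i ≫ copower.desc ((t y).1 i) =
      ((dualHomCopower k y).obj (op j)).map f ≫ copower.desc ((t y).1 j) :=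
    fun i j f => copower_desc_cowedge (t y) f
  let s {y y' : C} (g : y ⟶ y') : rightFamilies k y (X y') :=
    ⟨fun x => ((t y').1 x).comp (Linear.leftComp k x g).dualMap, fun x x' f ξ => by
      simp only [LinearMap.comp_apply, (t y').2 f]
      congr 1
      ext; simp⟩
  choose F hF using fun (y y' : C) (g : y ⟶ y') => (ht y (X y') (s g)).exists
  refine ⟨{ functor := { obj := X, map := fun {y y'} g => F y y' g, map_id := fun y => ?_,
                         map_comp := fun {y y' y''} g g' => ?_ }
            ι := fun y x => copower.desc ((t y).1 x)
            cowedge := hw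
            isColimit := fun y => Multicofork.IsColimit.mk _
              (fun K => ((ht y K.pt (rightFamilyOfCowedge (fun x => Multicofork.π K x) fun i j f =>
                Cowedge.condition K f)).exists).choose)
              (fun K x => copower.hom_ext fun ξ => ?_)
              (fun K m hm => ext fun x ξ => ?_)
            naturality := fun {y y'} g x => copower.hom_ext fun ξ => ?_ }⟩
  · refine ext fun x ξ => ?_
    rw [hF, Category.comp_id]
    change (t y).1 x ((Linear.leftComp k x (𝟙 y)).dualMap ξ) = _
    congr 1
    ext; simp
  · refine ext fun x ξ => ?_
    rw [hF, ← Category.assoc, hF]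
    change (t y'').1 x ((Linear.leftComp k x (g ≫ g')).dualMap ξ) =
      (t y').1 x ((Linear.leftComp k x g).dualMap ξ) ≫ F y' y'' g'
    rw [hF]
    change _ = (t y'').1 x ((Linear.leftComp k x g').dualMap _)
    congr 1
    ext; simp
  · have h1 := ((ht y K.pt (rightFamilyOfCowedge (fun x => Multicofork.π K x) fun i j f =>
      Cowedge.condition K f)).exists).choose_spec x ξ
    exact (key _ _ rfl ξ).symm.trans h1
  · have h1 := ((ht y K.pt (rightFamilyOfCowedge (fun x => Multicofork.π K x) fun i j f =>
      Cowedge.condition K f)).exists).choose_spec x ξ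
    exact (key m _ (hm x) ξ).trans h1.symm
  · refine (copower.ι_desc_assoc _ _ _).trans ((hF _ _ g x ξ).trans ?_)
    rw [copower.ι_map_assoc, Category.id_comp]
    have h := copower.ι_desc ((t y').1 x) ((Linear.leftComp k x g).dualMap ξ)
    exact h.symm

end RightNakayama

/-! ### Existence of the Nakayama functors -/

variable (k C) in
/-- The functor that sends `z` to the natural families `Hom(x, y)^* → Hom(z, x)` is left exact and
finite-dimensional, hence represented by `N^l(y)`. -/
theorem nonempty_leftNakayama : Nonempty (LeftNakayama k C) := by
  obtain ⟨P, hP⟩ := exists_isProjectiveSeparator k C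
  refine LeftNakayama.nonempty_of_universal fun y => ?_
  let m : LeftExactPresheaf k C (fun z => leftFamilies k y z) :=
    { map := fun {x x'} => LinearMap.mk₂ k
        (fun f t => ⟨fun z => (Linear.leftComp k z f).comp (t.1 z), fun z z' a ξ => by
          simp [t.2 a ξ]⟩)
        (fun f g t => Subtype.ext (funext fun z => LinearMap.ext fun ξ => by simp))
        (fun c f t => Subtype.ext (funext fun z => LinearMap.ext fun ξ => by simp))
        (fun f t t' => Subtype.ext (funext fun z => LinearMap.ext fun ξ => by simp))
        (fun c f t => Subtype.ext (funext fun z => LinearMap.ext fun ξ => by simp))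
      map_id := fun x t => Subtype.ext (funext fun z => LinearMap.ext fun ξ => by simp)
      map_comp := fun f g t => Subtype.ext (funext fun z => LinearMap.ext fun ξ => by simp)
      exact := fun {x x' x''} f g w hc t ht => by
        have : Epi g := Cofork.IsColimit.epi hc
        have ht' (z : C) (ξ : Module.Dual k (z ⟶ y)) : f ≫ t.1 z ξ = 0 :=
          LinearMap.congr_fun (congr_fun (congr_arg Subtype.val ht) z) ξ
        let d (z : C) (ξ : Module.Dual k (z ⟶ y)) : x'' ⟶ z :=
          hc.desc (CokernelCofork.ofπ _ (ht' z ξ))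
        have hd (z : C) (ξ : Module.Dual k (z ⟶ y)) : g ≫ d z ξ = t.1 z ξ :=
          hc.fac (CokernelCofork.ofπ _ (ht' z ξ)) WalkingParallelPair.one
        refine ⟨⟨fun z => ⟨⟨d z, fun ξ ζ => ?_⟩, fun c ξ => ?_⟩, fun z z' a ξ => ?_⟩, ?_,
          fun t' h => ?_⟩
        · rw [← cancel_epi g]
          simp [hd]
        · rw [← cancel_epi g]
          simp [hd]
        · rw [← cancel_epi g]
          change g ≫ d z ξ ≫ a = g ≫ d z' _
          rw [← Category.assoc, hd, hd, t.2]
        · exact Subtype.ext (funext fun z => LinearMap.ext fun ξ => hd z ξ)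
        · refine Subtype.ext (funext fun z => LinearMap.ext fun ξ => ?_)
          rw [← cancel_epi g]
          exact (LinearMap.congr_fun (congr_fun (congr_arg Subtype.val h) z) ξ).trans
            (hd z ξ).symm }
  -- a natural family is determined by its value at an injective coseparator
  obtain ⟨I, hI⟩ := hP.exists_op k
  let e : leftFamilies k y P →ₗ[k] (Module.Dual k (I.unop ⟶ y) →ₗ[k] (P ⟶ I.unop)) :=
    { toFun := fun t => t.1 I.unop, map_add' := fun _ _ => rfl, map_smul' := fun _ _ => rfl }
  have he : Function.Injective e := by
    refine (injective_iff_map_eq_zero e).2 fun t ht => ?_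
    refine Subtype.ext (funext fun x => LinearMap.ext fun ξ => ?_)
    refine Quiver.Hom.op_inj (hI.eq_zero _ fun p => Quiver.Hom.unop_inj ?_)
    exact (t.2 p.unop ξ).trans (LinearMap.congr_fun ht _)
  have : FiniteDimensional k (leftFamilies k y P) := Module.Finite.of_injective e he
  obtain ⟨X, t, ht⟩ := hP.exists_universal m
  refine ⟨X, t, fun z s => ?_⟩
  obtain ⟨h, hh, hu⟩ := (Function.bijective_iff_existsUnique _).1 (ht z) s
  refine ⟨h, fun x ξ => LinearMap.congr_fun (congr_fun (congr_arg Subtype.val hh) x) ξ,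
    fun h' hh' => hu h' ?_⟩
  exact Subtype.ext (funext fun x => LinearMap.ext fun ξ => hh' x ξ)

variable (k C) in
/-- The functor that sends `z` to the natural families `Hom(y, x)^* → Hom(x, z)` is left exact and
finite-dimensional, hence corepresented by `N^r(y)`. -/
theorem nonempty_rightNakayama : Nonempty (RightNakayama k C) := by
  obtain ⟨P, hP⟩ := exists_isProjectiveSeparator k C
  refine RightNakayama.nonempty_of_universal fun y => ?_
  let m : LeftExactCopresheaf k C (fun z => rightFamilies k y z) :=
    { map := fun {x x'} => LinearMap.mk₂ k
        (fun f t => ⟨fun z => (Linear.rightComp k z f).comp (t.1 z), fun z z' a ξ => by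
          simp [← t.2 a ξ]⟩)
        (fun f g t => Subtype.ext (funext fun z => LinearMap.ext fun ξ => by simp))
        (fun c f t => Subtype.ext (funext fun z => LinearMap.ext fun ξ => by simp))
        (fun f t t' => Subtype.ext (funext fun z => LinearMap.ext fun ξ => by simp))
        (fun c f t => Subtype.ext (funext fun z => LinearMap.ext fun ξ => by simp))
      map_id := fun x t => Subtype.ext (funext fun z => LinearMap.ext fun ξ => by simp)
      map_comp := fun f g t => Subtype.ext (funext fun z => LinearMap.ext fun ξ => by simp)
      exact := fun {x' x x''} g f w hc t ht => by
        have : Mono g := Fork.IsLimit.mono hc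
        have ht' (z : C) (ξ : Module.Dual k (y ⟶ z)) : t.1 z ξ ≫ f = 0 :=
          LinearMap.congr_fun (congr_fun (congr_arg Subtype.val ht) z) ξ
        let d (z : C) (ξ : Module.Dual k (y ⟶ z)) : z ⟶ x' :=
          hc.lift (KernelFork.ofι _ (ht' z ξ))
        have hd (z : C) (ξ : Module.Dual k (y ⟶ z)) : d z ξ ≫ g = t.1 z ξ :=
          hc.fac (KernelFork.ofι _ (ht' z ξ)) WalkingParallelPair.zero
        refine ⟨⟨fun z => ⟨⟨d z, fun ξ ζ => ?_⟩, fun c ξ => ?_⟩, fun z z' a ξ => ?_⟩, ?_,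
          fun t' h => ?_⟩
        · rw [← cancel_mono g]
          simp [hd]
        · rw [← cancel_mono g]
          simp [hd]
        · rw [← cancel_mono g]
          change (a ≫ d z ξ) ≫ g = d z' _ ≫ g
          rw [Category.assoc, hd, hd, t.2]
        · exact Subtype.ext (funext fun z => LinearMap.ext fun ξ => hd z ξ)
        · refine Subtype.ext (funext fun z => LinearMap.ext fun ξ => ?_)
          rw [← cancel_mono g]
          exact (LinearMap.congr_fun (congr_fun (congr_arg Subtype.val h) z) ξ).trans
            (hd z ξ).symm }
  -- a natural family is determined by its value at a projective separator
  let e (z : C) : rightFamilies k y z →ₗ[k] (Module.Dual k (y ⟶ P) →ₗ[k] (P ⟶ z)) :=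
    { toFun := fun t => t.1 P, map_add' := fun _ _ => rfl, map_smul' := fun _ _ => rfl }
  have he (z : C) : Function.Injective (e z) := by
    refine (injective_iff_map_eq_zero (e z)).2 fun t ht => ?_
    refine Subtype.ext (funext fun x => LinearMap.ext fun ξ => hP.eq_zero _ fun p => ?_)
    exact (t.2 p ξ).trans (LinearMap.congr_fun ht _)
  have (z : C) : FiniteDimensional k (rightFamilies k y z) :=
    Module.Finite.of_injective (e z) (he z)
  obtain ⟨X, t, ht⟩ := exists_couniversal m
  refine ⟨X, t, fun z s => ?_⟩
  obtain ⟨h, hh, hu⟩ := (Function.bijective_iff_existsUnique _).1 (ht z) s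
  refine ⟨h, fun x ξ => LinearMap.congr_fun (congr_fun (congr_arg Subtype.val hh) x) ξ,
    fun h' hh' => hu h' ?_⟩
  exact Subtype.ext (funext fun x => LinearMap.ext fun ξ => hh' x ξ)

end NakayamaComponents

/-! ### Nakayama functors and chains of adjunctions -/

section Comparison

variable {k : Type w} [Field k] {C : Type u} [Category.{v} C] [Abelian C] [Linear k C]
  [IsFiniteLinear k C]
variable {E : Type u'} [Category.{v'} E] [Abelian E] [Linear k E]

omit [Abelian E] [Linear k E] in
lemma LeftNakayama.hom_ext_of_isRightAdjoint (N : LeftNakayama k C) (G : C ⥤ E)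
    [G.IsRightAdjoint] {y : C} {z : E} {f g : z ⟶ G.obj (N.functor.obj y)}
    (h : ∀ (x : C) (ξ : Module.Dual k (x ⟶ y)),
      f ≫ G.map (N.component ξ) = g ≫ G.map (N.component ξ)) : f = g := by
  let adj := Adjunction.ofIsRightAdjoint G
  refine (adj.homEquiv _ _).symm.injective (N.hom_ext fun x ξ => ?_)
  rw [← adj.homEquiv_naturality_right_symm, ← adj.homEquiv_naturality_right_symm, h]

/-- A functor with a left adjoint preserves the end defining `N^l`. -/
lemma LeftNakayama.exists_lift_of_isRightAdjoint (N : LeftNakayama k C) (G : C ⥤ E)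
    [G.IsRightAdjoint] [G.Additive] [G.Linear k] {y : C} {z : E}
    (s : ∀ x : C, Module.Dual k (x ⟶ y) →ₗ[k] (z ⟶ G.obj x))
    (hs : ∀ ⦃x x' : C⦄ (f : x ⟶ x') (ξ : Module.Dual k (x ⟶ y)),
      s x ξ ≫ G.map f = s x' (ξ.comp (Linear.leftComp k y f))) :
    ∃ h : z ⟶ G.obj (N.functor.obj y), ∀ (x : C) (ξ : Module.Dual k (x ⟶ y)),
      h ≫ G.map (N.component ξ) = s x ξ := by
  let adj := Adjunction.ofIsRightAdjoint G
  let e (x : C) : (G.leftAdjoint.obj z ⟶ x) ≃ₗ[k] (z ⟶ G.obj x) :=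
    { adj.homEquiv z x with
      map_add' := fun f g => by simp [Adjunction.homEquiv_unit]
      map_smul' := fun c f => by simp [Adjunction.homEquiv_unit] }
  have he {x x' : C} (f : z ⟶ G.obj x) (g : x ⟶ x') :
      (e x).symm f ≫ g = (e x').symm (f ≫ G.map g) :=
    (adj.homEquiv_naturality_right_symm f g).symm
  obtain ⟨h, hh⟩ := N.exists_lift ⟨fun x => (e x).symm.toLinearMap.comp (s x), fun x x' f ξ => by
    simp [he, hs]⟩
  refine ⟨e _ h, fun x ξ => (e x).symm.injective ?_⟩
  rw [← he, LinearEquiv.symm_apply_apply, hh]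
  rfl

omit [Abelian E] [Linear k E] in
lemma RightNakayama.hom_ext_of_isLeftAdjoint (N : RightNakayama k C) (G : C ⥤ E)
    [G.IsLeftAdjoint] {y : C} {z : E} {f g : G.obj (N.functor.obj y) ⟶ z}
    (h : ∀ (x : C) (ξ : Module.Dual k (y ⟶ x)),
      G.map (N.component ξ) ≫ f = G.map (N.component ξ) ≫ g) : f = g := by
  let adj := Adjunction.ofIsLeftAdjoint G
  refine (adj.homEquiv _ _).injective (N.hom_ext fun x ξ => ?_)
  rw [← adj.homEquiv_naturality_left, ← adj.homEquiv_naturality_left, h]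

/-- A functor with a right adjoint preserves the coend defining `N^r`. -/
lemma RightNakayama.exists_desc_of_isLeftAdjoint (N : RightNakayama k C) (G : C ⥤ E)
    [G.IsLeftAdjoint] [G.Additive] [G.Linear k] {y : C} {z : E}
    (s : ∀ x : C, Module.Dual k (y ⟶ x) →ₗ[k] (G.obj x ⟶ z))
    (hs : ∀ ⦃x x' : C⦄ (f : x' ⟶ x) (ξ : Module.Dual k (y ⟶ x)),
      G.map f ≫ s x ξ = s x' (ξ.comp (Linear.rightComp k y f))) :
    ∃ h : G.obj (N.functor.obj y) ⟶ z, ∀ (x : C) (ξ : Module.Dual k (y ⟶ x)),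
      G.map (N.component ξ) ≫ h = s x ξ := by
  let adj := Adjunction.ofIsLeftAdjoint G
  let e (x : C) : (G.obj x ⟶ z) ≃ₗ[k] (x ⟶ G.rightAdjoint.obj z) :=
    { (adj.homEquiv x z).symm with
      map_add' := fun f g => by simp [Adjunction.homEquiv_counit]
      map_smul' := fun c f => by simp [Adjunction.homEquiv_counit] :
        (x ⟶ G.rightAdjoint.obj z) ≃ₗ[k] (G.obj x ⟶ z) }.symm
  have he {x x' : C} (f : G.obj x ⟶ z) (g : x' ⟶ x) :
      g ≫ e x f = e x' (G.map g ≫ f) :=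
    (adj.homEquiv_naturality_left g f).symm
  obtain ⟨h, hh⟩ := N.exists_desc ⟨fun x => (e x).toLinearMap.comp (s x), fun x x' f ξ => by
    simp [he, hs]⟩
  refine ⟨(e _).symm h, fun x ξ => (e x).injective ?_⟩
  rw [← he, LinearEquiv.apply_symm_apply, hh]
  rfl

variable [IsFiniteLinear k E]

/-- Let `G ⊣ L`, let `G` have a left adjoint, and let `Y` represent `x ↦ Hom(L x, y)`. Then
`G(N^l y) ≅ N^l Y`: substituting along the adjunctions,
`∫_x Hom(x, Y) ⊗ x ≅ ∫_x Hom(L x, y) ⊗ x ≅ ∫_z Hom(z, y) ⊗ G z ≅ G(∫_z Hom(z, y) ⊗ z)`. -/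
theorem LeftNakayama.exists_comparison (N : LeftNakayama k C) (N' : LeftNakayama k E)
    {L : E ⥤ C} {G : C ⥤ E} (adj : G ⊣ L) [G.IsRightAdjoint] [G.Additive] [G.Linear k]
    {y : C} {Y : E} (φ : ∀ x : E, (L.obj x ⟶ y) ≃ₗ[k] (x ⟶ Y))
    (hφ : ∀ ⦃x x' : E⦄ (f : x ⟶ x') (v : L.obj x' ⟶ y), φ x (L.map f ≫ v) = f ≫ φ x' v) :
    ∃ Θ : G.obj (N.functor.obj y) ≅ N'.functor.obj Y, ∀ (x : E) (ξ : Module.Dual k (x ⟶ Y)),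
      Θ.hom ≫ N'.component ξ =
        G.map (N.component (ξ.comp (φ x).toLinearMap)) ≫ adj.counit.app x := by
  obtain ⟨p, hp⟩ := N'.exists_lift (y := Y) (z := G.obj (N.functor.obj y)) ⟨fun x =>
    { toFun := fun ξ => G.map (N.component (ξ.comp (φ x).toLinearMap)) ≫ adj.counit.app x
      map_add' := fun ξ ζ => by
        rw [← N.family_apply, LinearMap.add_comp, map_add, G.map_add, Preadditive.add_comp]
        rfl
      map_smul' := fun c ξ => by
        rw [← N.family_apply, LinearMap.smul_comp, map_smul, G.map_smul, Linear.smul_comp]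
        rfl }, fun x x' f ξ => by
      change (G.map _ ≫ _) ≫ f = G.map _ ≫ _
      have h := adj.counit.naturality f
      dsimp at h
      rw [Category.assoc, ← h, ← Category.assoc, ← G.map_comp, N.component_comp]
      congr 3
      ext v
      simp [hφ]⟩
  let κ (x : C) : (G.obj x ⟶ Y) →ₗ[k] (x ⟶ y) :=
    (Linear.leftComp k y (adj.unit.app x)).comp (φ (G.obj x)).symm.toLinearMap
  have hκ {x x' : C} (f : x ⟶ x') (v : G.obj x' ⟶ Y) : κ x (G.map f ≫ v) = f ≫ κ x' v := by
    have h1 : (φ (G.obj x)).symm (G.map f ≫ v) = L.map (G.map f) ≫ (φ (G.obj x')).symm v := by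
      apply (φ _).injective
      rw [hφ]
      simp
    have h2 := adj.unit.naturality f
    dsimp at h2
    change adj.unit.app x ≫ (φ (G.obj x)).symm (G.map f ≫ v) =
      f ≫ adj.unit.app x' ≫ (φ (G.obj x')).symm v
    rw [h1, ← Category.assoc, ← h2, Category.assoc]
  obtain ⟨q, hq⟩ := N.exists_lift_of_isRightAdjoint G (y := y) (z := N'.functor.obj Y)
    (fun x => ((N'.family Y).1 (G.obj x)).comp (κ x).dualMap) fun x x' f ξ => by
      refine (N'.component_comp _ _).trans (congr_arg N'.component ?_)
      ext v
      simp [hκ]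
  refine ⟨⟨p, q, N.hom_ext_of_isRightAdjoint G fun x ξ => ?_, N'.hom_ext fun x ξ => ?_⟩, hp⟩
  · rw [Category.assoc, hq, Category.id_comp]
    refine (hp _ _).trans ?_
    have : N.component ((ξ.comp (κ x)).comp (φ (G.obj x)).toLinearMap) =
        N.component ξ ≫ adj.unit.app x := by
      rw [N.component_comp]
      congr 1
      ext v
      simp [κ]
    change G.map (N.component ((ξ.comp (κ x)).comp (φ (G.obj x)).toLinearMap)) ≫ _ = _
    rw [this, G.map_comp, Category.assoc, adj.left_triangle_components, Category.comp_id]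
  · rw [Category.assoc, hp, Category.id_comp]
    change q ≫ G.map (N.component (ξ.comp (φ x).toLinearMap)) ≫ _ = _
    rw [← Category.assoc, hq]
    refine (N'.component_comp _ _).trans (congr_arg N'.component ?_)
    ext v
    have h1 : (φ (G.obj (L.obj x))).symm (adj.counit.app x ≫ v) =
        L.map (adj.counit.app x) ≫ (φ x).symm v := by
      apply (φ _).injective
      rw [hφ]
      simp
    simp [κ, h1]

/-- Let `R ⊣ G`, let `G` have a right adjoint, and let `Y` corepresent `x ↦ Hom(y, R x)`. Then
`N^r Y ≅ G(N^r y)`, dually to `LeftNakayama.exists_comparison`. -/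
theorem RightNakayama.exists_comparison (N : RightNakayama k C) (N' : RightNakayama k E)
    {R : E ⥤ C} {G : C ⥤ E} (adj : R ⊣ G) [G.IsLeftAdjoint] [G.Additive] [G.Linear k]
    {y : C} {Y : E} (φ : ∀ x : E, (y ⟶ R.obj x) ≃ₗ[k] (Y ⟶ x))
    (hφ : ∀ ⦃x x' : E⦄ (f : x ⟶ x') (v : y ⟶ R.obj x), φ x' (v ≫ R.map f) = φ x v ≫ f) :
    ∃ Θ : N'.functor.obj Y ≅ G.obj (N.functor.obj y), ∀ (x : E) (ξ : Module.Dual k (Y ⟶ x)),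
      N'.component ξ ≫ Θ.hom =
        adj.unit.app x ≫ G.map (N.component (ξ.comp (φ x).toLinearMap)) := by
  obtain ⟨p, hp⟩ := N'.exists_desc (y := Y) (z := G.obj (N.functor.obj y)) ⟨fun x =>
    { toFun := fun ξ => adj.unit.app x ≫ G.map (N.component (ξ.comp (φ x).toLinearMap))
      map_add' := fun ξ ζ => by
        rw [← N.family_apply, LinearMap.add_comp, map_add, G.map_add, Preadditive.comp_add]
        rfl
      map_smul' := fun c ξ => by
        rw [← N.family_apply, LinearMap.smul_comp, map_smul, G.map_smul, Linear.comp_smul]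
        rfl }, fun x x' f ξ => by
      change f ≫ _ ≫ G.map _ = _ ≫ G.map _
      have h := adj.unit.naturality f
      dsimp at h
      rw [← Category.assoc, h, Category.assoc, ← G.map_comp, N.comp_component]
      congr 3
      ext v
      simp [hφ]⟩
  let κ (x : C) : (Y ⟶ G.obj x) →ₗ[k] (y ⟶ x) :=
    (Linear.rightComp k y (adj.counit.app x)).comp (φ (G.obj x)).symm.toLinearMap
  have hκ {x x' : C} (f : x ⟶ x') (v : Y ⟶ G.obj x) : κ x' (v ≫ G.map f) = κ x v ≫ f := by
    have h1 : (φ (G.obj x')).symm (v ≫ G.map f) = (φ (G.obj x)).symm v ≫ R.map (G.map f) := by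
      apply (φ _).injective
      rw [hφ]
      simp
    have h2 := adj.counit.naturality f
    dsimp at h2
    change (φ (G.obj x')).symm (v ≫ G.map f) ≫ adj.counit.app x' =
      ((φ (G.obj x)).symm v ≫ adj.counit.app x) ≫ f
    rw [h1, Category.assoc, Category.assoc, h2]
  obtain ⟨q, hq⟩ := N.exists_desc_of_isLeftAdjoint G (y := y) (z := N'.functor.obj Y)
    (fun x => ((N'.family Y).1 (G.obj x)).comp (κ x).dualMap) fun x x' f ξ => by
      refine (N'.comp_component _ _).trans (congr_arg N'.component ?_)
      ext v
      simp [hκ]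
  refine ⟨⟨p, q, N'.hom_ext fun x ξ => ?_, N.hom_ext_of_isLeftAdjoint G fun x ξ => ?_⟩, hp⟩
  · rw [← Category.assoc, hp, Category.comp_id]
    change (_ ≫ G.map (N.component (ξ.comp (φ x).toLinearMap))) ≫ q = _
    rw [Category.assoc, hq]
    refine (N'.comp_component _ _).trans (congr_arg N'.component ?_)
    ext v
    have h1 : (φ (G.obj (R.obj x))).symm (v ≫ adj.unit.app x) =
        (φ x).symm v ≫ R.map (adj.unit.app x) := by
      apply (φ _).injective
      rw [hφ]
      simp
    simp [κ, h1]
  · rw [← Category.assoc, hq, Category.comp_id]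
    refine (hp _ _).trans ?_
    have : N.component ((ξ.comp (κ x)).comp (φ (G.obj x)).toLinearMap) =
        adj.counit.app x ≫ N.component ξ := by
      rw [N.comp_component]
      congr 1
      ext v
      simp [κ]
    change _ ≫ G.map (N.component ((ξ.comp (κ x)).comp (φ (G.obj x)).toLinearMap)) = _
    rw [this, G.map_comp, ← Category.assoc, adj.right_triangle_components, Category.id_comp]

end Comparison

/-! ### Duality adjunctions -/

section DualityAdjunctions

variable {A : Type u} [Category.{v} A] [MonoidalCategory A]
variable {M : Type u'} [Category.{v'} M] [MonoidalLeftAction A M]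

lemma leftUnitor_inv_actionHom (c : A) (m : M) :
    (λ_ c).inv ⊵ₗ m = (λₗ[A] (c ⊙ₗ m)).inv ≫ (αₗ _ _ _).inv := by
  rw [← cancel_mono ((λ_ c).hom ⊵ₗ m), ← MonoidalLeftAction.comp_actionHomLeft]
  simp

lemma rightUnitor_inv_actionHom (c : A) (m : M) :
    (ρ_ c).inv ⊵ₗ m = c ⊴ₗ (λₗ[A] m).inv ≫ (αₗ _ _ _).inv := by
  rw [← cancel_mono ((ρ_ c).hom ⊵ₗ m), ← MonoidalLeftAction.comp_actionHomLeft]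
  simp

lemma associator_hom_actionHom (a b c : A) (m : M) :
    (α_ a b c).hom ⊵ₗ m = (αₗ (a ⊗ b) c m).hom ≫ (αₗ a b (c ⊙ₗ m)).hom ≫
      a ⊴ₗ (αₗ b c m).inv ≫ (αₗ a (b ⊗ c) m).inv := by
  rw [← MonoidalLeftAction.associator_actionHom_assoc]
  simp

lemma associator_inv_actionHom (a b c : A) (m : M) :
    (α_ a b c).inv ⊵ₗ m = (αₗ a (b ⊗ c) m).hom ≫ a ⊴ₗ (αₗ b c m).hom ≫
      (αₗ a b (c ⊙ₗ m)).inv ≫ (αₗ (a ⊗ b) c m).inv := by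
  rw [← cancel_epi ((α_ a b c).hom ⊵ₗ m), ← MonoidalLeftAction.comp_actionHomLeft,
    associator_hom_actionHom]
  simp

lemma actUnit_naturality (X Y : A) [ExactPairing X Y] {m n : M} (f : m ⟶ n) :
    f ≫ actUnit X Y n = actUnit X Y m ≫ X ⊴ₗ Y ⊴ₗ f := by
  simp only [actUnit, Category.assoc]
  rw [← MonoidalLeftAction.actionUnitIso_inv_naturality_assoc,
    MonoidalLeftAction.action_exchange_assoc]
  simp

lemma actUnit_naturality_assoc (X Y : A) [ExactPairing X Y] {m n : M} (f : m ⟶ n)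
    {Z : M} (h : X ⊙ₗ Y ⊙ₗ n ⟶ Z) :
    f ≫ actUnit X Y n ≫ h = actUnit X Y m ≫ X ⊴ₗ Y ⊴ₗ f ≫ h := by
  rw [reassoc_of% (actUnit_naturality X Y f)]

lemma actCounit_naturality (X Y : A) [ExactPairing X Y] {m n : M} (f : m ⟶ n) :
    Y ⊴ₗ X ⊴ₗ f ≫ actCounit X Y n = actCounit X Y m ≫ f := by
  simp only [actCounit, Category.assoc]
  rw [MonoidalLeftAction.actionUnitIso_hom_naturality,
    ← MonoidalLeftAction.action_exchange_assoc]
  simp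

@[simp]
lemma actUnit_actCounit_left (X Y : A) [ExactPairing X Y] (m : M) :
    Y ⊴ₗ actUnit X Y m ≫ actCounit X Y (Y ⊙ₗ m) = 𝟙 _ := by
  trans (ρ_ Y).inv ⊵ₗ m ≫ (Y ◁ η_ X Y ≫ (α_ _ _ _).inv ≫ ε_ X Y ▷ Y) ⊵ₗ m ≫ (λ_ Y).hom ⊵ₗ m
  · simp only [actUnit, actCounit, MonoidalLeftAction.comp_actionHomLeft,
      MonoidalLeftAction.whiskerLeft_actionHomLeft, MonoidalLeftAction.whiskerRight_actionHomLeft,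
      rightUnitor_inv_actionHom, associator_inv_actionHom,
      MonoidalLeftAction.leftUnitor_actionHom, MonoidalLeftAction.actionHomRight_comp,
      Category.assoc, Iso.inv_hom_id_assoc]
  · rw [ExactPairing.coevaluation_evaluation]
    simp only [← MonoidalLeftAction.comp_actionHomLeft]
    simp

@[simp]
lemma actUnit_actCounit_left_assoc (X Y : A) [ExactPairing X Y] (m : M) {Z : M} (h : Y ⊙ₗ m ⟶ Z) :
    Y ⊴ₗ actUnit X Y m ≫ actCounit X Y (Y ⊙ₗ m) ≫ h = h := by
  rw [reassoc_of% (actUnit_actCounit_left X Y m)]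

@[simp]
lemma actUnit_actCounit_right (X Y : A) [ExactPairing X Y] (m : M) :
    actUnit X Y (X ⊙ₗ m) ≫ X ⊴ₗ actCounit X Y m = 𝟙 _ := by
  trans (λ_ X).inv ⊵ₗ m ≫ (η_ X Y ▷ X ≫ (α_ _ _ _).hom ≫ X ◁ ε_ X Y) ⊵ₗ m ≫ (ρ_ X).hom ⊵ₗ m
  · simp only [actUnit, actCounit, MonoidalLeftAction.comp_actionHomLeft,
      MonoidalLeftAction.whiskerLeft_actionHomLeft, MonoidalLeftAction.whiskerRight_actionHomLeft,
      leftUnitor_inv_actionHom, associator_hom_actionHom,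
      MonoidalLeftAction.rightUnitor_actionHom, MonoidalLeftAction.actionHomRight_comp,
      Category.assoc, Iso.inv_hom_id_assoc]
  · rw [ExactPairing.evaluation_coevaluation]
    simp only [← MonoidalLeftAction.comp_actionHomLeft]
    simp

/-- For `Y` a right dual of `X`, acting with `Y` is left adjoint to acting with `X`. -/
def actAdjunction (X Y : A) [ExactPairing X Y] :
    MonoidalLeftAction.actionLeft M Y ⊣ MonoidalLeftAction.actionLeft M X where
  unit := { app := fun m => actUnit X Y m, naturality := fun _ _ f => actUnit_naturality X Y f }
  counit :=
    { app := fun m => actCounit X Y m, naturality := fun _ _ f => actCounit_naturality X Y f }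
  left_triangle_components := fun m => actUnit_actCounit_left X Y m
  right_triangle_components := fun m => actUnit_actCounit_right X Y m

lemma tensorUnit_naturality (X Y : A) [ExactPairing X Y] {m n : A} (f : m ⟶ n) :
    f ≫ tensorUnit X Y n = tensorUnit X Y m ≫ f ▷ X ▷ Y := by
  simp only [tensorUnit, Category.assoc]
  rw [rightUnitor_inv_naturality_assoc, ← whisker_exchange_assoc]
  simp

lemma tensorUnit_naturality_assoc (X Y : A) [ExactPairing X Y] {m n : A} (f : m ⟶ n)
    {Z : A} (h : (n ⊗ X) ⊗ Y ⟶ Z) :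
    f ≫ tensorUnit X Y n ≫ h = tensorUnit X Y m ≫ f ▷ X ▷ Y ≫ h := by
  rw [reassoc_of% (tensorUnit_naturality X Y f)]

lemma tensorCounit_naturality (X Y : A) [ExactPairing X Y] {m n : A} (f : m ⟶ n) :
    f ▷ Y ▷ X ≫ tensorCounit X Y n = tensorCounit X Y m ≫ f := by
  simp only [tensorCounit, Category.assoc]
  rw [← rightUnitor_naturality, whisker_exchange_assoc]
  simp

@[simp]
lemma tensorUnit_tensorCounit_left (X Y : A) [ExactPairing X Y] (x : A) :
    tensorUnit X Y x ▷ X ≫ tensorCounit X Y (x ⊗ X) = 𝟙 _ := by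
  simpa [tensorRightHomEquiv, tensorUnit, tensorCounit] using
    (tensorRightHomEquiv x X Y (x ⊗ X)).left_inv (𝟙 _)

@[simp]
lemma tensorUnit_tensorCounit_left_assoc (X Y : A) [ExactPairing X Y] (x : A)
    {Z : A} (h : x ⊗ X ⟶ Z) :
    tensorUnit X Y x ▷ X ≫ tensorCounit X Y (x ⊗ X) ≫ h = h := by
  rw [reassoc_of% (tensorUnit_tensorCounit_left X Y x)]

@[simp]
lemma tensorUnit_tensorCounit_right (X Y : A) [ExactPairing X Y] (x : A) :
    tensorUnit X Y (x ⊗ Y) ≫ tensorCounit X Y x ▷ Y = 𝟙 _ := by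
  simpa [tensorRightHomEquiv, tensorUnit, tensorCounit] using
    (tensorRightHomEquiv (x ⊗ Y) X Y x).right_inv (𝟙 _)

/-- For `Y` a right dual of `X`, the functor `- ⊗ X` is left adjoint to `- ⊗ Y`. -/
def tensorAdjunction (X Y : A) [ExactPairing X Y] : tensorRight X ⊣ tensorRight Y where
  unit :=
    { app := fun m => tensorUnit X Y m, naturality := fun _ _ f => tensorUnit_naturality X Y f }
  counit :=
    { app := fun m => tensorCounit X Y m
      naturality := fun _ _ f => tensorCounit_naturality X Y f }
  left_triangle_components := fun m => tensorUnit_tensorCounit_left X Y m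
  right_triangle_components := fun m => tensorUnit_tensorCounit_right X Y m

instance [RigidCategory A] (a : A) : (MonoidalLeftAction.actionLeft M a).IsRightAdjoint :=
  (actAdjunction a (HasRightDual.rightDual a)).isRightAdjoint

instance [RigidCategory A] (a : A) : (MonoidalLeftAction.actionLeft M a).IsLeftAdjoint :=
  (actAdjunction (HasLeftDual.leftDual a) a).isLeftAdjoint

instance [RigidCategory A] (a : A) : (tensorRight a).IsRightAdjoint :=
  (tensorAdjunction (HasLeftDual.leftDual a) a).isRightAdjoint

instance [RigidCategory A] (a : A) : (tensorRight a).IsLeftAdjoint :=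
  (tensorAdjunction a (HasRightDual.rightDual a)).isLeftAdjoint

section Linear

variable (k : Type w) [Field k] [Preadditive A] [Linear k A] [Preadditive M] [Linear k M]
  [BilinearAction k A M]

include k in
lemma actionLeft_additive (a : A) : (MonoidalLeftAction.actionLeft M a).Additive where
  map_add := BilinearAction.actionHomRight_add k a _ _

lemma actionLeft_linear (a : A) : (MonoidalLeftAction.actionLeft M a).Linear k where
  map_smul f c := BilinearAction.actionHomRight_smul a c f

include k in
lemma actionRight_additive (m : M) : (MonoidalLeftAction.actionRight A m).Additive where
  map_add := BilinearAction.add_actionHomLeft k _ _ m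

lemma actionRight_linear (m : M) : (MonoidalLeftAction.actionRight A m).Linear k where
  map_smul f c := BilinearAction.smul_actionHomLeft c f m

lemma actCurry_actionHomRight_comp (X Y : A) [ExactPairing X Y] {z z' m : M} (f : z ⟶ z')
    (v : Y ⊙ₗ z' ⟶ m) : actCurry k X Y z m (Y ⊴ₗ f ≫ v) = f ≫ actCurry k X Y z' m v := by
  change actUnit X Y z ≫ X ⊴ₗ (Y ⊴ₗ f ≫ v) = f ≫ actUnit X Y z' ≫ X ⊴ₗ v
  simp [actUnit_naturality_assoc]

lemma actUncurry_comp_actionHomRight (X Y : A) [ExactPairing X Y] {m z z' : M}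
    (v : m ⟶ X ⊙ₗ z) (f : z ⟶ z') :
    actUncurry k X Y m z' (v ≫ X ⊴ₗ f) = actUncurry k X Y m z v ≫ f := by
  change Y ⊴ₗ (v ≫ X ⊴ₗ f) ≫ actCounit X Y z' = (Y ⊴ₗ v ≫ actCounit X Y z) ≫ f
  simp [actCounit_naturality]

/-- The bijection `Hom(Y.z, m) ≃ Hom(z, X.m)` for `Y` a right dual of `X`. -/
def actCurryEquiv (X Y : A) [ExactPairing X Y] (z m : M) :
    (Y ⊙ₗ z ⟶ m) ≃ₗ[k] (z ⟶ X ⊙ₗ m) where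
  __ := actCurry k X Y z m
  invFun := actUncurry k X Y z m
  left_inv f := by
    change Y ⊴ₗ (actUnit X Y z ≫ X ⊴ₗ f) ≫ actCounit X Y m = f
    simp [actCounit_naturality]
  right_inv f := by
    change actUnit X Y z ≫ X ⊴ₗ (Y ⊴ₗ f ≫ actCounit X Y m) = f
    simp [← actUnit_naturality_assoc]

lemma tensorRight_additive [MonoidalPreadditive A] (a : A) : (tensorRight a).Additive where
  map_add := MonoidalPreadditive.add_whiskerRight _ _

lemma tensorRight_linear [MonoidalPreadditive A] [MonoidalLinear k A] (a : A) :
    (tensorRight a).Linear k where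
  map_smul f c := MonoidalLinear.smul_whiskerRight c f a

section Tensor

variable [MonoidalPreadditive A] [MonoidalLinear k A]

lemma tensorCurry_whiskerRight_comp (X Y : A) [ExactPairing X Y] {z z' x : A} (f : z ⟶ z')
    (v : z' ⊗ X ⟶ x) : tensorCurry k X Y z x (f ▷ X ≫ v) = f ≫ tensorCurry k X Y z' x v := by
  change tensorUnit X Y z ≫ (f ▷ X ≫ v) ▷ Y = f ≫ tensorUnit X Y z' ≫ v ▷ Y
  simp [tensorUnit_naturality_assoc]

lemma tensorUncurry_comp_whiskerRight (X Y : A) [ExactPairing X Y] {x z z' : A}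
    (v : x ⟶ z ⊗ Y) (f : z ⟶ z') :
    tensorUncurry k X Y x z' (v ≫ f ▷ Y) = tensorUncurry k X Y x z v ≫ f := by
  change (v ≫ f ▷ Y) ▷ X ≫ tensorCounit X Y z' = (v ▷ X ≫ tensorCounit X Y z) ≫ f
  simp [tensorCounit_naturality]

/-- The bijection `Hom(z ⊗ X, x) ≃ Hom(z, x ⊗ Y)` for `Y` a right dual of `X`. -/
def tensorCurryEquiv (X Y : A) [ExactPairing X Y]
    (z x : A) : (z ⊗ X ⟶ x) ≃ₗ[k] (z ⟶ x ⊗ Y) where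
  __ := tensorCurry k X Y z x
  invFun := tensorUncurry k X Y z x
  left_inv f := by
    change (tensorUnit X Y z ≫ f ▷ Y) ▷ X ≫ tensorCounit X Y x = f
    simp [tensorCounit_naturality]
  right_inv f := by
    change tensorUnit X Y z ≫ (f ▷ X ≫ tensorCounit X Y x) ▷ Y = f
    simp [← tensorUnit_naturality_assoc]

end Tensor

end Linear

end DualityAdjunctions

/-! ### Twisted module structures of the Nakayama functors -/

section NakayamaModuleStr

variable {k : Type w} [Field k]
variable {A : Type u} [Category.{v} A] [Abelian A] [Linear k A] [MonoidalCategory A]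
  [RigidCategory A]
variable {M : Type u'} [Category.{v'} M] [Abelian M] [Linear k M] [IsFiniteLinear k M]
  [MonoidalLeftAction A M] [BilinearAction k A M]

/-- The canonical isomorphism `a^∨∨.N^l(m) ≅ N^l(a.m)` is the comparison for the adjunction between
acting with `a^∨∨` and with `a^∨`, since `a.m` represents `z ↦ Hom(a^∨.z, m)`. -/
lemma LeftNakayama.nonempty_moduleStr (N : LeftNakayama k M) : Nonempty (N.ModuleStr A) := by
  have (a : A) (m : M) := by
    have := actionLeft_additive (M := M) k (rr a)
    have := actionLeft_linear (M := M) k (rr a)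
    exact N.exists_comparison N (actAdjunction (HasRightDual.rightDual a) (rr a))
      (y := m) (Y := a ⊙ₗ m) (fun z => actCurryEquiv k a (HasRightDual.rightDual a) z m)
      fun x x' f v => actCurry_actionHomRight_comp k _ _ f v
  choose iso spec using this
  exact ⟨⟨iso, spec⟩⟩

/-- The canonical isomorphism `N^r(a.m) ≅ ^∨∨a.N^r(m)` is the comparison for the adjunction between
acting with `^∨a` and with `^∨∨a`, since `a.m` corepresents `z ↦ Hom(m, ^∨a.z)`. -/
lemma RightNakayama.nonempty_moduleStr (N : RightNakayama k M) : Nonempty (N.ModuleStr A) := by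
  have (a : A) (m : M) := by
    have := actionLeft_additive (M := M) k (ll a)
    have := actionLeft_linear (M := M) k (ll a)
    exact N.exists_comparison N (actAdjunction (ll a) (HasLeftDual.leftDual a))
      (y := m) (Y := a ⊙ₗ m) (fun z => (actCurryEquiv k (HasLeftDual.leftDual a) a m z).symm)
      fun x x' f v => actUncurry_comp_actionHomRight k _ _ v f
  choose iso spec using this
  exact ⟨⟨iso, spec⟩⟩

variable [MonoidalPreadditive A] [MonoidalLinear k A] [IsFiniteLinear k A]

lemma LeftNakayama.nonempty_rightModuleStr (N : LeftNakayama k A) :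
    Nonempty N.RightModuleStr := by
  have (x b : A) := by
    have := tensorRight_additive (ll b)
    have := tensorRight_linear k (ll b)
    exact N.exists_comparison N (tensorAdjunction (ll b) (HasLeftDual.leftDual b))
      (y := x) (Y := x ⊗ b) (fun z => tensorCurryEquiv k (HasLeftDual.leftDual b) b z x)
      fun y y' f v => tensorCurry_whiskerRight_comp k _ _ f v
  choose iso spec using this
  exact ⟨⟨iso, spec⟩⟩

lemma RightNakayama.nonempty_rightModuleStr (N : RightNakayama k A) :
    Nonempty N.RightModuleStr := by
  have (x b : A) := by
    have := tensorRight_additive (rr b)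
    have := tensorRight_linear k (rr b)
    exact N.exists_comparison N (tensorAdjunction (HasRightDual.rightDual b) (rr b))
      (y := x) (Y := x ⊗ b) (fun z => (tensorCurryEquiv k b (HasRightDual.rightDual b) x z).symm)
      fun y y' f v => tensorUncurry_comp_whiskerRight k _ _ v f
  choose iso spec using this
  exact ⟨⟨iso, spec⟩⟩

lemma LeftNakayama.nonempty_radford (N : LeftNakayama k A) : Nonempty N.Radford := by
  obtain ⟨l⟩ := N.nonempty_moduleStr (A := A)
  obtain ⟨r⟩ := N.nonempty_rightModuleStr
  exact ⟨⟨l, r, fun a => l.iso a (𝟙_ A) ≪≫ N.functor.mapIso (ρ_ a) ≪≫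
    N.functor.mapIso (λ_ a).symm ≪≫ (r.iso (𝟙_ A) a).symm, fun a => by
      simp [← Functor.map_comp]⟩⟩

lemma RightNakayama.nonempty_radford (N : RightNakayama k A) : Nonempty N.Radford := by
  obtain ⟨l⟩ := N.nonempty_moduleStr (A := A)
  obtain ⟨r⟩ := N.nonempty_rightModuleStr
  exact ⟨⟨l, r, fun a => (r.iso (𝟙_ A) a).symm ≪≫ N.functor.mapIso (λ_ a) ≪≫
    N.functor.mapIso (ρ_ a).symm ≪≫ l.iso a (𝟙_ A), fun a => by
      simp [← Functor.map_comp_assoc N.functor (λ_ a).inv]⟩⟩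

end NakayamaModuleStr

/-! ### Calculus of inner Homs -/

section DualityActions

variable {A : Type u} [Category.{v} A] [MonoidalCategory A]
variable {M : Type u'} [Category.{v'} M] [MonoidalLeftAction A M]

lemma tensorUnit_actionHomLeft (X Y x : A) [ExactPairing X Y] (m : M) :
    tensorUnit X Y x ⊵ₗ m = x ⊴ₗ actUnit X Y m ≫ (αₗ x X (Y ⊙ₗ m)).inv ≫
      (αₗ (x ⊗ X) Y m).inv := by
  simp only [tensorUnit, actUnit, MonoidalLeftAction.comp_actionHomLeft,
    MonoidalLeftAction.whiskerLeft_actionHomLeft, rightUnitor_inv_actionHom,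
    associator_inv_actionHom, MonoidalLeftAction.actionHomRight_comp, Category.assoc,
    Iso.inv_hom_id_assoc]

lemma tensorCounit_actionHomLeft (X Y x : A) [ExactPairing X Y] (m : M) :
    tensorCounit X Y x ⊵ₗ m = (αₗ (x ⊗ Y) X m).hom ≫ (αₗ x Y (X ⊙ₗ m)).hom ≫
      x ⊴ₗ actCounit X Y m := by
  simp only [tensorCounit, actCounit, MonoidalLeftAction.comp_actionHomLeft,
    MonoidalLeftAction.whiskerLeft_actionHomLeft, MonoidalLeftAction.rightUnitor_actionHom,
    associator_hom_actionHom, MonoidalLeftAction.actionHomRight_comp, Category.assoc,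
    Iso.inv_hom_id_assoc]

lemma actUnit_actionHomLeft (X Y x : A) [ExactPairing X Y] (m : M) :
    (actUnit X Y x : x ⟶ X ⊗ Y ⊗ x) ⊵ₗ m = actUnit X Y (x ⊙ₗ m) ≫
      X ⊴ₗ (αₗ Y x m).inv ≫ (αₗ X (Y ⊗ x) m).inv := by
  trans ((λ_ x).inv ≫ η_ X Y ▷ x ≫ (α_ X Y x).hom) ⊵ₗ m
  · rfl
  simp only [actUnit, MonoidalLeftAction.comp_actionHomLeft,
    MonoidalLeftAction.whiskerRight_actionHomLeft, leftUnitor_inv_actionHom,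
    associator_hom_actionHom, Category.assoc, Iso.inv_hom_id_assoc]

lemma actCounit_actionHomLeft (X Y x : A) [ExactPairing X Y] (m : M) :
    (actCounit X Y x : Y ⊗ X ⊗ x ⟶ x) ⊵ₗ m = (αₗ Y (X ⊗ x) m).hom ≫
      Y ⊴ₗ (αₗ X x m).hom ≫ actCounit X Y (x ⊙ₗ m) := by
  trans ((α_ Y X x).inv ≫ ε_ X Y ▷ x ≫ (λ_ x).hom) ⊵ₗ m
  · rfl
  simp only [actCounit, MonoidalLeftAction.comp_actionHomLeft,
    MonoidalLeftAction.whiskerRight_actionHomLeft, MonoidalLeftAction.leftUnitor_actionHom,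
    associator_inv_actionHom, Category.assoc, Iso.inv_hom_id_assoc]

@[simp]
lemma actionHomRight_actUnit_actCounit (b X Y : A) [ExactPairing X Y] (m : M) :
    b ⊴ₗ actUnit X Y (X ⊙ₗ m) ≫ b ⊴ₗ X ⊴ₗ actCounit X Y m = 𝟙 _ := by
  rw [← MonoidalLeftAction.actionHomRight_comp, actUnit_actCounit_right,
    MonoidalLeftAction.actionHomRight_id]

@[simp]
lemma actionHomRight_actUnit_actCounit_assoc (b X Y : A) [ExactPairing X Y] (m : M)
    {Z : M} (h : b ⊙ₗ X ⊙ₗ m ⟶ Z) :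
    b ⊴ₗ actUnit X Y (X ⊙ₗ m) ≫ b ⊴ₗ X ⊴ₗ actCounit X Y m ≫ h = h := by
  rw [reassoc_of% (actionHomRight_actUnit_actCounit b X Y m)]

end DualityActions

namespace InnerHom

variable {A : Type u} [Category.{v} A] [MonoidalCategory A]
variable {M : Type u'} [Category.{v'} M] [MonoidalLeftAction A M]
variable (H : InnerHom A M)

open MonoidalLeftAction

lemma homEquiv_symm_apply {a : A} {m n : M} (u : a ⟶ H.hom m n) :
    H.homEquiv.symm u = u ⊵ₗ m ≫ H.ev m n := by
  have := H.adj.homEquiv_symm_naturality_two (X₁ := m) u (𝟙 (H.hom m n))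
  rw [Category.comp_id] at this
  exact this

@[simp]
lemma homEquiv_ev {a : A} {m n : M} (v : a ⊙ₗ m ⟶ n) : H.homEquiv v ⊵ₗ m ≫ H.ev m n = v := by
  rw [← homEquiv_symm_apply, Equiv.symm_apply_apply]

@[simp]
lemma homEquiv_ev_assoc {a : A} {m n : M} (v : a ⊙ₗ m ⟶ n) {Z : M} (h : n ⟶ Z) :
    H.homEquiv v ⊵ₗ m ≫ H.ev m n ≫ h = v ≫ h := by
  rw [reassoc_of% (H.homEquiv_ev v)]

variable {H} in
/-- Morphisms into an inner Hom are detected by the evaluation. -/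
lemma hom_ext {a : A} {m n : M} {u u' : a ⟶ H.hom m n}
    (h : u ⊵ₗ m ≫ H.ev m n = u' ⊵ₗ m ≫ H.ev m n) : u = u' :=
  H.homEquiv.symm.injective (by rwa [homEquiv_symm_apply, homEquiv_symm_apply])

@[simp]
lemma post_ev (m : M) {n n' : M} (g : n ⟶ n') :
    H.post m g ⊵ₗ m ≫ H.ev m n' = H.ev m n ≫ g := by
  rw [← homEquiv_symm_apply]
  have := H.adj.homEquiv_symm_naturality_three (X₁ := m) g (𝟙 (H.hom m n))
  rw [Category.id_comp] at this
  exact this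

@[simp]
lemma actionHomRight_post_ev (b : A) (m : M) {n n' : M} (g : n ⟶ n') :
    b ⊴ₗ H.post m g ⊵ₗ m ≫ b ⊴ₗ H.ev m n' = b ⊴ₗ H.ev m n ≫ b ⊴ₗ g := by
  simp only [← actionHomRight_comp, post_ev]

@[simp]
lemma actionHomRight_post_ev_assoc (b : A) (m : M) {n n' : M} (g : n ⟶ n')
    {Z : M} (h : b ⊙ₗ n' ⟶ Z) :
    b ⊴ₗ H.post m g ⊵ₗ m ≫ b ⊴ₗ H.ev m n' ≫ h = b ⊴ₗ H.ev m n ≫ b ⊴ₗ g ≫ h := by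
  rw [reassoc_of% (H.actionHomRight_post_ev b m g)]

@[simp]
lemma pre_ev {m m' : M} (f : m ⟶ m') (n : M) :
    H.pre f n ⊵ₗ m ≫ H.ev m n = H.hom m' n ⊴ₗ f ≫ H.ev m' n := by
  rw [← homEquiv_symm_apply]
  have := H.adj.homEquiv_symm_naturality_one f (𝟙 (H.hom m' n))
  rw [Category.id_comp] at this
  exact this

@[simp]
lemma actionHomRight_pre_ev (b : A) {m m' : M} (f : m ⟶ m') (n : M) :
    b ⊴ₗ H.pre f n ⊵ₗ m ≫ b ⊴ₗ H.ev m n = b ⊴ₗ H.hom m' n ⊴ₗ f ≫ b ⊴ₗ H.ev m' n := by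
  simp only [← actionHomRight_comp, pre_ev]

@[simp]
lemma actionHomRight_pre_ev_assoc (b : A) {m m' : M} (f : m ⟶ m') (n : M)
    {Z : M} (h : b ⊙ₗ n ⟶ Z) :
    b ⊴ₗ H.pre f n ⊵ₗ m ≫ b ⊴ₗ H.ev m n ≫ h = b ⊴ₗ H.hom m' n ⊴ₗ f ≫ b ⊴ₗ H.ev m' n ≫ h := by
  rw [reassoc_of% (H.actionHomRight_pre_ev b f n)]

@[simp]
lemma actPost_ev (a : A) (m n : M) :
    H.actPost a m n ⊵ₗ m ≫ H.ev m (a ⊙ₗ n) = (αₗ a (H.hom m n) m).hom ≫ a ⊴ₗ H.ev m n :=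
  H.homEquiv_ev _

@[simp]
lemma actPost_ev_assoc (a : A) (m n : M) {Z : M} (h : a ⊙ₗ n ⟶ Z) :
    H.actPost a m n ⊵ₗ m ≫ H.ev m (a ⊙ₗ n) ≫ h = (αₗ a (H.hom m n) m).hom ≫ a ⊴ₗ H.ev m n ≫ h := by
  rw [reassoc_of% (H.actPost_ev a m n)]

@[simp]
lemma actionHomRight_actPost_ev (b : A) (a : A) (m n : M) :
    b ⊴ₗ H.actPost a m n ⊵ₗ m ≫ b ⊴ₗ H.ev m (a ⊙ₗ n) =
      b ⊴ₗ (αₗ a (H.hom m n) m).hom ≫ b ⊴ₗ a ⊴ₗ H.ev m n := by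
  simp only [← actionHomRight_comp, actPost_ev]

@[simp]
lemma actionHomRight_actPost_ev_assoc (b : A) (a : A) (m n : M) {Z : M} (h : b ⊙ₗ a ⊙ₗ n ⟶ Z) :
    b ⊴ₗ H.actPost a m n ⊵ₗ m ≫ b ⊴ₗ H.ev m (a ⊙ₗ n) ≫ h =
      b ⊴ₗ (αₗ a (H.hom m n) m).hom ≫ b ⊴ₗ a ⊴ₗ H.ev m n ≫ h := by
  rw [reassoc_of% (H.actionHomRight_actPost_ev b a m n)]

@[simp]
lemma actPre_ev (X Y : A) [ExactPairing X Y] (m n : M) :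
    H.actPre X Y m n ⊵ₗ (X ⊙ₗ m) ≫ H.ev (X ⊙ₗ m) n =
      (αₗ (H.hom m n) Y (X ⊙ₗ m)).hom ≫ H.hom m n ⊴ₗ actCounit X Y m ≫ H.ev m n :=
  H.homEquiv_ev _

@[simp]
lemma actPre_ev_assoc (X Y : A) [ExactPairing X Y] (m n : M) {Z : M} (h : n ⟶ Z) :
    H.actPre X Y m n ⊵ₗ (X ⊙ₗ m) ≫ H.ev (X ⊙ₗ m) n ≫ h =
      (αₗ (H.hom m n) Y (X ⊙ₗ m)).hom ≫ H.hom m n ⊴ₗ actCounit X Y m ≫ H.ev m n ≫ h := by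
  rw [reassoc_of% (H.actPre_ev X Y m n)]

@[simp]
lemma actionHomRight_actPre_ev (b : A) (X Y : A) [ExactPairing X Y] (m n : M) :
    b ⊴ₗ H.actPre X Y m n ⊵ₗ (X ⊙ₗ m) ≫ b ⊴ₗ H.ev (X ⊙ₗ m) n =
      b ⊴ₗ (αₗ (H.hom m n) Y (X ⊙ₗ m)).hom ≫ b ⊴ₗ H.hom m n ⊴ₗ actCounit X Y m ≫
        b ⊴ₗ H.ev m n := by
  simp only [← actionHomRight_comp, actPre_ev]

@[simp]
lemma actionHomRight_actPre_ev_assoc (b : A) (X Y : A) [ExactPairing X Y] (m n : M)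
    {Z : M} (h : b ⊙ₗ n ⟶ Z) :
    b ⊴ₗ H.actPre X Y m n ⊵ₗ (X ⊙ₗ m) ≫ b ⊴ₗ H.ev (X ⊙ₗ m) n ≫ h =
      b ⊴ₗ (αₗ (H.hom m n) Y (X ⊙ₗ m)).hom ≫ b ⊴ₗ H.hom m n ⊴ₗ actCounit X Y m ≫
        b ⊴ₗ H.ev m n ≫ h := by
  rw [reassoc_of% (H.actionHomRight_actPre_ev b X Y m n)]

/-- The composition `IHom(x, n) ⊗ IHom(m, x) ⟶ IHom(m, n)`. -/
def comp (m x n : M) : H.hom x n ⊗ H.hom m x ⟶ H.hom m n :=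
  H.homEquiv ((αₗ _ _ _).hom ≫ H.hom x n ⊴ₗ H.ev m x ≫ H.ev x n)

@[simp]
lemma comp_ev (m x n : M) :
    H.comp m x n ⊵ₗ m ≫ H.ev m n = (αₗ _ _ _).hom ≫ H.hom x n ⊴ₗ H.ev m x ≫ H.ev x n :=
  H.homEquiv_ev _

@[simp]
lemma comp_ev_assoc (m x n : M) {Z : M} (h : n ⟶ Z) :
    H.comp m x n ⊵ₗ m ≫ H.ev m n ≫ h =
      (αₗ (H.hom x n) (H.hom m x) m).hom ≫ H.hom x n ⊴ₗ H.ev m x ≫ H.ev x n ≫ h := by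
  rw [reassoc_of% (H.comp_ev m x n)]

@[simp]
lemma actionHomRight_comp_ev (b : A) (m x n : M) :
    b ⊴ₗ H.comp m x n ⊵ₗ m ≫ b ⊴ₗ H.ev m n =
      b ⊴ₗ (αₗ _ _ _).hom ≫ b ⊴ₗ H.hom x n ⊴ₗ H.ev m x ≫ b ⊴ₗ H.ev x n := by
  simp only [← actionHomRight_comp, comp_ev]

@[simp]
lemma pre_id (m n : M) : H.pre (𝟙 m) n = 𝟙 _ := hom_ext (by simp)

lemma pre_comp {m m' m'' : M} (f : m ⟶ m') (g : m' ⟶ m'') (n : M) :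
    H.pre (f ≫ g) n = H.pre g n ≫ H.pre f n := by
  simp [pre]

lemma pre_post {m m' n n' : M} (f : m ⟶ m') (g : n ⟶ n') :
    H.pre f n ≫ H.post m g = H.post m' g ≫ H.pre f n' :=
  ((H.functor.map f.op).naturality g).symm

lemma pre_post_assoc {m m' n n' : M} (f : m ⟶ m') (g : n ⟶ n') {Z : A} (h : H.hom m n' ⟶ Z) :
    H.pre f n ≫ H.post m g ≫ h = H.post m' g ≫ H.pre f n' ≫ h := by
  rw [reassoc_of% (H.pre_post f g)]

lemma actPost_post (a : A) (m : M) {n n' : M} (g : n ⟶ n') :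
    a ◁ H.post m g ≫ H.actPost a m n' = H.actPost a m n ≫ H.post m (a ⊴ₗ g) :=
  hom_ext (by simp [-actionHomLeft_action])

lemma actPost_post_assoc (a : A) (m : M) {n n' : M} (g : n ⟶ n')
    {Z : A} (h : H.hom m (a ⊙ₗ n') ⟶ Z) :
    a ◁ H.post m g ≫ H.actPost a m n' ≫ h = H.actPost a m n ≫ H.post m (a ⊴ₗ g) ≫ h := by
  rw [reassoc_of% (H.actPost_post a m g)]

lemma actPost_left {a b : A} (f : a ⟶ b) (m n : M) :
    f ▷ H.hom m n ≫ H.actPost b m n = H.actPost a m n ≫ H.post m (f ⊵ₗ n) :=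
  hom_ext (by simp [-actionHomLeft_action, whiskerRight_actionHomLeft, action_exchange])

lemma actPost_left_assoc {a b : A} (f : a ⟶ b) (m n : M) {Z : A} (h : H.hom m (b ⊙ₗ n) ⟶ Z) :
    f ▷ H.hom m n ≫ H.actPost b m n ≫ h = H.actPost a m n ≫ H.post m (f ⊵ₗ n) ≫ h := by
  rw [reassoc_of% (H.actPost_left f m n)]

lemma actPost_pre (a : A) {m m' : M} (f : m ⟶ m') (n : M) :
    a ◁ H.pre f n ≫ H.actPost a m n = H.actPost a m' n ≫ H.pre f (a ⊙ₗ n) :=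
  hom_ext (by simp [-actionHomLeft_action, ← action_exchange_assoc])

lemma actPost_tensor (a b : A) (m n : M) :
    H.actPost (a ⊗ b) m n ≫ H.post m (αₗ a b n).hom =
      (α_ a b (H.hom m n)).hom ≫ a ◁ H.actPost b m n ≫ H.actPost a m (b ⊙ₗ n) :=
  hom_ext (by
    simp only [comp_actionHomLeft, Category.assoc, post_ev, actPost_ev_assoc, actPost_ev,
      whiskerLeft_actionHomLeft, Iso.inv_hom_id_assoc]
    simp [-actionHomLeft_action, associator_hom_actionHom])

lemma actPost_unit (m n : M) :
    H.actPost (𝟙_ A) m n ≫ H.post m (λₗ[A] n).hom = (λ_ (H.hom m n)).hom :=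
  hom_ext (by simp)

lemma actPre_post (X Y : A) [ExactPairing X Y] (m : M) {n n' : M} (g : n ⟶ n') :
    H.post m g ▷ Y ≫ H.actPre X Y m n' = H.actPre X Y m n ≫ H.post (X ⊙ₗ m) g :=
  hom_ext (by
    simp [-actionHomLeft_action, whiskerRight_actionHomLeft, ← action_exchange_assoc])

lemma actPre_post_assoc (X Y : A) [ExactPairing X Y] (m : M) {n n' : M} (g : n ⟶ n')
    {Z : A} (h : H.hom (X ⊙ₗ m) n' ⟶ Z) :
    H.post m g ▷ Y ≫ H.actPre X Y m n' ≫ h = H.actPre X Y m n ≫ H.post (X ⊙ₗ m) g ≫ h := by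
  rw [reassoc_of% (H.actPre_post X Y m g)]

lemma actPost_actPre (a X Y : A) [ExactPairing X Y] (m n : M) :
    H.actPost a m n ▷ Y ≫ H.actPre X Y m (a ⊙ₗ n) =
      (α_ _ _ _).hom ≫ a ◁ H.actPre X Y m n ≫ H.actPost a (X ⊙ₗ m) n :=
  hom_ext (by
    simp only [comp_actionHomLeft, Category.assoc, actPre_ev, actPost_ev,
      whiskerLeft_actionHomLeft, whiskerRight_actionHomLeft, Iso.inv_hom_id_assoc,
      ← action_exchange_assoc, tensor_actionHomRight]
    simp [-actionHomLeft_action, associator_hom_actionHom])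

lemma comp_pre {m m' : M} (f : m ⟶ m') (x n : M) :
    H.hom x n ◁ H.pre f x ≫ H.comp m x n = H.comp m' x n ≫ H.pre f n :=
  hom_ext (by
    simp [-actionHomLeft_action, ← action_exchange_assoc])

lemma comp_pre_assoc {m m' : M} (f : m ⟶ m') (x n : M) {Z : A} (h : H.hom m n ⟶ Z) :
    H.hom x n ◁ H.pre f x ≫ H.comp m x n ≫ h = H.comp m' x n ≫ H.pre f n ≫ h := by
  rw [reassoc_of% (H.comp_pre f x n)]

lemma comp_post (m x : M) {n n' : M} (g : n ⟶ n') :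
    H.post x g ▷ H.hom m x ≫ H.comp m x n' = H.comp m x n ≫ H.post m g :=
  hom_ext (by
    simp [-actionHomLeft_action, whiskerRight_actionHomLeft, ← action_exchange_assoc])

lemma comp_post_assoc (m x : M) {n n' : M} (g : n ⟶ n') {Z : A} (h : H.hom m n' ⟶ Z) :
    H.post x g ▷ H.hom m x ≫ H.comp m x n' ≫ h = H.comp m x n ≫ H.post m g ≫ h := by
  rw [reassoc_of% (H.comp_post m x g)]

/-- Composition of inner Homs is dinatural in the middle variable. -/
lemma comp_dinatural (m n : M) {x x' : M} (f : x ⟶ x') :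
    H.pre f n ▷ H.hom m x ≫ H.comp m x n = H.hom x' n ◁ H.post m f ≫ H.comp m x' n :=
  hom_ext (by
    simp [-actionHomLeft_action, whiskerRight_actionHomLeft, ← action_exchange_assoc])

lemma comp_dinatural_assoc (m n : M) {x x' : M} (f : x ⟶ x') {Z : A} (h : H.hom m n ⟶ Z) :
    H.pre f n ▷ H.hom m x ≫ H.comp m x n ≫ h = H.hom x' n ◁ H.post m f ≫ H.comp m x' n ≫ h := by
  rw [reassoc_of% (H.comp_dinatural m n f)]

lemma actPost_comp (b : A) (m x n : M) :
    (α_ b _ _).hom ≫ b ◁ H.comp m x n ≫ H.actPost b m n =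
      H.actPost b x n ▷ H.hom m x ≫ H.comp m x (b ⊙ₗ n) :=
  hom_ext (by
    simp only [comp_actionHomLeft, Category.assoc, comp_ev, actPost_ev,
      whiskerLeft_actionHomLeft, whiskerRight_actionHomLeft, Iso.inv_hom_id_assoc,
      ← action_exchange_assoc, tensor_actionHomRight]
    simp [-actionHomLeft_action, associator_hom_actionHom])

lemma actPre_comp (X Y : A) [ExactPairing X Y] (m x n : M) :
    (α_ _ _ Y).hom ≫ H.hom x n ◁ H.actPre X Y m x ≫ H.comp (X ⊙ₗ m) x n =
      H.comp m x n ▷ Y ≫ H.actPre X Y m n :=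
  hom_ext (by
    simp only [comp_actionHomLeft, Category.assoc, comp_ev, actPre_ev,
      whiskerLeft_actionHomLeft, whiskerRight_actionHomLeft, Iso.inv_hom_id_assoc,
      ← action_exchange_assoc, tensor_actionHomRight]
    simp [-actionHomLeft_action, associator_hom_actionHom])

/-- Acting with dual objects in the middle variable of a composition cancels. -/
lemma actPre_actPost_comp (X Y : A) [ExactPairing X Y] (m x n : M) :
    H.actPre X Y x n ▷ (X ⊗ H.hom m x) ≫
      H.hom (X ⊙ₗ x) n ◁ H.actPost X m x ≫ H.comp m (X ⊙ₗ x) n =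
    (α_ _ _ _).inv ≫ tensorCounit X Y (H.hom x n) ▷ H.hom m x ≫ H.comp m x n :=
  hom_ext (by
    simp only [comp_actionHomLeft, Category.assoc, comp_ev, actPre_ev,
      whiskerLeft_actionHomLeft, whiskerRight_actionHomLeft, Iso.inv_hom_id_assoc,
      ← action_exchange_assoc, tensor_actionHomRight]
    have h : H.hom x n ⊴ₗ Y ⊴ₗ H.actPost X m x ⊵ₗ m ≫ H.hom x n ⊴ₗ Y ⊴ₗ H.ev m (X ⊙ₗ x) =
        H.hom x n ⊴ₗ Y ⊴ₗ (αₗ X (H.hom m x) m).hom ≫ H.hom x n ⊴ₗ Y ⊴ₗ X ⊴ₗ H.ev m x := by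
      simp only [← actionHomRight_comp, actPost_ev]
    simp [-actionHomLeft_action, associator_inv_actionHom, tensorCounit_actionHomLeft,
      reassoc_of% h])

lemma actPre_actPost_comp_assoc (X Y : A) [ExactPairing X Y] (m x n : M)
    {Z : A} (h : H.hom m n ⟶ Z) :
    H.actPre X Y x n ▷ (X ⊗ H.hom m x) ≫
      H.hom (X ⊙ₗ x) n ◁ H.actPost X m x ≫ H.comp m (X ⊙ₗ x) n ≫ h =
    (α_ _ _ _).inv ≫ tensorCounit X Y (H.hom x n) ▷ H.hom m x ≫ H.comp m x n ≫ h := by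
  rw [reassoc_of% (H.actPre_actPost_comp X Y m x n)]

/-- The morphism `IHom(X.m, n) ⊗ X ⟶ IHom(m, n)` that corresponds to the evaluation
`IHom(X.m, n).X.m ⟶ n`. It is the mate of the inverse of `IHom(m, n) ⊗ X^∨ ≅ IHom(X.m, n)`. -/
def contract (X : A) (m n : M) : H.hom (X ⊙ₗ m) n ⊗ X ⟶ H.hom m n :=
  H.homEquiv ((αₗ _ _ _).hom ≫ H.ev (X ⊙ₗ m) n)

@[simp]
lemma contract_ev (X : A) (m n : M) :
    H.contract X m n ⊵ₗ m ≫ H.ev m n = (αₗ _ _ _).hom ≫ H.ev (X ⊙ₗ m) n :=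
  H.homEquiv_ev _

lemma actPre_contract (X Y : A) [ExactPairing X Y] (m n : M) :
    H.actPre X Y m n ▷ X ≫ H.contract X m n = tensorCounit X Y (H.hom m n) :=
  hom_ext (by
    simp [-actionHomLeft_action, whiskerRight_actionHomLeft, tensorCounit_actionHomLeft])

instance isIso_actPre (X Y : A) [ExactPairing X Y] (m n : M) : IsIso (H.actPre X Y m n) := by
  refine ⟨tensorUnit X Y (H.hom (X ⊙ₗ m) n) ≫ H.contract X m n ▷ Y, ?_, ?_⟩
  · rw [tensorUnit_naturality_assoc, ← comp_whiskerRight, actPre_contract,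
      tensorUnit_tensorCounit_right]
  · refine hom_ext ?_
    simp [-actionHomLeft_action, whiskerRight_actionHomLeft, tensorUnit_actionHomLeft,
      ← action_exchange_assoc]

lemma actPost_actCounit (X Y : A) [ExactPairing X Y] (m n : M) :
    Y ◁ H.actPost X m n ≫ H.actPost Y m (X ⊙ₗ n) ≫ H.post m (actCounit X Y n) =
      (actCounit X Y (H.hom m n) : Y ⊗ X ⊗ H.hom m n ⟶ _) :=
  hom_ext (by
    simp [-actionHomLeft_action, actCounit_actionHomLeft, actCounit_naturality])

lemma actUnit_actPost (X Y : A) [ExactPairing X Y] (m n : M) :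
    (actUnit X Y (H.hom m n) : _ ⟶ X ⊗ Y ⊗ H.hom m n) ≫ X ◁ H.actPost Y m n ≫
      H.actPost X m (Y ⊙ₗ n) = H.post m (actUnit X Y n) :=
  hom_ext (by
    simp [-actionHomLeft_action, actUnit_actionHomLeft, ← actUnit_naturality])

instance isIso_actPost [RigidCategory A] (X : A) (m n : M) : IsIso (H.actPost X m n) := by
  let Y := HasRightDual.rightDual X
  refine ⟨(actUnit X Y (H.hom m (X ⊙ₗ n)) : _ ⟶ X ⊗ Y ⊗ _) ≫
    X ◁ (H.actPost Y m (X ⊙ₗ n) ≫ H.post m (actCounit X Y n)), ?_, ?_⟩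
  · have h1 : H.actPost X m n ≫ (actUnit X Y (H.hom m (X ⊙ₗ n)) : _ ⟶ X ⊗ Y ⊗ _) =
      (actUnit X Y (X ⊗ H.hom m n) : _ ⟶ X ⊗ Y ⊗ _) ≫ X ◁ Y ◁ H.actPost X m n :=
      actUnit_naturality X Y (H.actPost X m n)
    rw [reassoc_of% h1, ← MonoidalCategory.whiskerLeft_comp, actPost_actCounit]
    exact actUnit_actCounit_right X Y (H.hom m n)
  · rw [MonoidalCategory.whiskerLeft_comp, Category.assoc, Category.assoc, actPost_post,
      reassoc_of% (H.actUnit_actPost X Y m (X ⊙ₗ n)), ← Functor.map_comp,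
      actUnit_actCounit_right]
    exact (H.functor.obj (op m)).map_id _

end InnerHom

/-! ### Existence and exactness of inner Homs -/

section Exactness

variable {C : Type u} [Category.{v} C] [Abelian C] {D : Type u'} [Category.{v'} D] [Abelian D]

/-- A left exact functor that preserves epimorphisms is right exact. -/
lemma preservesFiniteColimits_of_epi (F : C ⥤ D) [F.Additive] [PreservesFiniteLimits F]
    (hF : ∀ {x y : C} (f : x ⟶ y), Epi f → Epi (F.map f)) : PreservesFiniteColimits F :=
  ((F.preservesFiniteColimits_tfae).out 0 3).1 fun S hS => by
    have h : ∀ S : ShortComplex C, S.ShortExact → (S.map F).Exact ∧ Mono (F.map S.f) :=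
      ((F.preservesFiniteLimits_tfae).out 0 3).2 ‹_›
    exact ⟨(h S hS).1, hF _ hS.epi_g⟩

lemma existsUnique_desc_of_preservesFiniteColimits (F : C ⥤ D) [F.Additive]
    [PreservesFiniteColimits F] {x y z : C} (f : x ⟶ y) (g : y ⟶ z) (w : f ≫ g = 0)
    (hc : IsColimit (CokernelCofork.ofπ g w)) {t : D} (u : F.obj y ⟶ t) (hu : F.map f ≫ u = 0) :
    ∃! v, F.map g ≫ v = u := by
  have hc' := CokernelCofork.mapIsColimit _ hc F
  obtain ⟨v, hv⟩ := CokernelCofork.IsColimit.desc' hc' u hu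
  refine ⟨v, hv, fun v' hv' => ?_⟩
  exact Cofork.IsColimit.hom_ext hc' (hv'.trans hv.symm)

end Exactness

section Existence

variable {k : Type w} [Field k]
variable {A : Type u} [Category.{v} A] [Abelian A] [Linear k A] [MonoidalCategory A]
variable {M : Type u'} [Category.{v'} M] [Abelian M] [Linear k M] [MonoidalLeftAction A M]

open MonoidalLeftAction

variable (A M) in
omit [Abelian A] [Abelian M] in
/-- Inner Homs from representing objects of the functors `Hom(-.m, n)`. -/
lemma InnerHom.nonempty_of_equiv (E : M → M → A)
    (e : ∀ (m : M) (a : A) (n : M), (a ⊙ₗ m ⟶ n) ≃ (a ⟶ E m n))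
    (he : ∀ (m : M) {a b : A} (n : M) (f : a ⟶ b) (g : b ⊙ₗ m ⟶ n),
      e m a n (f ⊵ₗ m ≫ g) = f ≫ e m b n g) :
    Nonempty (InnerHom A M) := by
  let F := (curriedAction A M).flip
  let G (m : M) : M ⥤ A := Adjunction.rightAdjointOfEquiv (F := F.obj m) (G_obj := E m) (e m)
    fun _ _ n f g => he m n f g
  let adj (m : M) : F.obj m ⊣ G m := Adjunction.adjunctionOfEquivRight (F := F.obj m)
    (G_obj := E m) (e m) fun _ _ n f g => he m n f g
  let K : Mᵒᵖ ⥤ M ⥤ A :=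
    { obj := fun m => G m.unop
      map := fun f => conjugateEquiv (adj _) (adj _) (F.map f.unop)
      map_id := fun m => (congr_arg _ (F.map_id _)).trans (conjugateEquiv_id _)
      map_comp := fun f g => (congr_arg _ (F.map_comp _ _)).trans
        (conjugateEquiv_comp _ _ _ _ _).symm }
  exact ⟨⟨K, ⟨adj, fun f => by
    ext a
    exact (unit_conjugateEquiv (adj _) (adj _) (F.map f) a).symm⟩⟩⟩

variable (k A M) in
/-- The functor `a ↦ Hom(a.m, n)` is left exact, hence represented by the inner Hom. -/
theorem nonempty_innerHom [IsFiniteLinear k A] [IsFiniteLinear k M]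
    [ModuleCategory k A M] : Nonempty (InnerHom A M) := by
  obtain ⟨P, hP⟩ := exists_isProjectiveSeparator k A
  have (m n : M) : ∃ (X : A) (u : X ⊙ₗ m ⟶ n), ∀ a : A,
      Function.Bijective fun f : a ⟶ X => f ⊵ₗ m ≫ u := by
    have := ModuleCategory.preservesFiniteColimits k (A := A) m
    have := actionRight_additive (A := A) k m
    exact hP.exists_universal (k := k) (F := fun a : A => (a ⊙ₗ m ⟶ n))
      { map := LinearMap.mk₂ k (fun f v => f ⊵ₗ m ≫ v)
          (fun f g v => by rw [BilinearAction.add_actionHomLeft k, Preadditive.add_comp])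
          (fun c f v => by rw [BilinearAction.smul_actionHomLeft, Linear.smul_comp])
          (fun f v v' => Preadditive.comp_add _ _ _ _ _ _)
          (fun c f v => Linear.comp_smul _ _ _ _ _ _)
        map_id := fun a v => by simp
        map_comp := fun f g v => by simp
        exact := fun f g w hc u hu =>
          existsUnique_desc_of_preservesFiniteColimits (actionRight A m) f g w hc u hu }
  choose X u hu using this
  let e (m : M) (a : A) (n : M) : (a ⊙ₗ m ⟶ n) ≃ (a ⟶ X m n) :=
    (Equiv.ofBijective _ (hu m n a)).symm
  refine InnerHom.nonempty_of_equiv A M X e fun m a b n f g => ?_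
  rw [Equiv.symm_apply_eq]
  change _ = (f ≫ _) ⊵ₗ m ≫ u m n
  rw [comp_actionHomLeft, Category.assoc]
  exact congr_arg (f ⊵ₗ m ≫ ·) ((e m b n).symm_apply_apply g).symm

namespace InnerHom

variable (H : InnerHom A M)

section Linear

variable (k) [BilinearAction k A M]

include k in
lemma post_add (m : M) {n n' : M} (f g : n ⟶ n') : H.post m (f + g) = H.post m f + H.post m g :=
  hom_ext (by
    rw [BilinearAction.add_actionHomLeft k, Preadditive.add_comp]
    simp)

lemma post_smul (m : M) {n n' : M} (c : k) (f : n ⟶ n') : H.post m (c • f) = c • H.post m f :=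
  hom_ext (by
    rw [BilinearAction.smul_actionHomLeft, Linear.smul_comp]
    simp)

include k in
lemma pre_add {m m' : M} (f g : m ⟶ m') (n : M) : H.pre (f + g) n = H.pre f n + H.pre g n :=
  hom_ext (by
    rw [BilinearAction.add_actionHomLeft k, Preadditive.add_comp]
    simp only [pre_ev, BilinearAction.actionHomRight_add k, Preadditive.add_comp])

lemma pre_smul {m m' : M} (c : k) (f : m ⟶ m') (n : M) : H.pre (c • f) n = c • H.pre f n :=
  hom_ext (by
    rw [BilinearAction.smul_actionHomLeft, Linear.smul_comp]
    simp only [pre_ev, BilinearAction.actionHomRight_smul, Linear.smul_comp])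

include k in
lemma additive_post (m : M) : (H.functor.obj (op m)).Additive where
  map_add := H.post_add k m _ _

include k in
lemma additive_pre (n : M) : (H.functor.flip.obj n).Additive where
  map_add {_ _ f g} := H.pre_add k f.unop g.unop n

end Linear

variable (k) [IsFiniteLinear k A]

include k in
/-- The functor `IHom(m, -)` of an exact module category is right exact: for `P ⟶ IHom(m, y)` an
epimorphism with `P` projective, also `P.m` is projective, so that the morphism lifts along
`IHom(m, f)` for any epimorphism `f : x ⟶ y`. -/
lemma preservesFiniteColimits_post [IsFiniteLinear k M] [ModuleCategory k A M]
    (hM : IsExactModuleCategory A M) (m : M) : PreservesFiniteColimits (H.functor.obj (op m)) := by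
  obtain ⟨P, hP⟩ := exists_isProjectiveSeparator k A
  have := hP.enoughProjectives k
  have := H.additive_post k m
  have := (H.adj.adj m).rightAdjoint_preservesLimits
  refine preservesFiniteColimits_of_epi _ fun {x y} f _ => ?_
  let q := Projective.π (H.hom m y)
  have := hM (Projective.over (H.hom m y)) inferInstance m
  let t : Projective.over (H.hom m y) ⟶ H.hom m x :=
    H.homEquiv (Projective.factorThru (H.homEquiv.symm q) f)
  have ht : t ≫ H.post m f = q := hom_ext (by
    simp only [comp_actionHomLeft, Category.assoc, post_ev, t, homEquiv_ev_assoc,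
      Projective.factorThru_comp]
    rw [homEquiv_symm_apply])
  exact epi_of_epi_fac ht

omit [Abelian A] [Abelian M] in
/-- For every `n`, the functor `IHom(-, n) : Mᵒᵖ ⥤ A` is right adjoint to `a ↦ ^∨a.n`. -/
lemma isRightAdjoint_pre [RigidCategory A] (n : M) : (H.functor.flip.obj n).IsRightAdjoint := by
  let e (a : A) (m : Mᵒᵖ) : (op (HasLeftDual.leftDual a ⊙ₗ n) ⟶ m) ≃ (a ⟶ H.hom m.unop n) :=
    (opEquiv _ _).trans
      ((((actAdjunction (HasLeftDual.leftDual a) a).homEquiv m.unop n).symm.trans H.homEquiv))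
  exact (Adjunction.adjunctionOfEquivLeft e fun a m m' g h => by
    refine hom_ext ?_
    change H.homEquiv (a ⊴ₗ (g.unop ≫ h.unop) ≫ actCounit (HasLeftDual.leftDual a) a n) ⊵ₗ _ ≫ _ =
      (H.homEquiv (a ⊴ₗ h.unop ≫ actCounit (HasLeftDual.leftDual a) a n) ≫
        H.pre g.unop n) ⊵ₗ _ ≫ _
    simp only [homEquiv_ev, actionHomRight_comp, comp_actionHomLeft, Category.assoc, pre_ev,
      ← action_exchange_assoc]).isRightAdjoint

include k in
/-- The functor `IHom(-, n)` of an exact module category turns kernels into cokernels: for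
`P ⟶ IHom(x, n)` an epimorphism with `P` projective and `f : x ⟶ y` a monomorphism, the
monomorphism `P.f` splits because its cokernel `P.coker(f)` is projective; a retraction lifts the
given morphism along `IHom(f, n)`. -/
lemma preservesFiniteColimits_pre [RigidCategory A] [IsFiniteLinear k M] [ModuleCategory k A M]
    (hM : IsExactModuleCategory A M) (n : M) : PreservesFiniteColimits (H.functor.flip.obj n) := by
  obtain ⟨P, hP⟩ := exists_isProjectiveSeparator k A
  have := hP.enoughProjectives k
  have := H.additive_pre k n
  have := H.isRightAdjoint_pre n
  refine preservesFiniteColimits_of_epi _ fun {y x} f _ => ?_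
  let Q := Projective.over (H.hom x.unop n)
  let q : Q ⟶ H.hom x.unop n := Projective.π _
  have := actionLeft_additive (M := M) k Q
  let S := ShortComplex.mk f.unop (cokernel.π f.unop) (cokernel.condition _)
  have hS : S.ShortExact :=
    { exact := ShortComplex.exact_of_g_is_cokernel _ (cokernelIsCokernel _)
      mono_f := inferInstanceAs (Mono f.unop)
      epi_g := inferInstanceAs (Epi (cokernel.π f.unop)) }
  have hQ := hS.map_of_exact (actionLeft M Q)
  have : Projective (S.map (actionLeft M Q)).X₃ := hM Q inferInstance _
  obtain ⟨r, hr⟩ : ∃ r : Q ⊙ₗ y.unop ⟶ Q ⊙ₗ x.unop, Q ⊴ₗ f.unop ≫ r = 𝟙 (Q ⊙ₗ x.unop) :=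
    ⟨hQ.splittingOfProjective.r, hQ.splittingOfProjective.f_r⟩
  let t : Q ⟶ H.hom y.unop n := H.homEquiv (r ≫ q ⊵ₗ x.unop ≫ H.ev x.unop n)
  have ht : t ≫ H.pre f.unop n = q := hom_ext (by
    simp only [comp_actionHomLeft, Category.assoc, pre_ev, t]
    rw [← action_exchange_assoc, homEquiv_ev, reassoc_of% hr])
  have : Epi q := inferInstanceAs (Epi (Projective.π _))
  exact epi_of_epi_fac (f := t) (g := (H.functor.flip.obj n).map f) ht

end InnerHom

end Existence

/-! ### Evaluations of dual pairs -/

section Evaluation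

variable {A : Type u} [Category.{v} A] [MonoidalCategory A]

/-- The morphism `e : Y ⊗ X ⟶ 𝟙` is the evaluation of an exact pairing, making `Y` a right dual
of `X`. -/
def IsEvaluation {X Y : A} (e : Y ⊗ X ⟶ 𝟙_ A) : Prop :=
  ∃ _ : ExactPairing X Y, ExactPairing.evaluation X Y = e

lemma isEvaluation_evaluation (X Y : A) [ExactPairing X Y] : IsEvaluation (ε_ X Y) :=
  ⟨inferInstance, rfl⟩

/-- The nested pairing `(Y₂ ⊗ Y₁) ⊗ (X₁ ⊗ X₂) ⟶ Y₂ ⊗ X₂ ⟶ 𝟙`. -/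
def nest {X₁ X₂ Y₁ Y₂ : A} (e₁ : Y₁ ⊗ X₁ ⟶ 𝟙_ A) (e₂ : Y₂ ⊗ X₂ ⟶ 𝟙_ A) :
    (Y₂ ⊗ Y₁) ⊗ X₁ ⊗ X₂ ⟶ 𝟙_ A :=
  (α_ _ _ _).inv ≫ ((α_ _ _ _).hom ≫ Y₂ ◁ e₁ ≫ (ρ_ _).hom) ▷ X₂ ≫ e₂

/-- The tensor product of dual pairs has the nested pairing as its evaluation. -/
lemma ExactPairing.tensor_evaluation_eq_nest (X₁ X₂ Y₁ Y₂ : A) [ExactPairing X₁ Y₁]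
    [ExactPairing X₂ Y₂] : ε_ (X₁ ⊗ X₂) (Y₂ ⊗ Y₁) = nest (ε_ X₁ Y₁) (ε_ X₂ Y₂) := by
  rw [ExactPairing.tensor_evaluation, nest]
  monoidal

lemma leftDualIso_hom_evaluation {X₁ X₂ Y : A} (p₁ : ExactPairing X₁ Y) (p₂ : ExactPairing X₂ Y) :
    Y ◁ (leftDualIso p₁ p₂).hom ≫ ε_ X₂ Y = ε_ X₁ Y := by
  have := @leftAdjointMate_comp_evaluation A _ _ Y Y ⟨X₂⟩ ⟨X₁⟩ (𝟙 Y)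
  rw [id_whiskerRight, Category.id_comp] at this
  exact this

lemma rightDualIso_hom_evaluation {X Y₁ Y₂ : A} (p₁ : ExactPairing X Y₁)
    (p₂ : ExactPairing X Y₂) : (rightDualIso p₁ p₂).hom ▷ X ≫ ε_ X Y₂ = ε_ X Y₁ := by
  have := @rightAdjointMate_comp_evaluation A _ _ X X ⟨Y₂⟩ ⟨Y₁⟩ (𝟙 X)
  rw [MonoidalCategory.whiskerLeft_id, Category.id_comp] at this
  exact this

namespace IsEvaluation

variable {X Y : A} {e : Y ⊗ X ⟶ 𝟙_ A}

lemma bijective_left (h : IsEvaluation e) (a : A) :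
    Function.Bijective fun f : a ⟶ X => Y ◁ f ≫ e := by
  obtain ⟨P, rfl⟩ := h
  have : (fun f : a ⟶ X => Y ◁ f ≫ ε_ X Y) = (tensorLeftHomEquiv a X Y (𝟙_ A)).symm ∘
      ((Iso.refl a).homCongr (ρ_ X).symm) := by
    ext f
    simp [tensorLeftHomEquiv, unitors_equal]
  rw [this]
  exact (Equiv.bijective _).comp (Equiv.bijective _)

lemma bijective_right (h : IsEvaluation e) (a : A) :
    Function.Bijective fun f : a ⟶ Y => f ▷ X ≫ e := by
  obtain ⟨P, rfl⟩ := h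
  have : (fun f : a ⟶ Y => f ▷ X ≫ ε_ X Y) = (tensorRightHomEquiv a X Y (𝟙_ A)).symm ∘
      ((Iso.refl a).homCongr (λ_ Y).symm) := by
    ext f
    simp [tensorRightHomEquiv, ← unitors_equal]
  rw [this]
  exact (Equiv.bijective _).comp (Equiv.bijective _)

lemma injective_left (h : IsEvaluation e) {a : A} {f g : a ⟶ X}
    (hfg : Y ◁ f ≫ e = Y ◁ g ≫ e) : f = g :=
  (h.bijective_left a).1 hfg

lemma injective_right (h : IsEvaluation e) {a : A} {f g : a ⟶ Y}
    (hfg : f ▷ X ≫ e = g ▷ X ≫ e) : f = g :=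
  (h.bijective_right a).1 hfg

lemma exists_leftDual_iso [HasLeftDual Y] (h : IsEvaluation e) :
    ∃ s : HasLeftDual.leftDual Y ≅ X, Y ◁ s.hom ≫ e = ε_ (HasLeftDual.leftDual Y) Y := by
  obtain ⟨P, rfl⟩ := h
  exact ⟨leftDualIso HasLeftDual.exact P, leftDualIso_hom_evaluation _ _⟩

lemma exists_rightDual_iso [HasRightDual X] (h : IsEvaluation e) :
    ∃ s : HasRightDual.rightDual X ≅ Y, s.hom ▷ X ≫ e = ε_ X (HasRightDual.rightDual X) := by
  obtain ⟨P, rfl⟩ := h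
  exact ⟨rightDualIso HasRightDual.exact P, rightDualIso_hom_evaluation _ _⟩

lemma comp_left (h : IsEvaluation e) {X' : A} (i : X' ≅ X) : IsEvaluation (Y ◁ i.hom ≫ e) := by
  obtain ⟨P, rfl⟩ := h
  exact ⟨exactPairingCongrLeft i, rfl⟩

lemma comp_right (h : IsEvaluation e) {Y' : A} (i : Y' ≅ Y) : IsEvaluation (i.hom ▷ X ≫ e) := by
  obtain ⟨P, rfl⟩ := h
  exact ⟨exactPairingCongrRight i, rfl⟩

lemma of_comp {X' Y' : A} (f : Y' ⟶ Y) (g : X' ⟶ X) [IsIso f] [IsIso g]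
    (h : IsEvaluation (f ▷ X' ≫ Y ◁ g ≫ e)) : IsEvaluation e := by
  have := (h.comp_left (asIso g).symm).comp_right (asIso f).symm
  convert! this using 1
  simp [whisker_exchange_assoc]

lemma nest {X' Y' : A} {e' : Y' ⊗ X' ⟶ 𝟙_ A} (h : IsEvaluation e) (h' : IsEvaluation e') :
    IsEvaluation (nest e e') := by
  obtain ⟨P, rfl⟩ := h
  obtain ⟨P', rfl⟩ := h'
  exact ⟨ExactPairing.tensor, ExactPairing.tensor_evaluation_eq_nest _ _ _ _⟩

/-- A pairing with the universal property of the evaluation is the evaluation of a dual pair, since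
it differs by an isomorphism from the evaluation of the chosen dual. -/
lemma of_bijective_left [HasLeftDual Y]
    (h : ∀ a : A, Function.Bijective fun f : a ⟶ X => Y ◁ f ≫ e) : IsEvaluation e := by
  have hε := isEvaluation_evaluation (HasLeftDual.leftDual Y) Y
  obtain ⟨t, ht⟩ := (hε.bijective_left X).2 e
  obtain ⟨s, hs⟩ := (h (HasLeftDual.leftDual Y)).2 (ε_ (HasLeftDual.leftDual Y) Y)
  dsimp only at ht hs
  have hts : t ≫ s = 𝟙 X := (h X).1 (by simp [hs, ht])
  have hst : s ≫ t = 𝟙 _ := hε.injective_left (by simp [hs, ht])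
  rw [← ht]
  exact hε.comp_left ⟨t, s, hts, hst⟩

lemma of_bijective_right [HasRightDual X]
    (h : ∀ a : A, Function.Bijective fun f : a ⟶ Y => f ▷ X ≫ e) : IsEvaluation e := by
  have hε := isEvaluation_evaluation X (HasRightDual.rightDual X)
  obtain ⟨t, ht⟩ := (hε.bijective_right Y).2 e
  obtain ⟨s, hs⟩ := (h (HasRightDual.rightDual X)).2 (ε_ X (HasRightDual.rightDual X))
  dsimp only at ht hs
  have hts : t ≫ s = 𝟙 Y := (h Y).1 (by simp [hs, ht])
  have hst : s ≫ t = 𝟙 _ := hε.injective_right (by simp [hs, ht])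
  rw [← ht]
  exact hε.comp_right ⟨t, s, hts, hst⟩

end IsEvaluation

end Evaluation

/-! ### Traces on inner Homs -/

namespace InnerHom

variable {A : Type u} [Category.{v} A] [MonoidalCategory A]
variable {M : Type u'} [Category.{v'} M] [MonoidalLeftAction A M]
variable (H : InnerHom A M)

open MonoidalLeftAction

lemma post_comp (m : M) {n n' n'' : M} (f : n ⟶ n') (g : n' ⟶ n'') :
    H.post m (f ≫ g) = H.post m f ≫ H.post m g :=
  (H.functor.obj (op m)).map_comp f g

lemma actPost_post_ev (m x n : M) :
    H.actPost (H.hom x n) m x ≫ H.post m (H.ev x n) = H.comp m x n :=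
  hom_ext (by simp)

/-- The unit `𝟙 ⟶ IHom(m, m)`. -/
def unit (m : M) : 𝟙_ A ⟶ H.hom m m := H.homEquiv (λₗ[A] m).hom

@[simp]
lemma unit_ev (m : M) : H.unit m ⊵ₗ m ≫ H.ev m m = (λₗ[A] m).hom := H.homEquiv_ev _

@[simp]
lemma unit_ev_assoc (m : M) {Z : M} (h : m ⟶ Z) :
    H.unit m ⊵ₗ m ≫ H.ev m m ≫ h = (λₗ m).hom ≫ h := by
  rw [reassoc_of% (H.unit_ev m)]

lemma unit_post {m x : M} (a : A) (t : a ⊙ₗ m ⟶ x) :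
    (ρ_ a).inv ≫ a ◁ H.unit m ≫ H.actPost a m m ≫ H.post m t = H.homEquiv t :=
  hom_ext (by
    simp only [comp_actionHomLeft, Category.assoc, post_ev, actPost_ev_assoc,
      whiskerLeft_actionHomLeft, rightUnitor_inv_actionHom, Iso.inv_hom_id_assoc, homEquiv_ev,
      ← actionHomRight_comp_assoc, unit_ev]
    simp)

lemma unit_comp (m n : M) : (ρ_ _).inv ≫ H.hom m n ◁ H.unit m ≫ H.comp m m n = 𝟙 _ := by
  rw [← actPost_post_ev, unit_post]
  exact H.homEquiv.apply_symm_apply _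

lemma unit_comp_assoc (m n : M) {Z : A} (h : H.hom m n ⟶ Z) :
    (ρ_ (H.hom m n)).inv ≫ H.hom m n ◁ H.unit m ≫ H.comp m m n ≫ h = h := by
  rw [reassoc_of% (H.unit_comp m n)]

lemma unit_comp_pre {m x : M} (g : m ⟶ x) (n : M) :
    (ρ_ _).inv ≫ H.hom x n ◁ (H.unit m ≫ H.post m g) ≫ H.comp m x n = H.pre g n :=
  hom_ext (by
    simp only [comp_actionHomLeft, Category.assoc, comp_ev, pre_ev,
      whiskerLeft_actionHomLeft, rightUnitor_inv_actionHom, Iso.inv_hom_id_assoc,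
      ← actionHomRight_comp_assoc, post_ev, unit_ev_assoc])

lemma pre_contract (m x n : M) :
    H.pre (H.ev m x) n ▷ H.hom m x ≫ H.contract (H.hom m x) m n = H.comp m x n :=
  hom_ext (by simp [-actionHomLeft_action, whiskerRight_actionHomLeft])

lemma whiskerRight_comp_eq_actPost {a : A} (m n : M) {x : M} (f : a ⟶ H.hom x n) :
    f ▷ H.hom m x ≫ H.comp m x n = H.actPost a m x ≫ H.post m (H.homEquiv.symm f) := by
  rw [← actPost_post_ev, actPost_left_assoc, ← Functor.map_comp, homEquiv_symm_apply]

lemma whiskerRight_comp_eq_actPost_assoc {a : A} (m n : M) {x : M} (f : a ⟶ H.hom x n)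
    {Z : A} (h : H.hom m n ⟶ Z) :
    f ▷ H.hom m x ≫ H.comp m x n ≫ h = H.actPost a m x ≫ H.post m (H.homEquiv.symm f) ≫ h := by
  rw [reassoc_of% (H.whiskerRight_comp_eq_actPost m n f)]

lemma whiskerLeft_comp_eq_actPre (X Y : A) [ExactPairing X Y] (m n : M) {x : M}
    (f : Y ⟶ H.hom m x) :
    H.hom x n ◁ f ≫ H.comp m x n =
      H.actPre X Y x n ≫ H.pre (actUnit X Y m ≫ X ⊴ₗ H.homEquiv.symm f) n :=
  hom_ext (by
    rw [homEquiv_symm_apply]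
    simp only [comp_actionHomLeft, Category.assoc, comp_ev, pre_ev, whiskerLeft_actionHomLeft,
      Iso.inv_hom_id_assoc, ← action_exchange_assoc, actPre_ev, tensor_actionHomRight]
    have h : Y ⊴ₗ (actUnit X Y m ≫ X ⊴ₗ (f ⊵ₗ m ≫ H.ev m x)) ≫ actCounit X Y x =
        f ⊵ₗ m ≫ H.ev m x := by
      rw [actionHomRight_comp, Category.assoc, actCounit_naturality, actUnit_actCounit_left_assoc]
    rw [← actionHomRight_comp_assoc, ← actionHomRight_comp_assoc, h])

lemma whiskerLeft_comp_eq_actPre_assoc (X Y : A) [ExactPairing X Y] (m n : M) {x : M}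
    (f : Y ⟶ H.hom m x) {Z : A} (h : H.hom m n ⟶ Z) :
    H.hom x n ◁ f ≫ H.comp m x n ≫ h =
      H.actPre X Y x n ≫ H.pre (actUnit X Y m ≫ X ⊴ₗ H.homEquiv.symm f) n ≫ h := by
  rw [reassoc_of% (H.whiskerLeft_comp_eq_actPre X Y m n f)]

variable {H}

/-- A morphism `τ : IHom(m, n) ⟶ 𝟙` is a perfect trace if the pairings
`IHom(x, n) ⊗ IHom(m, x) ⟶ IHom(m, n) ⟶ 𝟙` are evaluations of dual pairs. -/
def IsPerfect {m n : M} (τ : H.hom m n ⟶ 𝟙_ A) : Prop :=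
  ∀ x : M, IsEvaluation (H.comp m x n ≫ τ)

section

variable {m n : M} {τ : H.hom m n ⟶ 𝟙_ A}

lemma IsPerfect.bijective_post (hτ : IsPerfect τ) (x : M) :
    Function.Bijective fun g : x ⟶ n => H.post m g ≫ τ := by
  have : (fun g : x ⟶ n => H.post m g ≫ τ) =
      ((λ_ (H.hom m x)).homCongr (Iso.refl (𝟙_ A))) ∘
        (fun f : 𝟙_ A ⟶ H.hom x n => f ▷ H.hom m x ≫ H.comp m x n ≫ τ) ∘ H.homEquiv ∘
          ((λₗ[A] x).symm.homCongr (Iso.refl n)) := by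
    ext g
    simp only [Function.comp_apply, Iso.homCongr_apply, Iso.symm_inv, Iso.refl_hom,
      Category.comp_id]
    rw [← Category.assoc (_ ▷ _), whiskerRight_comp_eq_actPost, Equiv.symm_apply_apply,
      post_comp]
    simp only [Category.assoc, reassoc_of% (H.actPost_unit m x), Iso.inv_hom_id_assoc]
  rw [this]
  exact (Equiv.bijective _).comp (((hτ x).bijective_right _).comp
    ((Equiv.bijective _).comp (Equiv.bijective _)))

lemma IsPerfect.bijective_pre (hτ : IsPerfect τ) (x : M) :
    Function.Bijective fun g : m ⟶ x => H.pre g n ≫ τ := by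
  have : (fun g : m ⟶ x => H.pre g n ≫ τ) =
      ((ρ_ (H.hom x n)).homCongr (Iso.refl (𝟙_ A))) ∘
        (fun f : 𝟙_ A ⟶ H.hom m x => H.hom x n ◁ f ≫ H.comp m x n ≫ τ) ∘ H.homEquiv ∘
          ((λₗ[A] m).symm.homCongr (Iso.refl x)) := by
    ext g
    simp only [Function.comp_apply, Iso.homCongr_apply, Iso.symm_inv, Iso.refl_hom,
      Category.comp_id]
    rw [← unit_comp_pre]
    have : H.homEquiv ((λₗ[A] m).hom ≫ g) = H.unit m ≫ H.post m g := hom_ext (by simp)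
    rw [this]
    simp
  rw [this]
  exact (Equiv.bijective _).comp (((hτ x).bijective_left _).comp
    ((Equiv.bijective _).comp (Equiv.bijective _)))

/-- A trace is perfect if `(n, τ)` represents `x ↦ Hom(IHom(m, x), 𝟙)`. -/
lemma isPerfect_of_bijective_post [RigidCategory A]
    (h : ∀ x : M, Function.Bijective fun g : x ⟶ n => H.post m g ≫ τ) : IsPerfect τ := fun x =>
  .of_bijective_right fun a => by
    have : (fun f : a ⟶ H.hom x n => f ▷ H.hom m x ≫ H.comp m x n ≫ τ) =
        ((asIso (H.actPost a m x)).symm.homCongr (Iso.refl (𝟙_ A))) ∘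
          (fun g : a ⊙ₗ x ⟶ n => H.post m g ≫ τ) ∘ H.homEquiv.symm := by
      ext f
      simp [← whiskerRight_comp_eq_actPost_assoc]
    rw [this]
    exact (Equiv.bijective _).comp ((h _).comp (Equiv.bijective _))

/-- A trace is perfect if `(m, τ)` corepresents `x ↦ Hom(IHom(x, n), 𝟙)`. -/
lemma isPerfect_of_bijective_pre [RigidCategory A]
    (h : ∀ x : M, Function.Bijective fun g : m ⟶ x => H.pre g n ≫ τ) : IsPerfect τ := fun x =>
  .of_bijective_left fun a => by
    let X := HasLeftDual.leftDual a
    have : (fun f : a ⟶ H.hom m x => H.hom x n ◁ f ≫ H.comp m x n ≫ τ) =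
        ((asIso (H.actPre X a x n)).symm.homCongr (Iso.refl (𝟙_ A))) ∘
          (fun g : m ⟶ X ⊙ₗ x => H.pre g n ≫ τ) ∘ ((actAdjunction X a).homEquiv m x) ∘
            H.homEquiv.symm := by
      ext f
      have h := H.whiskerLeft_comp_eq_actPre_assoc X a m n f τ
      simp only [Iso.homCongr_apply, Function.comp_apply, Iso.symm_inv, asIso_hom, Iso.refl_hom,
        Category.comp_id]
      exact h
    rw [this]
    exact (Equiv.bijective _).comp ((h _).comp ((Equiv.bijective _).comp (Equiv.bijective _)))

end

end InnerHom

/-! ### Adjoint mates and nested pairings -/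

section Mates

variable {A : Type u} [Category.{v} A] [MonoidalCategory A]

/-- Adjoint mates in terms of the pairings that exhibit `X` and `X'` as left duals. -/
lemma IsEvaluation.leftAdjointMate_iff {X X' Y Y' : A} [HasLeftDual Y] [HasLeftDual Y']
    {e : Y ⊗ X ⟶ 𝟙_ A} {e' : Y' ⊗ X' ⟶ 𝟙_ A} (he : IsEvaluation e)
    {s : HasLeftDual.leftDual Y ⟶ X} {s' : HasLeftDual.leftDual Y' ≅ X'}
    (hs : Y ◁ s ≫ e = ε_ _ Y) (hs' : Y' ◁ s'.hom ≫ e' = ε_ _ Y') (f : Y ⟶ Y') (h : X' ⟶ X) :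
    s'.hom ≫ h = leftAdjointMate f ≫ s ↔ Y ◁ h ≫ e = f ▷ X' ≫ e' := by
  have h2 : Y ◁ (leftAdjointMate f ≫ s) ≫ e = Y ◁ s'.hom ≫ f ▷ X' ≫ e' := by
    rw [MonoidalCategory.whiskerLeft_comp, Category.assoc, hs, leftAdjointMate_comp_evaluation,
      whisker_exchange_assoc, hs']
  constructor
  · intro h1
    rw [← cancel_epi (Y ◁ s'.hom), ← h2, ← h1, MonoidalCategory.whiskerLeft_comp, Category.assoc]
  · intro h1
    refine he.injective_left ?_
    rw [h2, ← h1, MonoidalCategory.whiskerLeft_comp, Category.assoc]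

/-- Adjoint mates in terms of the pairings that exhibit `Y` and `Y'` as right duals. -/
lemma IsEvaluation.rightAdjointMate_iff {X X' Y Y' : A} [HasRightDual X] [HasRightDual X']
    {e : Y ⊗ X ⟶ 𝟙_ A} {e' : Y' ⊗ X' ⟶ 𝟙_ A} (he : IsEvaluation e)
    {s : HasRightDual.rightDual X ⟶ Y} {s' : HasRightDual.rightDual X' ≅ Y'}
    (hs : s ▷ X ≫ e = ε_ X _) (hs' : s'.hom ▷ X' ≫ e' = ε_ X' _) (f : X ⟶ X') (h : Y' ⟶ Y) :
    s'.hom ≫ h = rightAdjointMate f ≫ s ↔ h ▷ X ≫ e = Y' ◁ f ≫ e' := by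
  have h2 : (rightAdjointMate f ≫ s) ▷ X ≫ e = s'.hom ▷ X ≫ Y' ◁ f ≫ e' := by
    rw [comp_whiskerRight, Category.assoc, hs, rightAdjointMate_comp_evaluation,
      ← whisker_exchange_assoc, hs']
  constructor
  · intro h1
    rw [← cancel_epi (s'.hom ▷ X), ← h2, ← h1, comp_whiskerRight, Category.assoc]
  · intro h1
    refine he.injective_right ?_
    rw [h2, ← h1, comp_whiskerRight, Category.assoc]

lemma nest_whiskerLeft_whiskerLeft {X₁ X₂ X₃ Y₁ Y₂ : A} (e₁ : Y₁ ⊗ X₁ ⟶ 𝟙_ A)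
    (e₂ : Y₂ ⊗ X₂ ⟶ 𝟙_ A) (f : X₃ ⟶ X₂) :
    (Y₂ ⊗ Y₁) ◁ X₁ ◁ f ≫ nest e₁ e₂ = nest e₁ (Y₂ ◁ f ≫ e₂) := by
  rw [nest, nest, associator_inv_naturality_right_assoc, whisker_exchange_assoc]

lemma nest_whiskerLeft_whiskerRight {X₁ X₂ X₃ Y₁ Y₂ : A} (e₁ : Y₁ ⊗ X₁ ⟶ 𝟙_ A)
    (e₂ : Y₂ ⊗ X₂ ⟶ 𝟙_ A) (f : X₃ ⟶ X₁) :
    (Y₂ ⊗ Y₁) ◁ f ▷ X₂ ≫ nest e₁ e₂ = nest (Y₁ ◁ f ≫ e₁) e₂ := by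
  simp [nest]

lemma nest_whiskerRight_whiskerRight {X₁ X₂ Y₁ Y₂ Y₃ : A} (e₁ : Y₁ ⊗ X₁ ⟶ 𝟙_ A)
    (e₂ : Y₂ ⊗ X₂ ⟶ 𝟙_ A) (f : Y₃ ⟶ Y₂) :
    f ▷ Y₁ ▷ (X₁ ⊗ X₂) ≫ nest e₁ e₂ = nest e₁ (f ▷ X₂ ≫ e₂) := by
  rw [nest, nest, associator_inv_naturality_left_assoc, ← comp_whiskerRight_assoc,
    associator_naturality_left_assoc, ← whisker_exchange_assoc, rightUnitor_naturality]
  simp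

lemma nest_whiskerRight_whiskerLeft {X₁ X₂ Y₁ Y₂ Y₃ : A} (e₁ : Y₁ ⊗ X₁ ⟶ 𝟙_ A)
    (e₂ : Y₂ ⊗ X₂ ⟶ 𝟙_ A) (f : Y₃ ⟶ Y₁) :
    (Y₂ ◁ f) ▷ (X₁ ⊗ X₂) ≫ nest e₁ e₂ = nest (f ▷ X₁ ≫ e₁) e₂ := by
  simp [nest]

end Mates

namespace InnerHom

variable {A : Type u} [Category.{v} A] [MonoidalCategory A] [RigidCategory A]
variable {M : Type u'} [Category.{v'} M] [MonoidalLeftAction A M]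
variable {H : InnerHom A M}

open MonoidalLeftAction

/-! ### Partial traces -/

section Trace

variable {m n : M} (τ : H.hom m n ⟶ 𝟙_ A)

/-- The partial trace `IHom(m, x) ⟶ IHom(m, a.n) ≅ a ⊗ IHom(m, n) ⟶ a` of a morphism
`x ⟶ a.n` with respect to `τ : IHom(m, n) ⟶ 𝟙`. -/
def trace {x : M} {a : A} (g : x ⟶ a ⊙ₗ n) : H.hom m x ⟶ a :=
  H.post m g ≫ inv (H.actPost a m n) ≫ a ◁ τ ≫ (ρ_ a).hom

lemma trace_comp {x y : M} {a : A} (f : x ⟶ y) (g : y ⟶ a ⊙ₗ n) :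
    trace τ (f ≫ g) = H.post m f ≫ trace τ g := by
  simp [trace]

lemma trace_actionHomLeft {x : M} {a b : A} (g : x ⟶ a ⊙ₗ n) (f : a ⟶ b) :
    trace τ (g ≫ f ⊵ₗ n) = trace τ g ≫ f := by
  have h : H.post m (f ⊵ₗ n) ≫ inv (H.actPost b m n) = inv (H.actPost a m n) ≫ f ▷ _ := by
    rw [IsIso.comp_inv_eq, Category.assoc, actPost_left, IsIso.inv_hom_id_assoc]
  simp [trace, reassoc_of% h, ← whisker_exchange_assoc]

lemma trace_actionHomRight_assoc_inv {x : M} {a b : A} (g : x ⟶ a ⊙ₗ b ⊙ₗ n) :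
    trace τ (g ≫ (αₗ a b n).inv) = H.post m g ≫ inv (H.actPost a m (b ⊙ₗ n)) ≫
      a ◁ trace τ (𝟙 (b ⊙ₗ n)) := by
  have h : H.post m (αₗ a b n).inv ≫ inv (H.actPost (a ⊗ b) m n) =
      inv (H.actPost a m (b ⊙ₗ n)) ≫ a ◁ inv (H.actPost b m n) ≫ (α_ _ _ _).inv := by
    rw [IsIso.comp_inv_eq, ← cancel_mono (H.post m (αₗ a b n).hom), ← post_comp]
    simp only [Category.assoc, actPost_tensor, Iso.inv_hom_id_assoc, Iso.inv_hom_id]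
    simp [← MonoidalCategory.whiskerLeft_comp_assoc]
  simp [trace, reassoc_of% h]

lemma post_actUnit_inv_actPost (X Y : A) [ExactPairing X Y] (m : M) {z w : M} (g : Y ⊙ₗ z ⟶ w) :
    H.post m (actUnit X Y z ≫ X ⊴ₗ g) ≫ inv (H.actPost X m w) =
      (actUnit X Y (H.hom m z) : _ ⟶ X ⊗ Y ⊗ _) ≫ X ◁ (H.actPost Y m z ≫ H.post m g) := by
  rw [IsIso.comp_inv_eq, post_comp, ← actUnit_actPost]
  simp [actPost_post]

lemma post_actUnit_inv_actPost_assoc (X Y : A) [ExactPairing X Y] (m : M) {z w : M} (g : Y ⊙ₗ z ⟶ w)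
    {Z : A} (h : X ⊗ H.hom m w ⟶ Z) :
    H.post m (actUnit X Y z ≫ X ⊴ₗ g) ≫ inv (H.actPost X m w) ≫ h =
      actUnit X Y (H.hom m z) ≫ X ◁ (H.actPost Y m z ≫ H.post m g) ≫ h := by
  rw [reassoc_of% (post_actUnit_inv_actPost X Y m g)]

/-- A perfect trace on `IHom(m, n)` identifies `Hom(x, a.n)` with `Hom(IHom(m, x), a)`: by duality,
the case of general `a` reduces to `a = 𝟙` with `x` replaced by `a^∨.x`. -/
lemma IsPerfect.bijective_trace {τ : H.hom m n ⟶ 𝟙_ A} (hτ : IsPerfect τ) (x : M) (a : A) :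
    Function.Bijective fun g : x ⟶ a ⊙ₗ n => trace τ g := by
  let Y := HasRightDual.rightDual a
  let E : (H.hom m (Y ⊙ₗ x) ⟶ 𝟙_ A) ≃ (H.hom m x ⟶ a) :=
    ((asIso (H.actPost Y m x)).symm.homCongr (Iso.refl (𝟙_ A))).trans
      ((tensorLeftHomEquiv (H.hom m x) a Y (𝟙_ A)).trans
        ((Iso.refl (H.hom m x)).homCongr (ρ_ a)))
  have hE (t : H.hom m (Y ⊙ₗ x) ⟶ 𝟙_ A) : E t =
      (actUnit a Y (H.hom m x) : _ ⟶ a ⊗ Y ⊗ _) ≫ a ◁ (H.actPost Y m x ≫ t) ≫ (ρ_ a).hom := by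
    simp [E, tensorLeftHomEquiv, actUnit]
  have h1 (g : Y ⊙ₗ x ⟶ n) :
      trace τ (actUnit a Y x ≫ a ⊴ₗ g) = E (H.post m g ≫ τ) := by
    refine (post_actUnit_inv_actPost_assoc (H := H) a Y m g (a ◁ τ ≫ (ρ_ a).hom)).trans ?_
    rw [hE]
    simp
  have h2 : Function.Bijective fun g : Y ⊙ₗ x ⟶ n => actUnit a Y x ≫ a ⊴ₗ g :=
    ((actAdjunction a Y).homEquiv x n).bijective
  refine (Function.Bijective.of_comp_iff _ h2).1 ?_
  convert E.bijective.comp (hτ.bijective_post (Y ⊙ₗ x)) using 1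
  exact funext h1

/-- For a chain of duals `X`, `Y`, `Z`: the trace on `IHom(X.m, Z.n) ≅ Z ⊗ IHom(m, n) ⊗ Y`
induced by a trace on `IHom(m, n)`. -/
def twist (X Y Z : A) [ExactPairing X Y] [ExactPairing Y Z] :
    H.hom (X ⊙ₗ m) (Z ⊙ₗ n) ⟶ 𝟙_ A :=
  inv (H.actPre X Y m (Z ⊙ₗ n)) ≫ trace τ (𝟙 (Z ⊙ₗ n)) ▷ Y ≫ ε_ Y Z

/-- Under `IHom(x, Z.n) ≅ Z ⊗ IHom(x, n)` and `IHom(X.m, x) ≅ IHom(m, x) ⊗ Y`, the pairing of a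
twisted trace is nested from the pairing of `τ` and the evaluation of `Y` and `Z`. -/
lemma actPost_actPre_comp_twist (X Y Z : A) [ExactPairing X Y] [ExactPairing Y Z] (x : M) :
    H.actPost Z x n ▷ (H.hom m x ⊗ Y) ≫ H.hom x (Z ⊙ₗ n) ◁ H.actPre X Y m x ≫
      H.comp (X ⊙ₗ m) x (Z ⊙ₗ n) ≫ twist τ X Y Z = nest (H.comp m x n ≫ τ) (ε_ Y Z) := by
  have h := H.actPost_comp Z m x n
  have h1 : H.actPost Z m n ≫ trace τ (𝟙 (Z ⊙ₗ n)) = Z ◁ τ ≫ (ρ_ Z).hom := by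
    simp [trace]
  have h2 : H.hom x (Z ⊙ₗ n) ◁ H.actPre X Y m x ≫ H.comp (X ⊙ₗ m) x (Z ⊙ₗ n) =
      (α_ _ _ _).inv ≫ H.comp m x (Z ⊙ₗ n) ▷ Y ≫ H.actPre X Y m (Z ⊙ₗ n) := by
    rw [← actPre_comp, Iso.inv_hom_id_assoc]
  have h3 : H.actPost Z x n ▷ H.hom m x ≫ H.comp m x (Z ⊙ₗ n) ≫ trace τ (𝟙 (Z ⊙ₗ n)) =
      (α_ _ _ _).hom ≫ Z ◁ (H.comp m x n ≫ τ) ≫ (ρ_ Z).hom := by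
    rw [← reassoc_of% h, h1]
    simp
  rw [reassoc_of% h2, twist, IsIso.hom_inv_id_assoc, associator_inv_naturality_left_assoc, nest,
    ← h3]
  simp

lemma IsPerfect.twist {τ : H.hom m n ⟶ 𝟙_ A} (hτ : IsPerfect τ) (X Y Z : A) [ExactPairing X Y]
    [ExactPairing Y Z] : IsPerfect (twist τ X Y Z) := fun x => by
  have h := (hτ x).nest (isEvaluation_evaluation Y Z)
  rw [← actPost_actPre_comp_twist τ X Y Z x] at h
  exact h.of_comp _ _

lemma actPre_trace_twist (X Y Z : A) [ExactPairing X Y] [ExactPairing Y Z] {z : M} {b : A}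
    (g : z ⟶ b ⊙ₗ Z ⊙ₗ n) :
    H.actPre X Y m z ≫ trace (twist τ X Y Z) g =
      trace τ (g ≫ (αₗ b Z n).inv) ▷ Y ≫ tensorCounit Y Z b := by
  have h : H.actPre X Y m (b ⊙ₗ Z ⊙ₗ n) ≫ inv (H.actPost b (X ⊙ₗ m) (Z ⊙ₗ n)) =
      inv (H.actPost b m (Z ⊙ₗ n)) ▷ Y ≫ (α_ _ _ _).hom ≫ b ◁ H.actPre X Y m (Z ⊙ₗ n) := by
    rw [IsIso.comp_inv_eq, ← cancel_epi (H.actPost b m (Z ⊙ₗ n) ▷ Y), actPost_actPre]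
    simp [← comp_whiskerRight_assoc]
  rw [trace_actionHomRight_assoc_inv, trace, ← actPre_post_assoc, reassoc_of% h, twist,
    tensorCounit]
  simp

end Trace

/-- A family of pairings `IHom(x, n) ⊗ IHom(m, x) ⟶ 𝟙` that is natural and compatible with the
action of `A` on `x`. -/
structure IsBalanced {m n : M} (β : ∀ x : M, H.hom x n ⊗ H.hom m x ⟶ 𝟙_ A) : Prop where
  dinatural {x x' : M} (f : x ⟶ x') :
    H.pre f n ▷ H.hom m x ≫ β x = H.hom x' n ◁ H.post m f ≫ β x'
  balanced (a : A) (z : M) :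
    H.actPre a (HasRightDual.rightDual a) z n ▷ (a ⊗ H.hom m z) ≫
      H.hom (a ⊙ₗ z) n ◁ H.actPost a m z ≫ β (a ⊙ₗ z) = nest (ε_ a _) (β z)

lemma isBalanced_comp {m n : M} (τ : H.hom m n ⟶ 𝟙_ A) :
    IsBalanced fun x => H.comp m x n ≫ τ where
  dinatural f := by rw [comp_dinatural_assoc]
  balanced a z := by
    rw [actPre_actPost_comp_assoc]
    rfl

/-- A balanced family of pairings is induced by a trace: by naturality and balancing it is
determined by its value on the unit of `IHom(m, m)`. -/
lemma IsBalanced.eq_comp {m n : M} {β : ∀ x : M, H.hom x n ⊗ H.hom m x ⟶ 𝟙_ A}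
    (hβ : IsBalanced β) (x : M) :
    β x = H.comp m x n ≫ (ρ_ _).inv ≫ H.hom m n ◁ H.unit m ≫ β m := by
  let b := H.hom m x
  let Y := HasRightDual.rightDual b
  -- the idea is to insert the identity of `b = IHom(m, x)`, written as the composite `h1` through
  -- `IHom(m, b.m)`, and to move it through `β` by naturality along `b.m ⟶ x` and by balancing
  have h1 : (ρ_ b).inv ≫ b ◁ H.unit m ≫ H.actPost b m m ≫ H.post m (H.ev m x) = 𝟙 _ := by
    rw [unit_post]
    exact H.homEquiv.apply_symm_apply _
  have h2 : (H.pre (H.ev m x) n ≫ inv (H.actPre b Y m n)) ▷ b ≫ tensorCounit b Y (H.hom m n) =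
      H.comp m x n := by
    rw [← actPre_contract, ← comp_whiskerRight_assoc]
    simp [← pre_contract, b]
  have h3 := hβ.dinatural (H.ev m x)
  have h4 := hβ.balanced b m
  calc
    β x = H.hom x n ◁ ((ρ_ b).inv ≫ b ◁ H.unit m ≫ H.actPost b m m ≫ H.post m (H.ev m x)) ≫
        β x := by
      rw [h1, MonoidalCategory.whiskerLeft_id, Category.id_comp]
    _ = H.hom x n ◁ ((ρ_ b).inv ≫ b ◁ H.unit m ≫ H.actPost b m m) ≫
        H.pre (H.ev m x) n ▷ _ ≫ β (b ⊙ₗ m) := by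
      rw [h3]
      simp
    _ = (H.pre (H.ev m x) n ≫ inv (H.actPre b Y m n)) ▷ b ≫ _ ◁ ((ρ_ b).inv ≫ b ◁ H.unit m) ≫
        H.actPre b Y m n ▷ (b ⊗ H.hom m m) ≫ H.hom (b ⊙ₗ m) n ◁ H.actPost b m m ≫
          β (b ⊙ₗ m) := by
      rw [← whisker_exchange_assoc, ← comp_whiskerRight_assoc]
      simp [whisker_exchange_assoc, b]
    _ = (H.pre (H.ev m x) n ≫ inv (H.actPre b Y m n)) ▷ b ≫ _ ◁ (ρ_ b).inv ≫
        nest (ε_ b Y) (H.hom m n ◁ H.unit m ≫ β m) := by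
      rw [h4, ← nest_whiskerLeft_whiskerLeft]
      simp [Y]
    _ = ((H.pre (H.ev m x) n ≫ inv (H.actPre b Y m n)) ▷ b ≫ tensorCounit b Y (H.hom m n)) ≫
        (ρ_ _).inv ≫ H.hom m n ◁ H.unit m ≫ β m := by
      simp [nest, tensorCounit]
    _ = _ := by rw [h2]

end InnerHom

/-! ### Relative Serre functors and perfect traces -/

section NatIso

variable {C : Type u} [Category.{v} C] {D : Type u'} [Category.{v'} D] {F G : C ⥤ D}

/-- The Yoneda lemma for functors that are pointwise defined by corepresenting objects. -/
lemma nonempty_iso_of_equiv_from (e : ∀ x y, (F.obj x ⟶ y) ≃ (G.obj x ⟶ y))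
    (h₁ : ∀ {x y y'} (f : F.obj x ⟶ y) (g : y ⟶ y'), e x y' (f ≫ g) = e x y f ≫ g)
    (h₂ : ∀ {x x' y} (u : x ⟶ x') (f : F.obj x' ⟶ y),
      e x y (F.map u ≫ f) = G.map u ≫ e x' y f) : Nonempty (F ≅ G) := by
  have h₃ {x y y'} (f : G.obj x ⟶ y) (g : y ⟶ y') :
      (e x y').symm (f ≫ g) = (e x y).symm f ≫ g := by
    rw [Equiv.symm_apply_eq, h₁, Equiv.apply_symm_apply]
  refine ⟨(NatIso.ofComponents
    (fun x => ⟨e x _ (𝟙 _), (e x _).symm (𝟙 _), ?_, ?_⟩) fun {x x'} u => ?_ : G ≅ F).symm⟩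
  · rw [← h₁, Category.id_comp, Equiv.apply_symm_apply]
  · rw [← h₃, Category.id_comp, Equiv.symm_apply_apply]
  · change G.map u ≫ e x' _ (𝟙 _) = e x _ (𝟙 _) ≫ F.map u
    rw [← h₁, ← h₂, Category.id_comp, Category.comp_id]

/-- The Yoneda lemma for functors that are pointwise defined by representing objects. -/
lemma nonempty_iso_of_equiv_to (e : ∀ x y, (y ⟶ F.obj x) ≃ (y ⟶ G.obj x))
    (h₁ : ∀ {x y y'} (g : y' ⟶ y) (f : y ⟶ F.obj x), e x y' (g ≫ f) = g ≫ e x y f)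
    (h₂ : ∀ {x x' y} (u : x ⟶ x') (f : y ⟶ F.obj x),
      e x' y (f ≫ F.map u) = e x y f ≫ G.map u) : Nonempty (F ≅ G) := by
  have h₃ {x y y'} (g : y' ⟶ y) (f : y ⟶ G.obj x) :
      (e x y').symm (g ≫ f) = g ≫ (e x y).symm f := by
    rw [Equiv.symm_apply_eq, h₁, Equiv.apply_symm_apply]
  refine ⟨NatIso.ofComponents
    (fun x => ⟨e x _ (𝟙 _), (e x _).symm (𝟙 _), ?_, ?_⟩) fun {x x'} u => ?_⟩
  · rw [← h₃, Category.comp_id, Equiv.symm_apply_apply]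
  · rw [← h₁, Category.comp_id, Equiv.apply_symm_apply]
  · change F.map u ≫ e x' _ (𝟙 _) = e x _ (𝟙 _) ≫ G.map u
    rw [← h₁, ← h₂, Category.id_comp, Category.comp_id]

end NatIso

section Iso

variable {A : Type u} [Category.{v} A] [MonoidalCategory A]
variable {M : Type u'} [Category.{v'} M] [MonoidalLeftAction A M]
variable {H : InnerHom A M}

namespace InnerHom

open MonoidalLeftAction

/-- The bijection `Hom(x, y) ≃ Hom(𝟙, IHom(x, y))`. -/
def unitEquiv {x y : M} : (x ⟶ y) ≃ (𝟙_ A ⟶ H.hom x y) :=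
  ((λₗ[A] x).symm.homCongr (Iso.refl y)).trans H.homEquiv

lemma unitEquiv_comp {x y z : M} (f : x ⟶ y) (g : y ⟶ z) :
    H.unitEquiv (f ≫ g) = H.unitEquiv f ≫ H.post x g :=
  hom_ext (by simp [unitEquiv])

lemma unitEquiv_comp' {x y z : M} (f : x ⟶ y) (g : y ⟶ z) :
    H.unitEquiv (f ≫ g) = H.unitEquiv g ≫ H.pre f z :=
  hom_ext (by simp [unitEquiv, ← action_exchange_assoc])

/-- For a fixed target, a perfect trace determines its source up to isomorphism. -/
lemma IsPerfect.exists_iso_of_pre {m m' n : M} {τ : H.hom m n ⟶ 𝟙_ A} {τ' : H.hom m' n ⟶ 𝟙_ A}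
    (hτ : IsPerfect τ) (hτ' : IsPerfect τ') : ∃ i : m ≅ m', H.pre i.hom n ≫ τ = τ' := by
  obtain ⟨f, hf⟩ := (hτ.bijective_pre m').2 τ'
  obtain ⟨g, hg⟩ := (hτ'.bijective_pre m).2 τ
  dsimp only at hf hg
  refine ⟨⟨f, g, (hτ.bijective_pre _).1 ?_, (hτ'.bijective_pre _).1 ?_⟩, hf⟩
  · simp only [pre_comp, Category.assoc, hf, hg, pre_id, Category.id_comp]
  · simp only [pre_comp, Category.assoc, hf, hg, pre_id, Category.id_comp]

/-- For a fixed source, a perfect trace determines its target up to isomorphism. -/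
lemma IsPerfect.exists_iso_of_post {m n n' : M} {τ : H.hom m n ⟶ 𝟙_ A} {τ' : H.hom m n' ⟶ 𝟙_ A}
    (hτ : IsPerfect τ) (hτ' : IsPerfect τ') : ∃ i : n' ≅ n, H.post m i.hom ≫ τ = τ' := by
  obtain ⟨f, hf⟩ := (hτ.bijective_post n').2 τ'
  obtain ⟨g, hg⟩ := (hτ'.bijective_post n).2 τ
  dsimp only at hf hg
  refine ⟨⟨f, g, (hτ'.bijective_post _).1 ?_, (hτ.bijective_post _).1 ?_⟩, hf⟩
  · simp [hf, hg]
  · simp [hf, hg]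

end InnerHom

end Iso

section RelativeSerre

variable {A : Type u} [Category.{v} A] [MonoidalCategory A] [RigidCategory A]
variable {M : Type u'} [Category.{v'} M] [MonoidalLeftAction A M]
variable {H : InnerHom A M}

open MonoidalLeftAction InnerHom

lemma leftDualTensorIso_hom_nest (a b : A) :
    (a ⊗ b) ◁ (leftDualTensorIso a b).hom ≫ nest (ε_ (HasLeftDual.leftDual b) b)
      (ε_ (HasLeftDual.leftDual a) a) = ε_ (HasLeftDual.leftDual (a ⊗ b)) (a ⊗ b) := by
  rw [← ExactPairing.tensor_evaluation_eq_nest]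
  exact leftDualIso_hom_evaluation _ _

lemma rightDualTensorIso_hom_nest (a b : A) :
    (rightDualTensorIso a b).hom ▷ (a ⊗ b) ≫ nest (ε_ a (HasRightDual.rightDual a))
      (ε_ b (HasRightDual.rightDual b)) = ε_ (a ⊗ b) (HasRightDual.rightDual (a ⊗ b)) := by
  rw [← ExactPairing.tensor_evaluation_eq_nest]
  exact rightDualIso_hom_evaluation _ _

namespace LeftRelativeSerre

/-- The morphisms `τ n : IHom(S n, n) ⟶ 𝟙` induce the left relative Serre functor `S`: they are
natural perfect traces, and the isomorphisms `^∨IHom(m, n) ≅ IHom(S n, m)` correspond to the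
pairings `IHom(m, n) ⊗ IHom(S n, m) ⟶ IHom(S n, n) ⟶ 𝟙`. -/
structure IsTrace (S : LeftRelativeSerre H) (τ : ∀ n, H.hom (S.functor.obj n) n ⟶ 𝟙_ A) :
    Prop where
  perfect (n : M) : IsPerfect (τ n)
  naturality {n n' : M} (g : n ⟶ n') :
    H.pre (S.functor.map g) n ≫ τ n = H.post (S.functor.obj n') g ≫ τ n'
  iso_comp (m n : M) :
    H.hom m n ◁ (S.iso m n).hom ≫ H.comp (S.functor.obj n) m n ≫ τ n = ε_ _ (H.hom m n)

/-- In terms of the pairings `β` that correspond to the isomorphisms of a relative Serre functor,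
module naturality means that the pairings are balanced. -/
lemma isModuleNatural_iff (S : LeftRelativeSerre H)
    {β : ∀ n z : M, H.hom z n ⊗ H.hom (S.functor.obj n) z ⟶ 𝟙_ A}
    (hβ : ∀ n z : M, H.hom z n ◁ (S.iso z n).hom ≫ β n z = ε_ _ (H.hom z n)) :
    S.IsModuleNatural ↔ ∀ (n : M) (a : A) (z : M),
      H.actPre a (HasRightDual.rightDual a) z n ▷ (a ⊗ H.hom (S.functor.obj n) z) ≫
        H.hom (a ⊙ₗ z) n ◁ H.actPost a (S.functor.obj n) z ≫ β n (a ⊙ₗ z) =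
          nest (ε_ a _) (β n z) := by
  have hβ' (n z : M) : IsEvaluation (β n z) := by
    have := (isEvaluation_evaluation _ (H.hom z n)).comp_left (S.iso z n).symm
    rw [← hβ, Iso.symm_hom, ← MonoidalCategory.whiskerLeft_comp_assoc, Iso.inv_hom_id,
      MonoidalCategory.whiskerLeft_id, Category.id_comp] at this
    exact this
  have key (n : M) (a : A) (z : M) :
      (S.iso (a ⊙ₗ z) n).hom =
        leftAdjointMate (H.actPre a (HasRightDual.rightDual a) z n) ≫
          (leftDualIso (HasLeftDual.exact (Y := H.hom z n ⊗ HasRightDual.rightDual a))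
            (ExactPairing.tensor (X₁ := a) (X₂ := HasLeftDual.leftDual (H.hom z n)))).hom ≫
          a ◁ (S.iso z n).hom ≫ H.actPost a (S.functor.obj n) z ↔
      H.actPre a (HasRightDual.rightDual a) z n ▷ (a ⊗ H.hom (S.functor.obj n) z) ≫
        H.hom (a ⊙ₗ z) n ◁ H.actPost a (S.functor.obj n) z ≫ β n (a ⊙ₗ z) =
          nest (ε_ a _) (β n z) := by
    let s := (leftDualIso (HasLeftDual.exact (Y := H.hom z n ⊗ HasRightDual.rightDual a))
      (ExactPairing.tensor (X₁ := a) (X₂ := HasLeftDual.leftDual (H.hom z n)))).hom ≫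
        a ◁ (S.iso z n).hom
    have hs : _ ◁ s ≫ nest (ε_ a (HasRightDual.rightDual a)) (β n z) = ε_ _ _ := by
      rw [MonoidalCategory.whiskerLeft_comp, Category.assoc, nest_whiskerLeft_whiskerLeft, hβ,
        ← ExactPairing.tensor_evaluation_eq_nest]
      exact leftDualIso_hom_evaluation _ _
    have h := ((isEvaluation_evaluation a (HasRightDual.rightDual a)).nest
      (hβ' n z)).leftAdjointMate_iff hs (hβ n (a ⊙ₗ z))
      (H.actPre a (HasRightDual.rightDual a) z n) (inv (H.actPost a (S.functor.obj n) z))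
    rw [IsIso.comp_inv_eq] at h
    simp only [s, Category.assoc] at h
    rw [h, ← cancel_epi (_ ◁ H.actPost a (S.functor.obj n) z),
      ← MonoidalCategory.whiskerLeft_comp_assoc, IsIso.hom_inv_id,
      MonoidalCategory.whiskerLeft_id, Category.id_comp, whisker_exchange_assoc, eq_comm]
  exact ⟨fun h n a z => (key n a z).1 (h a z n), fun h a z n => (key n a z).2 (h n a z)⟩

lemma IsTrace.isModuleNatural {S : LeftRelativeSerre H}
    {τ : ∀ n, H.hom (S.functor.obj n) n ⟶ 𝟙_ A} (hτ : S.IsTrace τ) : S.IsModuleNatural :=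
  (S.isModuleNatural_iff fun n z => hτ.iso_comp z n).2 fun n => (isBalanced_comp (τ n)).balanced

/-- The isomorphisms of a module natural relative Serre functor come from traces: the corresponding
pairings are natural and balanced. -/
lemma exists_isTrace (S : LeftRelativeSerre H) (hS : S.IsModuleNatural) :
    ∃ τ, S.IsTrace τ := by
  let β (n z : M) : H.hom z n ⊗ H.hom (S.functor.obj n) z ⟶ 𝟙_ A :=
    H.hom z n ◁ (S.iso z n).inv ≫ ε_ _ (H.hom z n)
  have hβ (n z : M) : H.hom z n ◁ (S.iso z n).hom ≫ β n z = ε_ _ (H.hom z n) := by simp [β]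
  have hβ' (n z : M) : IsEvaluation (β n z) :=
    (isEvaluation_evaluation _ (H.hom z n)).comp_left (S.iso z n).symm
  have hb (n : M) : IsBalanced (β n) :=
    { dinatural := fun f => (((hβ' n _).leftAdjointMate_iff (hβ n _) (hβ n _) _ _).1
        (S.naturality_fst f n)).symm
      balanced := (S.isModuleNatural_iff hβ).1 hS n }
  let τ (n : M) : H.hom (S.functor.obj n) n ⟶ 𝟙_ A :=
    (ρ_ _).inv ≫ H.hom _ n ◁ H.unit _ ≫ β n (S.functor.obj n)
  have hτ (n z : M) : β n z = H.comp (S.functor.obj n) z n ≫ τ n := (hb n).eq_comp z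
  refine ⟨τ, fun n z => hτ n z ▸ hβ' n z, fun {n n'} g => ?_, fun m n => hτ n m ▸ hβ n m⟩
  have h := ((hβ' n (S.functor.obj n')).leftAdjointMate_iff (hβ n _) (hβ n' _) _ _).1
    (S.naturality_snd (S.functor.obj n') g)
  rw [hτ, hτ, comp_pre_assoc, comp_post_assoc] at h
  simpa only [unit_comp_assoc] using
    congr_arg (fun t => (ρ_ _).inv ≫ H.hom (S.functor.obj n') n ◁ H.unit (S.functor.obj n') ≫ t) h

/-- A choice of perfect traces on all `IHom(S n, n)` makes `S` a relative Serre functor. -/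
lemma exists_of_isPerfect (S : M → M) (τ : ∀ n, H.hom (S n) n ⟶ 𝟙_ A)
    (hτ : ∀ n, IsPerfect (τ n)) : ∃ S : LeftRelativeSerre H, S.IsModuleNatural := by
  choose F hF using fun (n n' : M) (g : n ⟶ n') =>
    ((hτ n).bijective_pre (S n')).2 (H.post (S n') g ≫ τ n')
  choose i hi using fun m n : M => (hτ n m).exists_leftDual_iso
  dsimp only at hF
  let S' : LeftRelativeSerre H :=
    { functor :=
        { obj := S
          map := fun g => F _ _ g
          map_id := fun n => ((hτ n).bijective_pre _).1 (by simp [hF])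
          map_comp := fun f g => ((hτ _).bijective_pre _).1 (by
            simp only [pre_comp, Category.assoc, hF]
            rw [pre_post_assoc, hF, post_comp, Category.assoc]) }
      iso := i
      naturality_fst := fun f n => ((hτ n _).leftAdjointMate_iff (hi _ n) (hi _ n) _ _).2
        (H.comp_dinatural_assoc _ _ f _).symm
      naturality_snd := fun m n n' g => ((hτ n _).leftAdjointMate_iff (hi _ n) (hi _ n') _ _).2 (by
        rw [comp_pre_assoc, comp_post_assoc, hF]) }
  exact ⟨S', IsTrace.isModuleNatural (τ := τ) ⟨hτ, hF _ _, hi⟩⟩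

/-- For the structure isomorphisms of a relative Serre functor induced by traces, the traces of
`S(a.m)` and of `S(m)` correspond to each other. -/
lemma IsTrace.exists_moduleStr {S : LeftRelativeSerre H}
    {τ : ∀ n, H.hom (S.functor.obj n) n ⟶ 𝟙_ A} (hτ : S.IsTrace τ) :
    ∃ σ : S.ModuleStr, ∀ (a : A) (m : M), H.pre (σ.iso a m).hom (a ⊙ₗ m) ≫
      twist (τ m) (ll a) (HasLeftDual.leftDual a) a = τ (a ⊙ₗ m) := by
  choose i hi using fun (a : A) (m : M) =>
    ((hτ.perfect m).twist (ll a) (HasLeftDual.leftDual a) a).exists_iso_of_pre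
      (hτ.perfect (a ⊙ₗ m))
  refine ⟨⟨i, fun a m n => ?_⟩, hi⟩
  let s := (leftDualTensorIso a (H.hom n m)).hom ≫ (S.iso n m).hom ▷ HasLeftDual.leftDual a
  have hs : _ ◁ s ≫ nest (H.comp (S.functor.obj m) n m ≫ τ m)
      (ε_ (HasLeftDual.leftDual a) a) = ε_ _ _ := by
    rw [MonoidalCategory.whiskerLeft_comp, Category.assoc, nest_whiskerLeft_whiskerRight,
      hτ.iso_comp, leftDualTensorIso_hom_nest]
  have h := (((hτ.perfect m n).nest
    (isEvaluation_evaluation (HasLeftDual.leftDual a) a)).leftAdjointMate_iff hs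
      (hτ.iso_comp n (a ⊙ₗ m)) (H.actPost a n m)
      (H.pre (i a m).hom n ≫ inv (H.actPre (ll a) (HasLeftDual.leftDual a) (S.functor.obj m) n))).2
  rw [← Category.assoc (S.iso n (a ⊙ₗ m)).hom, IsIso.comp_inv_eq] at h
  simp only [s, Category.assoc] at h
  refine h ?_
  rw [← actPost_actPre_comp_twist (τ m) (ll a), whisker_exchange_assoc,
    ← MonoidalCategory.whiskerLeft_comp_assoc]
  simp only [Category.assoc, IsIso.inv_hom_id, Category.comp_id]
  rw [comp_pre_assoc, hi]

/-- Relative Serre functors are unique up to isomorphism, module natural or not: apply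
`Hom(𝟙, -)` to `IHom(S n, m) ≅ ^∨IHom(m, n) ≅ IHom(S' n, m)`. -/
lemma nonempty_iso (S S' : LeftRelativeSerre H) : Nonempty (S.functor ≅ S'.functor) := by
  let i (m n : M) : H.hom (S.functor.obj n) m ≅ H.hom (S'.functor.obj n) m :=
    (S.iso m n).symm ≪≫ S'.iso m n
  have hi (n : M) {m m' : M} (f : m ⟶ m') :
      H.post _ f ≫ (i m' n).hom = (i m n).hom ≫ H.post _ f := by
    simp [i, Iso.eq_inv_comp, reassoc_of% (S.naturality_fst f n), S'.naturality_fst]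
  have hi' (m : M) {n n' : M} (g : n ⟶ n') :
      H.pre (S.functor.map g) m ≫ (i m n).hom = (i m n').hom ≫ H.pre (S'.functor.map g) m := by
    simp [i, Iso.eq_inv_comp, reassoc_of% (S.naturality_snd m g), S'.naturality_snd]
  refine nonempty_iso_of_equiv_from (fun n m => H.unitEquiv.trans
    (((Iso.refl (𝟙_ A)).homCongr (i m n)).trans H.unitEquiv.symm)) ?_ ?_
  · intro x y y' f g
    simp only [Equiv.trans_apply, Equiv.symm_apply_eq, unitEquiv_comp, Equiv.apply_symm_apply]
    simp [hi]
  · intro x x' y u f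
    simp only [Equiv.trans_apply, Equiv.symm_apply_eq, unitEquiv_comp', Equiv.apply_symm_apply]
    simp [hi']

end LeftRelativeSerre

namespace RightRelativeSerre

/-- The morphisms `τ m : IHom(m, S m) ⟶ 𝟙` induce the right relative Serre functor `S`: they are
natural perfect traces, and the isomorphisms `IHom(m, n)^∨ ≅ IHom(n, S m)` correspond to the
pairings `IHom(n, S m) ⊗ IHom(m, n) ⟶ IHom(m, S m) ⟶ 𝟙`. -/
structure IsTrace (S : RightRelativeSerre H) (τ : ∀ m, H.hom m (S.functor.obj m) ⟶ 𝟙_ A) :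
    Prop where
  perfect (m : M) : IsPerfect (τ m)
  naturality {m m' : M} (f : m ⟶ m') :
    H.post m' (S.functor.map f) ≫ τ m' = H.pre f (S.functor.obj m) ≫ τ m
  iso_comp (m n : M) :
    (S.iso m n).hom ▷ H.hom m n ≫ H.comp m n (S.functor.obj m) ≫ τ m = ε_ (H.hom m n) _

/-- In terms of the pairings `β` that correspond to the isomorphisms of a relative Serre functor,
module naturality means that the pairings are balanced. -/
lemma isModuleNatural_iff (S : RightRelativeSerre H)
    {β : ∀ m z : M, H.hom z (S.functor.obj m) ⊗ H.hom m z ⟶ 𝟙_ A}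
    (hβ : ∀ m z : M, (S.iso m z).hom ▷ H.hom m z ≫ β m z = ε_ (H.hom m z) _) :
    S.IsModuleNatural ↔ ∀ (m : M) (a : A) (z : M),
      H.actPre a (HasRightDual.rightDual a) z (S.functor.obj m) ▷ (a ⊗ H.hom m z) ≫
        H.hom (a ⊙ₗ z) (S.functor.obj m) ◁ H.actPost a m z ≫ β m (a ⊙ₗ z) =
          nest (ε_ a _) (β m z) := by
  have hβ' (m z : M) : IsEvaluation (β m z) := by
    have := (isEvaluation_evaluation (H.hom m z) _).comp_right (S.iso m z).symm
    rw [← hβ, Iso.symm_hom, ← comp_whiskerRight_assoc, Iso.inv_hom_id, id_whiskerRight,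
      Category.id_comp] at this
    exact this
  have key (m : M) (a : A) (z : M) :
      (S.iso m (a ⊙ₗ z)).hom =
        rightAdjointMate (H.actPost a m z) ≫ (rightDualTensorIso a (H.hom m z)).hom ≫
          (S.iso m z).hom ▷ HasRightDual.rightDual a ≫
          H.actPre a (HasRightDual.rightDual a) z (S.functor.obj m) ↔
      H.actPre a (HasRightDual.rightDual a) z (S.functor.obj m) ▷ (a ⊗ H.hom m z) ≫
        H.hom (a ⊙ₗ z) (S.functor.obj m) ◁ H.actPost a m z ≫ β m (a ⊙ₗ z) =
          nest (ε_ a _) (β m z) := by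
    let s := (rightDualTensorIso a (H.hom m z)).hom ≫
      (S.iso m z).hom ▷ HasRightDual.rightDual a
    have hs : s ▷ _ ≫ nest (ε_ a (HasRightDual.rightDual a)) (β m z) = ε_ _ _ := by
      rw [comp_whiskerRight, Category.assoc, nest_whiskerRight_whiskerRight, hβ,
        rightDualTensorIso_hom_nest]
    have h := ((isEvaluation_evaluation a (HasRightDual.rightDual a)).nest
      (hβ' m z)).rightAdjointMate_iff hs (hβ m (a ⊙ₗ z)) (H.actPost a m z)
      (inv (H.actPre a (HasRightDual.rightDual a) z (S.functor.obj m)))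
    rw [IsIso.comp_inv_eq] at h
    simp only [s, Category.assoc] at h
    rw [h, ← cancel_epi (H.actPre a (HasRightDual.rightDual a) z (S.functor.obj m) ▷ _),
      ← comp_whiskerRight_assoc, IsIso.hom_inv_id, id_whiskerRight, Category.id_comp, eq_comm]
  exact ⟨fun h m a z => (key m a z).1 (h a m z), fun h a m z => (key m a z).2 (h m a z)⟩

lemma IsTrace.isModuleNatural {S : RightRelativeSerre H}
    {τ : ∀ m, H.hom m (S.functor.obj m) ⟶ 𝟙_ A} (hτ : S.IsTrace τ) : S.IsModuleNatural :=
  (S.isModuleNatural_iff hτ.iso_comp).2 fun m => (isBalanced_comp (τ m)).balanced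

/-- The isomorphisms of a module natural relative Serre functor come from traces: the corresponding
pairings are natural and balanced. -/
lemma exists_isTrace (S : RightRelativeSerre H) (hS : S.IsModuleNatural) :
    ∃ τ, S.IsTrace τ := by
  let β (m z : M) : H.hom z (S.functor.obj m) ⊗ H.hom m z ⟶ 𝟙_ A :=
    (S.iso m z).inv ▷ H.hom m z ≫ ε_ (H.hom m z) _
  have hβ (m z : M) : (S.iso m z).hom ▷ H.hom m z ≫ β m z = ε_ (H.hom m z) _ := by simp [β]
  have hβ' (m z : M) : IsEvaluation (β m z) :=
    (isEvaluation_evaluation (H.hom m z) _).comp_right (S.iso m z).symm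
  have hb (m : M) : IsBalanced (β m) :=
    { dinatural := fun f => ((hβ' m _).rightAdjointMate_iff (hβ m _) (hβ m _) _ _).1
        (S.naturality_snd m f)
      balanced := (S.isModuleNatural_iff hβ).1 hS m }
  let τ (m : M) : H.hom m (S.functor.obj m) ⟶ 𝟙_ A :=
    (ρ_ _).inv ≫ H.hom m _ ◁ H.unit m ≫ β m m
  have hτ (m z : M) : β m z = H.comp m z (S.functor.obj m) ≫ τ m := (hb m).eq_comp z
  refine ⟨τ, fun m z => hτ m z ▸ hβ' m z, fun {m m'} f => ?_, fun m n => hτ m n ▸ hβ m n⟩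
  have h := ((hβ' m' m').rightAdjointMate_iff (hβ m' _) (hβ m _) _ _).1
    (S.naturality_fst f m')
  rw [hτ, hτ, comp_pre_assoc, comp_post_assoc] at h
  simpa only [unit_comp_assoc] using
    congr_arg (fun t => (ρ_ _).inv ≫ H.hom m' (S.functor.obj m) ◁ H.unit m' ≫ t) h

/-- A choice of perfect traces on all `IHom(m, S m)` makes `S` a relative Serre functor. -/
lemma exists_of_isPerfect (S : M → M) (τ : ∀ m, H.hom m (S m) ⟶ 𝟙_ A)
    (hτ : ∀ m, IsPerfect (τ m)) : ∃ S : RightRelativeSerre H, S.IsModuleNatural := by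
  choose F hF using fun (m m' : M) (f : m ⟶ m') =>
    ((hτ m').bijective_post (S m)).2 (H.pre f (S m) ≫ τ m)
  choose i hi using fun m n : M => (hτ m n).exists_rightDual_iso
  dsimp only at hF
  let S' : RightRelativeSerre H :=
    { functor :=
        { obj := S
          map := fun g => F _ _ g
          map_id := fun n => ((hτ n).bijective_post _).1 (by simp [hF])
          map_comp := fun f g => ((hτ _).bijective_post _).1 (by
            simp only [post_comp, Category.assoc, hF]
            rw [← pre_post_assoc, hF, pre_comp, Category.assoc]) }
      iso := i
      naturality_fst := fun f n => ((hτ _ n).rightAdjointMate_iff (hi _ n) (hi _ n) _ _).2 (by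
        rw [comp_pre_assoc, comp_post_assoc, hF])
      naturality_snd := fun m n n' g => ((hτ m _).rightAdjointMate_iff (hi m _) (hi m _) _ _).2
        (H.comp_dinatural_assoc _ _ g _) }
  exact ⟨S', IsTrace.isModuleNatural (τ := τ) ⟨hτ, hF _ _, hi⟩⟩

/-- For the structure isomorphisms of a relative Serre functor induced by traces, the traces of
`S(a.m)` and of `S(m)` correspond to each other. -/
lemma IsTrace.exists_moduleStr {S : RightRelativeSerre H}
    {τ : ∀ m, H.hom m (S.functor.obj m) ⟶ 𝟙_ A} (hτ : S.IsTrace τ) :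
    ∃ σ : S.ModuleStr, ∀ (a : A) (m : M), H.post (a ⊙ₗ m) (σ.iso a m).hom ≫
      twist (τ m) a (HasRightDual.rightDual a) (rr a) = τ (a ⊙ₗ m) := by
  choose i hi using fun (a : A) (m : M) =>
    ((hτ.perfect m).twist a (HasRightDual.rightDual a) (rr a)).exists_iso_of_post
      (hτ.perfect (a ⊙ₗ m))
  refine ⟨⟨i, fun a m n => ?_⟩, hi⟩
  let s := (rightDualTensorIso (H.hom m n) (HasRightDual.rightDual a)).hom ≫ rr a ◁ (S.iso m n).hom
  have hs : s ▷ _ ≫ nest (H.comp m n (S.functor.obj m) ≫ τ m)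
      (ε_ (HasRightDual.rightDual a) (rr a)) = ε_ _ _ := by
    rw [comp_whiskerRight, Category.assoc, nest_whiskerRight_whiskerLeft,
      hτ.iso_comp, rightDualTensorIso_hom_nest]
  have h := (((hτ.perfect m n).nest
    (isEvaluation_evaluation (HasRightDual.rightDual a) (rr a))).rightAdjointMate_iff hs
      (hτ.iso_comp (a ⊙ₗ m) n) (H.actPre a (HasRightDual.rightDual a) m n)
      (H.post n (i a m).hom ≫ inv (H.actPost (rr a) n (S.functor.obj m)))).2
  rw [← Category.assoc (S.iso (a ⊙ₗ m) n).hom, IsIso.comp_inv_eq] at h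
  simp only [s, Category.assoc] at h
  refine h ?_
  rw [← actPost_actPre_comp_twist (τ m) a, ← comp_whiskerRight_assoc]
  simp only [Category.assoc, IsIso.inv_hom_id, Category.comp_id]
  rw [← whisker_exchange_assoc, comp_post_assoc, hi]

/-- Relative Serre functors are unique up to isomorphism, module natural or not: apply
`Hom(𝟙, -)` to `IHom(n, S m) ≅ IHom(m, n)^∨ ≅ IHom(n, S' m)`. -/
lemma nonempty_iso (S S' : RightRelativeSerre H) : Nonempty (S.functor ≅ S'.functor) := by
  let i (m n : M) : H.hom n (S.functor.obj m) ≅ H.hom n (S'.functor.obj m) :=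
    (S.iso m n).symm ≪≫ S'.iso m n
  have hi (n : M) {m m' : M} (f : m ⟶ m') :
      H.post n (S.functor.map f) ≫ (i m' n).hom = (i m n).hom ≫ H.post n (S'.functor.map f) := by
    simp [i, Iso.eq_inv_comp, reassoc_of% (S.naturality_fst f n), S'.naturality_fst]
  have hi' (m : M) {n n' : M} (g : n ⟶ n') :
      H.pre g _ ≫ (i m n).hom = (i m n').hom ≫ H.pre g _ := by
    simp [i, Iso.eq_inv_comp, reassoc_of% (S.naturality_snd m g), S'.naturality_snd]
  refine nonempty_iso_of_equiv_to (fun m n => H.unitEquiv.trans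
    (((Iso.refl (𝟙_ A)).homCongr (i m n)).trans H.unitEquiv.symm)) ?_ ?_
  · intro x y y' f g
    simp only [Equiv.trans_apply, Equiv.symm_apply_eq, unitEquiv_comp', Equiv.apply_symm_apply]
    simp [hi']
  · intro x x' y u f
    simp only [Equiv.trans_apply, Equiv.symm_apply_eq, unitEquiv_comp, Equiv.apply_symm_apply]
    simp [hi]

end RightRelativeSerre

end RelativeSerre

/-! ### Existence of relative Serre functors -/

section Existence

variable {k : Type w} [Field k]
variable {A : Type u} [Category.{v} A] [Abelian A] [Linear k A] [MonoidalCategory A]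
  [RigidCategory A] [IsFiniteLinear k A]
variable {M : Type u'} [Category.{v'} M] [Abelian M] [Linear k M] [IsFiniteLinear k M]
  [MonoidalLeftAction A M] [ModuleCategory k A M]

open InnerHom

variable (k) in
include k in
/-- The functor `x ↦ Hom(IHom(x, n), 𝟙)` is left exact, hence corepresentable. -/
theorem LeftRelativeSerre.exists_isModuleNatural (hM : IsExactModuleCategory A M)
    (H : InnerHom A M) : ∃ S : LeftRelativeSerre H, S.IsModuleNatural := by
  have (n : M) : ∃ (X : M) (u : H.hom X n ⟶ 𝟙_ A), ∀ x,
      Function.Bijective fun f : X ⟶ x => H.pre f n ≫ u := by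
    have := H.preservesFiniteColimits_pre k hM n
    have := H.additive_pre k n
    exact exists_couniversal (k := k) (F := fun x => (H.hom x n ⟶ 𝟙_ A))
      { map := LinearMap.mk₂ k (fun f v => H.pre f n ≫ v)
          (fun f g v => by rw [pre_add k, Preadditive.add_comp])
          (fun c f v => by rw [pre_smul, Linear.smul_comp])
          (fun f v v' => Preadditive.comp_add _ _ _ _ _ _)
          (fun c f v => Linear.comp_smul _ _ _ _ _ _)
        map_id := fun a v => by simp
        map_comp := fun f g v => by simp [pre_comp]
        exact := fun f g w hc u hu =>
          existsUnique_desc_of_preservesFiniteColimits (H.functor.flip.obj n) g.op f.op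
            (by rw [← op_comp, w, op_zero]) (KernelFork.IsLimit.ofιOp _ _ hc) u hu }
  choose S τ hτ using this
  exact exists_of_isPerfect S τ fun n => isPerfect_of_bijective_pre (hτ n)

variable (k) in
include k in
/-- The functor `x ↦ Hom(IHom(m, x), 𝟙)` is left exact, hence representable. -/
theorem RightRelativeSerre.exists_isModuleNatural (hM : IsExactModuleCategory A M)
    (H : InnerHom A M) : ∃ S : RightRelativeSerre H, S.IsModuleNatural := by
  obtain ⟨P, hP⟩ := exists_isProjectiveSeparator k M
  have (m : M) : ∃ (X : M) (u : H.hom m X ⟶ 𝟙_ A), ∀ x,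
      Function.Bijective fun f : x ⟶ X => H.post m f ≫ u := by
    have := H.preservesFiniteColimits_post k hM m
    have := H.additive_post k m
    exact hP.exists_universal (k := k) (F := fun x => (H.hom m x ⟶ 𝟙_ A))
      { map := LinearMap.mk₂ k (fun f v => H.post m f ≫ v)
          (fun f g v => by rw [post_add k, Preadditive.add_comp])
          (fun c f v => by rw [post_smul, Linear.smul_comp])
          (fun f v v' => Preadditive.comp_add _ _ _ _ _ _)
          (fun c f v => Linear.comp_smul _ _ _ _ _ _)
        map_id := fun a v => by simp
        map_comp := fun f g v => by simp
        exact := fun f g w hc u hu =>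
          existsUnique_desc_of_preservesFiniteColimits (H.functor.obj (op m)) f g w hc u hu }
  choose S τ hτ using this
  exact exists_of_isPerfect S τ fun m => isPerfect_of_bijective_post (hτ m)

end Existence

/-! ### The adjunction of a perfect trace -/

section TraceAdjunction

variable {A : Type u} [Category.{v} A] [MonoidalCategory A]
variable {M : Type u'} [Category.{v'} M] [MonoidalLeftAction A M]
variable {H : InnerHom A M}

open MonoidalLeftAction

namespace InnerHom

lemma adj_counit (m n : M) :
    ((H.adj.adj m).counit.app n : H.hom m n ⊙ₗ m ⟶ n) = H.ev m n := by
  refine (((H.adj.adj m).homEquiv_counit (g := 𝟙 (H.hom m n))).trans ?_).symm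
  exact (congr_arg (· ≫ _) (CategoryTheory.Functor.map_id _ _)).trans (Category.id_comp _)

lemma actionHomRight_actPost_ev_actCounit (X Y : A) [ExactPairing X Y] {d : A} {m z : M}
    (w : d ⟶ X ⊗ H.hom m z) :
    Y ⊴ₗ ((w ≫ H.actPost X m z) ⊵ₗ m ≫ H.ev m (X ⊙ₗ z)) ≫ actCounit X Y z =
      (αₗ Y d m).inv ≫ (Y ◁ w ≫ (actCounit X Y (H.hom m z) : Y ⊗ X ⊗ _ ⟶ _)) ⊵ₗ m ≫ H.ev m z := by
  rw [comp_actionHomLeft (Y ◁ w), actCounit_actionHomLeft]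
  simp [actCounit_naturality]

lemma actPre_actionHomLeft_ev (X Y : A) [ExactPairing X Y] {d : A} {m z : M}
    (w : d ⟶ H.hom m z ⊗ Y) :
    (w ≫ H.actPre X Y m z) ⊵ₗ (X ⊙ₗ m) ≫ H.ev (X ⊙ₗ m) z =
      (αₗ d X m).inv ≫ (w ▷ X ≫ tensorCounit X Y _) ⊵ₗ m ≫ H.ev m z := by
  rw [comp_actionHomLeft (w ▷ X), tensorCounit_actionHomLeft]
  simp [-actionHomLeft_action, whiskerRight_actionHomLeft]

lemma unitEquiv_eq {x y : M} (f : x ⟶ y) : H.unitEquiv f = H.unit x ≫ H.post x f :=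
  hom_ext (by simp [unitEquiv])

variable [RigidCategory A]

lemma actPre_post_twist {m n z : M} (τ : H.hom m n ⟶ 𝟙_ A) (X Y Z : A) [ExactPairing X Y]
    [ExactPairing Y Z] (f : z ⟶ Z ⊙ₗ n) :
    H.actPre X Y m z ≫ H.post (X ⊙ₗ m) f ≫ twist τ X Y Z = trace τ f ▷ Y ≫ ε_ Y Z := by
  rw [← actPre_post_assoc, twist, IsIso.hom_inv_id_assoc, ← comp_whiskerRight_assoc,
    ← trace_comp, Category.comp_id]

/-- A perfect trace on `IHom(m, n)` makes `IHom(m, -)` left adjoint to `a ↦ a.n`. -/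
def traceAdjunction {m n : M} {τ : H.hom m n ⟶ 𝟙_ A} (hτ : IsPerfect τ) :
    H.functor.obj (op m) ⊣ actionRight A n :=
  Adjunction.mkOfHomEquiv
    { homEquiv := fun x a => (Equiv.ofBijective _ (hτ.bijective_trace x a)).symm
      homEquiv_naturality_left_symm := fun f g => trace_comp τ f g
      homEquiv_naturality_right := fun {x a a'} f g => by
        refine (Equiv.symm_apply_eq _).2 ?_
        change _ = trace τ ((Equiv.ofBijective _ (hτ.bijective_trace x a)).symm f ≫ g ⊵ₗ n)
        rw [trace_actionHomLeft]
        congr 1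
        exact ((Equiv.ofBijective _ (hτ.bijective_trace x a)).apply_symm_apply f).symm }

/-- For a perfect trace on `IHom(m, n)`: the morphism `x ⟶ IHom(m, x).n` whose partial trace is
the identity. -/
def IsPerfect.coev {m n : M} {τ : H.hom m n ⟶ 𝟙_ A} (hτ : IsPerfect τ) (x : M) :
    x ⟶ H.hom m x ⊙ₗ n :=
  (traceAdjunction hτ).unit.app x

lemma IsPerfect.trace_coev {m n : M} {τ : H.hom m n ⟶ 𝟙_ A} (hτ : IsPerfect τ) (x : M) :
    trace τ (hτ.coev x) = 𝟙 _ := by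
  rw [coev, traceAdjunction, Adjunction.mkOfHomEquiv_unit_app]
  exact (Equiv.ofBijective _ (hτ.bijective_trace x (H.hom m x))).apply_symm_apply _

lemma IsPerfect.ext_trace {m n x : M} {a : A} {τ : H.hom m n ⟶ 𝟙_ A} (hτ : IsPerfect τ)
    {f g : x ⟶ a ⊙ₗ n} (h : trace τ f = trace τ g) : f = g :=
  (hτ.bijective_trace x a).1 h

lemma post_actionHomRight_inv_actPost (a : A) (m : M) {n n' : M} (f : n ⟶ n') :
    H.post m (a ⊴ₗ f) ≫ inv (H.actPost a m n') = inv (H.actPost a m n) ≫ a ◁ H.post m f := by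
  rw [IsIso.comp_inv_eq, Category.assoc, actPost_post, IsIso.inv_hom_id_assoc]

lemma post_actionHomRight_inv_actPost_assoc (a : A) (m : M) {n n' : M} (f : n ⟶ n')
    {Z : A} (h : a ⊗ H.hom m n' ⟶ Z) :
    H.post m (a ⊴ₗ f) ≫ inv (H.actPost a m n') ≫ h =
      inv (H.actPost a m n) ≫ a ◁ H.post m f ≫ h := by
  rw [reassoc_of% (post_actionHomRight_inv_actPost a m f)]

lemma trace_actionHomRight {m n n' x : M} (τ : H.hom m n ⟶ 𝟙_ A) {a : A} (g : x ⟶ a ⊙ₗ n')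
    (f : n' ⟶ n) : trace τ (g ≫ a ⊴ₗ f) = trace (H.post m f ≫ τ) g := by
  simp [trace, post_actionHomRight_inv_actPost_assoc]

lemma trace_pre {m m' n x : M} (τ : H.hom m n ⟶ 𝟙_ A) {a : A} (g : x ⟶ a ⊙ₗ n) (f : m ⟶ m') :
    trace (H.pre f n ≫ τ) g = H.pre f x ≫ trace τ g := by
  have h : H.pre f (a ⊙ₗ n) ≫ inv (H.actPost a m n) = inv (H.actPost a m' n) ≫ a ◁ H.pre f n := by
    rw [IsIso.comp_inv_eq, Category.assoc, actPost_pre, IsIso.inv_hom_id_assoc]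
  simp only [trace, MonoidalCategory.whiskerLeft_comp, Category.assoc, pre_post_assoc,
    reassoc_of% h]

end InnerHom

end TraceAdjunction

/-! ### Nakayama functors in terms of relative Serre functors -/

section NakayamaIso

variable {k : Type w} [Field k]
variable {A : Type u} [Category.{v} A] [Abelian A] [Linear k A] [MonoidalCategory A]
  [RigidCategory A]
variable {M : Type u'} [Category.{v'} M] [Abelian M] [Linear k M] [MonoidalLeftAction A M]
variable {H : InnerHom A M}

open MonoidalLeftAction InnerHom

lemma comp_hom_eq_of_inv_comp {C : Type u} [Category.{v} C] {p q r s : C} (f : p ≅ q) (g : r ≅ s)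
    {u : p ⟶ r} {v : q ⟶ s} (h : f.inv ≫ u = v ≫ g.inv) : u ≫ g.hom = f.hom ≫ v := by
  rw [Iso.inv_comp_eq] at h
  rw [h]
  simp

namespace InnerHom

variable (k) [BilinearAction k A M]

/-- For a perfect trace on `IHom(m, n)`: the bijection `Hom(x, n) ≃ Hom(IHom(m, x), 𝟙)`. -/
def IsPerfect.postEquiv {m n : M} {τ : H.hom m n ⟶ 𝟙_ A} (hτ : IsPerfect τ) (x : M) :
    (x ⟶ n) ≃ₗ[k] (H.hom m x ⟶ 𝟙_ A) :=
  LinearEquiv.ofBijective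
    { toFun := fun g => H.post m g ≫ τ
      map_add' := fun f g => by rw [post_add k, Preadditive.add_comp]
      map_smul' := fun c f => by rw [post_smul, Linear.smul_comp, RingHom.id_apply] }
    (hτ.bijective_post x)

/-- For a perfect trace on `IHom(m, n)`: the bijection `Hom(x, a.n) ≃ Hom(IHom(m, x), a)`. -/
def IsPerfect.traceEquiv [MonoidalPreadditive A] {m n : M} {τ : H.hom m n ⟶ 𝟙_ A}
    (hτ : IsPerfect τ) (x : M) (a : A) : (x ⟶ a ⊙ₗ n) ≃ₗ[k] (H.hom m x ⟶ a) :=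
  LinearEquiv.ofBijective
    { toFun := fun g => trace τ g
      map_add' := fun f g => by rw [trace, post_add k, Preadditive.add_comp]; rfl
      map_smul' := fun c f => by
        rw [trace, post_smul, Linear.smul_comp, RingHom.id_apply]; rfl }
    (hτ.bijective_trace x a)

/-- The linear bijection `Hom(x, y) ≃ Hom(𝟙, IHom(x, y))`. -/
def unitLinearEquiv (x y : M) : (x ⟶ y) ≃ₗ[k] (𝟙_ A ⟶ H.hom x y) where
  __ := H.unitEquiv
  map_add' f g := by
    change H.unitEquiv _ = H.unitEquiv _ + H.unitEquiv _
    simp only [unitEquiv_eq, post_add k, Preadditive.comp_add]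
  map_smul' c f := by
    change H.unitEquiv _ = c • H.unitEquiv _
    simp only [unitEquiv_eq, post_smul, Linear.comp_smul]

variable (H) in
/-- The linear map `Hom(a, IHom(m, x)) → Hom(a.m, x)`. -/
def uncurry (a : A) (m x : M) : (a ⟶ H.hom m x) →ₗ[k] (a ⊙ₗ m ⟶ x) where
  toFun u := u ⊵ₗ m ≫ H.ev m x
  map_add' f g := by rw [BilinearAction.add_actionHomLeft k, Preadditive.add_comp]
  map_smul' c f := by
    rw [BilinearAction.smul_actionHomLeft, Linear.smul_comp, RingHom.id_apply]

end InnerHom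

variable [MonoidalPreadditive A] [MonoidalLinear k A] [IsFiniteLinear k A] [IsFiniteLinear k M]
  [BilinearAction k A M]

/-- The functor `IHom(m, -)` is right adjoint to `a ↦ a.m`, and `n` represents
`x ↦ Hom(IHom(m, x), 𝟙)`. -/
theorem LeftNakayama.exists_iso_of_isPerfect (NA : LeftNakayama k A) (N : LeftNakayama k M)
    {m n : M} {τ : H.hom m n ⟶ 𝟙_ A} (hτ : IsPerfect τ) [(actionRight A m).IsRightAdjoint] :
    ∃ Θ : NA.dist ⊙ₗ m ≅ N.functor.obj n, ∀ (x : M) (ξ : Module.Dual k (x ⟶ n)),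
      Θ.hom ≫ N.component ξ =
        NA.component (ξ.comp (hτ.postEquiv k x).symm.toLinearMap) ⊵ₗ m ≫ H.ev m x := by
  have := actionRight_additive (A := A) k m
  have := actionRight_linear (A := A) k m
  simp only [← adj_counit]
  exact NA.exists_comparison N (H.adj.adj m) (fun x => (hτ.postEquiv k x).symm)
    fun x x' f v => by
      rw [LinearEquiv.symm_apply_eq]
      change _ = H.post m (f ≫ _) ≫ τ
      rw [post_comp, Category.assoc]
      congr 1
      exact ((hτ.postEquiv k x').apply_symm_apply v).symm

/-- The isomorphism `N^l(n) ≅ D.S(n)`, with its components. -/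
theorem LeftRelativeSerre.IsTrace.exists_iso (NA : LeftNakayama k A) (N : LeftNakayama k M)
    {S : LeftRelativeSerre H} {τ : ∀ n, H.hom (S.functor.obj n) n ⟶ 𝟙_ A} (hτ : S.IsTrace τ) :
    ∃ θ : N.functor ≅ actComp NA.dist S.functor, ∀ (n x : M) (ξ : Module.Dual k (x ⟶ n)),
      θ.inv.app n ≫ N.component ξ =
        NA.component (ξ.comp ((hτ.perfect n).postEquiv k x).symm.toLinearMap) ⊵ₗ
          S.functor.obj n ≫ H.ev (S.functor.obj n) x := by
  have (n : M) : (actionRight A n).IsRightAdjoint := (traceAdjunction (hτ.perfect n)).isRightAdjoint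
  choose Θ hΘ using fun n => NA.exists_iso_of_isPerfect N (hτ.perfect n)
  refine ⟨(NatIso.ofComponents Θ fun {n n'} g => N.hom_ext fun x ξ => ?_).symm, ?_⟩
  rotate_left
  · exact hΘ
  change (NA.dist ⊴ₗ S.functor.map g ≫ (Θ n').hom) ≫ N.component ξ =
    ((Θ n).hom ≫ N.functor.map g) ≫ N.component ξ
  rw [Category.assoc, Category.assoc, N.map_component, hΘ, hΘ, action_exchange_assoc, ← pre_ev,
    ← comp_actionHomLeft_assoc, NA.component_comp]
  congr 3
  ext v
  obtain ⟨f, rfl⟩ := ((hτ.perfect n).postEquiv k x).surjective v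
  simp only [LinearMap.comp_apply, LinearEquiv.coe_coe, Linear.leftComp_apply,
    LinearEquiv.symm_apply_apply, Linear.rightComp_apply]
  congr 1
  rw [LinearEquiv.symm_apply_eq]
  change H.pre _ x ≫ H.post _ f ≫ τ n = H.post _ (f ≫ g) ≫ τ n'
  rw [pre_post_assoc, hτ.naturality, post_comp, Category.assoc]

/-- The isomorphism `N^l ≅ D.S` is compatible with the twisted module structures.

Let `ξ` be a linear form on `Hom(z, a.m)` and `ω` the corresponding one on `Hom(IHom(S m, z), a)`.
The component at `ξ` of either composite `a^∨∨.D.S(m) ⟶ N^l(a.m)` is determined by a component of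
`N^l_A` at `ω`: of `N^l_A(a ⊗ 𝟙)` for the composite through `a^∨∨.N^l(m)`, and of `N^l_A(𝟙 ⊗ a)`
for the composite through `D.^∨∨a.S(m)`. The isomorphism `D ⊗ ^∨∨a ≅ a^∨∨ ⊗ D` is defined by
identifying these two. -/
theorem LeftRelativeSerre.IsTrace.exists_moduleIso (NA : LeftNakayama k A) (N : LeftNakayama k M)
    {S : LeftRelativeSerre H} {τ : ∀ n, H.hom (S.functor.obj n) n ⟶ 𝟙_ A} (hτ : S.IsTrace τ) :
    ∃ (μ : N.ModuleStr A) (r : NA.Radford) (σ : S.ModuleStr)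
      (θ : N.functor ≅ actComp NA.dist S.functor), IsLeftModuleIso μ r σ θ := by
  obtain ⟨μ⟩ := N.nonempty_moduleStr (A := A)
  obtain ⟨r⟩ := NA.nonempty_radford
  obtain ⟨σ, hσ⟩ := hτ.exists_moduleStr
  obtain ⟨θ, hθ⟩ := hτ.exists_iso NA N
  refine ⟨μ, r, σ, θ, fun a m => ?_⟩
  let La := HasLeftDual.leftDual a
  let Ra := HasRightDual.rightDual a
  let Sm := S.functor.obj m
  let Θ (n : M) : NA.dist ⊙ₗ S.functor.obj n ⟶ N.functor.obj n := θ.inv.app n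
  have hΘ (n x : M) (ξ : Module.Dual k (x ⟶ n)) : Θ n ≫ N.component ξ =
      NA.component (ξ.comp ((hτ.perfect n).postEquiv k x).symm.toLinearMap) ⊵ₗ
          S.functor.obj n ≫ H.ev (S.functor.obj n) x := hθ n x ξ
  -- it suffices to compare the inverses of the isomorphisms `N(m) ≅ D.S(m)`
  suffices h : rr a ⊴ₗ Θ m ≫ (μ.iso a m).hom =
      ((αₗ (rr a) NA.dist Sm).inv ≫ (r.iso a).hom ⊵ₗ Sm ≫ (αₗ NA.dist (ll a) Sm).hom ≫
        NA.dist ⊴ₗ (σ.iso a m).hom) ≫ Θ (a ⊙ₗ m) from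
    comp_hom_eq_of_inv_comp ((actionLeft M (rr a)).mapIso (θ.app m)) (θ.app (a ⊙ₗ m)) h
  refine N.hom_ext fun z ξ => ?_
  let e := (hτ.perfect m).traceEquiv k z a
  -- the linear form on `Hom(IHom(S m, z), a) ≅ Hom(z, a.m)` that corresponds to `ξ`
  let ω : Module.Dual k (H.hom Sm z ⟶ a) := ξ.comp e.symm.toLinearMap
  -- `ξ` and `ω` correspond along the identification of `IHom(S m, a^∨.z)` with `a^∨ ⊗ IHom(S m, z)`
  have hl : NA.component ((ξ.comp (actCurry k a Ra z m)).comp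
        ((hτ.perfect m).postEquiv k (Ra ⊙ₗ z)).symm.toLinearMap) =
      NA.component ((ω.comp (Linear.rightComp k _ (ρ_ a).hom)).comp
        (actCurry k a Ra (H.hom Sm z) (𝟙_ A))) ≫ H.actPost Ra Sm z := by
    rw [NA.component_comp]
    congr 1
    ext v
    obtain ⟨f, rfl⟩ := ((hτ.perfect m).postEquiv k (Ra ⊙ₗ z)).surjective v
    change ξ (actCurry k a Ra z m (((hτ.perfect m).postEquiv k (Ra ⊙ₗ z)).symm
      ((hτ.perfect m).postEquiv k (Ra ⊙ₗ z) f))) = ξ (e.symm _)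
    rw [LinearEquiv.symm_apply_apply]
    congr 1
    rw [LinearEquiv.eq_symm_apply]
    have := post_actUnit_inv_actPost_assoc a Ra Sm f (a ◁ τ m ≫ (ρ_ a).hom)
    refine this.trans ?_
    change _ = ((actUnit a Ra (H.hom Sm z) : _ ⟶ a ⊗ Ra ⊗ _) ≫
      a ◁ (H.actPost Ra Sm z ≫ H.post Sm f ≫ τ m)) ≫ (ρ_ a).hom
    simp
  -- `ξ` and `ω` correspond along the identification of `IHom(S(a.m), z)` with `IHom(S m, z) ⊗ ^∨a`
  have hr : NA.component (ξ.comp ((hτ.perfect (a ⊙ₗ m)).postEquiv k z).symm.toLinearMap) ≫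
        H.pre (σ.iso a m).hom z =
      NA.component ((ω.comp (Linear.rightComp k _ (λ_ a).hom)).comp
        (tensorCurry k La a (H.hom Sm z) (𝟙_ A))) ≫ H.actPre (ll a) La Sm z := by
    rw [NA.component_comp, NA.component_comp]
    congr 1
    ext v
    obtain ⟨f, rfl⟩ := (((hτ.perfect m).twist (ll a) La a).postEquiv k z).surjective v
    change ξ (((hτ.perfect (a ⊙ₗ m)).postEquiv k z).symm (H.pre (σ.iso a m).hom z ≫
        H.post _ f ≫ twist (τ m) (ll a) La a)) =
      ξ (e.symm (tensorCurry k La a (H.hom Sm z) (𝟙_ A) (H.actPre (ll a) La Sm z ≫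
        H.post _ f ≫ twist (τ m) (ll a) La a) ≫ (λ_ a).hom))
    congr 1
    rw [LinearEquiv.symm_apply_eq, actPre_post_twist]
    have : tensorCurry k La a (H.hom Sm z) (𝟙_ A) (trace (τ m) f ▷ La ≫ ε_ La a) ≫ (λ_ a).hom =
        e f := by
      change (tensorUnit La a _ ≫ (trace (τ m) f ▷ La ≫ ε_ La a) ▷ a) ≫ (λ_ a).hom = trace (τ m) f
      rw [comp_whiskerRight, ← tensorUnit_naturality_assoc]
      simp [tensorUnit]
    rw [this, LinearEquiv.symm_apply_apply]
    change _ = H.post _ f ≫ τ (a ⊙ₗ m)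
    rw [pre_post_assoc, hσ]
  have h1 := r.left.spec a (𝟙_ A) (H.hom Sm z) (ω.comp (Linear.rightComp k _ (ρ_ a).hom))
  have h2 := r.right.spec (𝟙_ A) a (H.hom Sm z) (ω.comp (Linear.rightComp k _ (λ_ a).hom))
  have hl' := (hΘ m (Ra ⊙ₗ z) (ξ.comp (actCurry k a Ra z m))).trans
    (congr_arg (fun t => t ⊵ₗ Sm ≫ H.ev Sm _) hl)
  have hr' : NA.dist ⊴ₗ (σ.iso a m).hom ≫ Θ (a ⊙ₗ m) ≫ N.component ξ =
      (NA.component ((ω.comp (Linear.rightComp k _ (λ_ a).hom)).comp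
        (tensorCurry k La a (H.hom Sm z) (𝟙_ A))) ≫ H.actPre (ll a) La Sm z) ⊵ₗ (ll a ⊙ₗ Sm) ≫
          H.ev (ll a ⊙ₗ Sm) z := by
    rw [hΘ, ← hr, action_exchange_assoc, ← pre_ev, comp_actionHomLeft_assoc]
  have h3 : (r.iso a).hom ≫ (r.right.iso (𝟙_ A) a).hom ≫
      NA.component (ω.comp (Linear.rightComp k _ (λ_ a).hom)) = (r.left.iso a (𝟙_ A)).hom ≫
        NA.component (ω.comp (Linear.rightComp k _ (ρ_ a).hom)) := by
    rw [← NA.map_component, ← NA.map_component, ← reassoc_of% (r.spec a)]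
  have hL : (rr a ⊴ₗ Θ m ≫ (μ.iso a m).hom) ≫ N.component ξ = (αₗ (rr a) NA.dist Sm).inv ≫
      ((r.left.iso a (𝟙_ A)).hom ≫ NA.component (ω.comp (Linear.rightComp k _ (ρ_ a).hom))) ⊵ₗ Sm ≫
        H.ev Sm z := by
    rw [Category.assoc, μ.spec, h1, ← actionHomRight_comp_assoc]
    refine (congr_arg (fun t => rr a ⊴ₗ t ≫ actCounit Ra (rr a) z) hl').trans ?_
    exact actionHomRight_actPost_ev_actCounit _ _ _
  rw [hL, ← h3, h2]
  simp only [Category.assoc]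
  rw [hr', actPre_actionHomLeft_ev]
  simp [La]

/-- The functor `IHom(m, -)` is left adjoint to `a ↦ a.n`, and `m` corepresents
`x ↦ Hom(𝟙, IHom(m, x))`. -/
theorem RightNakayama.exists_iso_of_isPerfect (NA : RightNakayama k A) (N : RightNakayama k M)
    {m n : M} {τ : H.hom m n ⟶ 𝟙_ A} (hτ : IsPerfect τ) :
    ∃ Θ : N.functor.obj m ≅ NA.distInv ⊙ₗ n, ∀ (x : M) (ξ : Module.Dual k (m ⟶ x)),
      N.component ξ ≫ Θ.hom = hτ.coev x ≫
        NA.component (ξ.comp (unitLinearEquiv k m x).symm.toLinearMap) ⊵ₗ n := by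
  have := actionRight_additive (A := A) k n
  have := actionRight_linear (A := A) k n
  have : (actionRight A n).IsLeftAdjoint := (H.adj.adj n).isLeftAdjoint
  exact NA.exists_comparison N (traceAdjunction hτ) (fun x => (unitLinearEquiv k m x).symm)
    fun x x' f v => by
      rw [LinearEquiv.symm_apply_eq]
      refine Eq.trans ?_ (unitEquiv_comp _ f).symm
      congr 1
      exact ((unitLinearEquiv k m x).apply_symm_apply v).symm

/-- The isomorphism `N^r(m) ≅ D⁻¹.S(m)`, with its components. -/
theorem RightRelativeSerre.IsTrace.exists_iso (NA : RightNakayama k A) (N : RightNakayama k M)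
    {S : RightRelativeSerre H} {τ : ∀ m, H.hom m (S.functor.obj m) ⟶ 𝟙_ A} (hτ : S.IsTrace τ) :
    ∃ θ : N.functor ≅ actComp NA.distInv S.functor, ∀ (m x : M) (ξ : Module.Dual k (m ⟶ x)),
      N.component ξ ≫ θ.hom.app m = (hτ.perfect m).coev x ≫
        NA.component (ξ.comp (unitLinearEquiv k m x).symm.toLinearMap) ⊵ₗ S.functor.obj m := by
  choose Θ hΘ using fun m => NA.exists_iso_of_isPerfect N (hτ.perfect m)
  refine ⟨NatIso.ofComponents Θ fun {m m'} f => N.hom_ext fun x ξ => ?_, ?_⟩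
  rotate_left
  · exact hΘ
  change N.component ξ ≫ N.functor.map f ≫ (Θ m').hom =
    N.component ξ ≫ (Θ m).hom ≫ NA.distInv ⊴ₗ S.functor.map f
  have h : (hτ.perfect m').coev x ≫ H.pre f x ⊵ₗ S.functor.obj m' =
      (hτ.perfect m).coev x ≫ H.hom m x ⊴ₗ S.functor.map f := by
    apply (hτ.perfect m').ext_trace
    rw [trace_actionHomLeft, IsPerfect.trace_coev, trace_actionHomRight, hτ.naturality, trace_pre,
      IsPerfect.trace_coev, Category.id_comp, Category.comp_id]
  rw [N.component_map_assoc, hΘ, reassoc_of% (hΘ m x ξ), ← action_exchange,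
    ← reassoc_of% h, ← comp_actionHomLeft, NA.comp_component]
  congr 3
  ext v
  obtain ⟨g, rfl⟩ := (unitLinearEquiv k m' x).surjective v
  simp only [LinearMap.comp_apply, LinearEquiv.coe_coe, Linear.leftComp_apply,
    LinearEquiv.symm_apply_apply, Linear.rightComp_apply]
  congr 1
  rw [LinearEquiv.eq_symm_apply]
  exact unitEquiv_comp' f g

/-- The isomorphism `N^r ≅ D⁻¹.S` is compatible with the twisted module structures.

Let `ξ` be a linear form on `Hom(a.m, z)` and `ω` the corresponding one on `Hom(a, IHom(m, z))`.
Composing the component of `N^r(a.m)` at `ξ` with either morphism to `^∨∨a.D⁻¹.S(m)` gives the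
component at `ω` of `N^r_A(a ⊗ 𝟙)` and of `N^r_A(𝟙 ⊗ a)`, respectively; the isomorphism
`D⁻¹ ⊗ a^∨∨ ≅ ^∨∨a ⊗ D⁻¹` is defined by identifying these two. -/
theorem RightRelativeSerre.IsTrace.exists_moduleIso (NA : RightNakayama k A)
    (N : RightNakayama k M) {S : RightRelativeSerre H}
    {τ : ∀ m, H.hom m (S.functor.obj m) ⟶ 𝟙_ A} (hτ : S.IsTrace τ) :
    ∃ (δ : N.ModuleStr A) (r : NA.Radford) (σ : S.ModuleStr)
      (θ : N.functor ≅ actComp NA.distInv S.functor), IsRightModuleIso δ r σ θ := by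
  obtain ⟨δ⟩ := N.nonempty_moduleStr (A := A)
  obtain ⟨r⟩ := NA.nonempty_radford
  obtain ⟨σ, hσ⟩ := hτ.exists_moduleStr
  obtain ⟨θ, hθ⟩ := hτ.exists_iso NA N
  refine ⟨δ, r, σ, θ, fun a m => ?_⟩
  let La := HasLeftDual.leftDual a
  let Ra := HasRightDual.rightDual a
  let Sm := S.functor.obj m
  let Θ (m : M) : N.functor.obj m ⟶ NA.distInv ⊙ₗ S.functor.obj m := θ.hom.app m
  have hΘ (m x : M) (ξ : Module.Dual k (m ⟶ x)) : N.component ξ ≫ Θ m = (hτ.perfect m).coev x ≫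
      NA.component (ξ.comp (unitLinearEquiv k m x).symm.toLinearMap) ⊵ₗ S.functor.obj m := hθ m x ξ
  change (δ.iso a m).hom ≫ ll a ⊴ₗ Θ m = Θ (a ⊙ₗ m) ≫ NA.distInv ⊴ₗ (σ.iso a m).hom ≫
        (αₗ NA.distInv (rr a) Sm).inv ≫ (r.iso a).hom ⊵ₗ Sm ≫ (αₗ (ll a) NA.distInv Sm).hom
  refine N.hom_ext fun z ξ => ?_
  -- the linear form on `Hom(a, IHom(m, z)) ≅ Hom(a.m, z)` that corresponds to `ξ`
  let ω : Module.Dual k (a ⟶ H.hom m z) := ξ.comp (H.uncurry k a m z)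
  -- `ξ` and `ω` correspond along the identification of `IHom(m, ^∨a.z)` with `^∨a ⊗ IHom(m, z)`
  have hl : H.actPost La m z ≫ NA.component ((ξ.comp (actUncurry k La a m z)).comp
        (unitLinearEquiv k m (La ⊙ₗ z)).symm.toLinearMap) =
      NA.component ((ω.comp (Linear.leftComp k _ (ρ_ a).inv)).comp
        (actUncurry k La a (𝟙_ A) (H.hom m z))) := by
    rw [NA.comp_component]
    congr 1
    ext v
    obtain ⟨g, hg⟩ := (unitLinearEquiv k m (La ⊙ₗ z)).surjective (v ≫ H.actPost La m z)
    change ξ (actUncurry k La a m z ((unitLinearEquiv k m (La ⊙ₗ z)).symm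
      (v ≫ H.actPost La m z))) = ξ (((ρ_ a).inv ≫ a ◁ v ≫
        (actCounit La a (H.hom m z) : a ⊗ La ⊗ _ ⟶ _)) ⊵ₗ m ≫ H.ev m z)
    rw [← hg, LinearEquiv.symm_apply_apply]
    congr 1
    rw [← homEquiv_symm_apply, Equiv.eq_symm_apply]
    replace hg : H.unitEquiv g = v ≫ H.actPost La m z := hg
    rw [← actPost_actCounit, ← MonoidalCategory.whiskerLeft_comp_assoc, ← hg, unitEquiv_eq,
      ← unit_post]
    change _ ≫ _ ≫ _ ≫ H.post m (a ⊴ₗ g ≫ actCounit La a z) = _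
    rw [post_comp, ← actPost_post_assoc]
    simp
  -- `ξ` and `ω` correspond along the identification of `IHom(a.m, z)` with `IHom(m, z) ⊗ a^∨`
  have hr : H.actPre a Ra m z ≫ NA.component (ξ.comp
        (unitLinearEquiv k (a ⊙ₗ m) z).symm.toLinearMap) =
      NA.component ((ω.comp (Linear.leftComp k _ (λ_ a).inv)).comp
        (tensorUncurry k a Ra (𝟙_ A) (H.hom m z))) := by
    rw [NA.comp_component]
    congr 1
    ext v
    change ξ ((unitLinearEquiv k (a ⊙ₗ m) z).symm (v ≫ H.actPre a Ra m z)) =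
      ξ (((λ_ a).inv ≫ v ▷ a ≫ tensorCounit a Ra (H.hom m z)) ⊵ₗ m ≫ H.ev m z)
    congr 1
    rw [LinearEquiv.symm_apply_eq]
    refine hom_ext ?_
    rw [actPre_actionHomLeft_ev]
    change _ = H.homEquiv ((λₗ[A] (a ⊙ₗ m)).hom ≫ _ ≫ 𝟙 z) ⊵ₗ (a ⊙ₗ m) ≫ H.ev (a ⊙ₗ m) z
    rw [homEquiv_ev, comp_actionHomLeft (λ_ a).inv, leftUnitor_inv_actionHom]
    simp
  -- how the coevaluations at `m` and `a.m` interact with the action, by comparing partial traces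
  have hl' : (hτ.perfect m).coev (La ⊙ₗ z) = La ⊴ₗ (hτ.perfect m).coev z ≫
      (αₗ La (H.hom m z) Sm).inv ≫ H.actPost La m z ⊵ₗ Sm := by
    apply (hτ.perfect m).ext_trace
    rw [IsPerfect.trace_coev, ← Category.assoc, trace_actionHomLeft,
      trace_actionHomRight_assoc_inv, post_actionHomRight_inv_actPost_assoc,
      ← MonoidalCategory.whiskerLeft_comp, ← trace_comp, Category.comp_id,
      IsPerfect.trace_coev]
    simp
  have hr' : (hτ.perfect (a ⊙ₗ m)).coev z ≫ H.hom (a ⊙ₗ m) z ⊴ₗ (σ.iso a m).hom =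
      (hτ.perfect m).coev z ≫ tensorUnit Ra (rr a) (H.hom m z) ⊵ₗ Sm ≫ (αₗ _ _ _).hom ≫
        H.actPre a Ra m z ⊵ₗ (rr a ⊙ₗ Sm) := by
    apply ((hτ.perfect m).twist a Ra (rr a)).ext_trace
    rw [trace_actionHomRight, hσ, IsPerfect.trace_coev, ← Category.assoc, ← Category.assoc,
      trace_actionHomLeft, ← cancel_epi (H.actPre a Ra m z), ← Category.assoc (H.actPre a Ra m z),
      actPre_trace_twist, Category.assoc _ (αₗ _ _ _).hom (αₗ _ _ _).inv, Iso.hom_inv_id,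
      Category.comp_id, Category.comp_id, trace_actionHomLeft, IsPerfect.trace_coev]
    simp
  have h1 := r.left.spec a (𝟙_ A) (H.hom m z) (ω.comp (Linear.leftComp k _ (ρ_ a).inv))
  have h2 := r.right.spec (𝟙_ A) a (H.hom m z) (ω.comp (Linear.leftComp k _ (λ_ a).inv))
  have h3 : NA.component (ω.comp (Linear.leftComp k _ (λ_ a).inv)) ≫ (r.right.iso (𝟙_ A) a).hom ≫
      (r.iso a).hom = NA.component (ω.comp (Linear.leftComp k _ (ρ_ a).inv)) ≫
        (r.left.iso a (𝟙_ A)).hom := by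
    rw [← NA.component_map, ← NA.component_map, Category.assoc, r.spec a, Category.assoc]
  have hL : N.component ξ ≫ (δ.iso a m).hom ≫ ll a ⊴ₗ Θ m = (hτ.perfect m).coev z ≫
      (NA.component (ω.comp (Linear.leftComp k _ (ρ_ a).inv)) ≫ (r.left.iso a (𝟙_ A)).hom) ⊵ₗ Sm ≫
        (αₗ (ll a) NA.distInv Sm).hom := by
    rw [← Category.assoc, δ.spec, h1, Category.assoc, ← actionHomRight_comp, hΘ, hl']
    simp only [Category.assoc]
    rw [← comp_actionHomLeft, hl, comp_actionHomLeft (actUnit _ _ _), actUnit_actionHomLeft]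
    simp [actUnit_naturality_assoc, La, Sm]
  rw [hL, ← h3, reassoc_of% h2, reassoc_of% (hΘ (a ⊙ₗ m) z ξ)]
  rw [← action_exchange_assoc, reassoc_of% hr', ← comp_actionHomLeft_assoc, hr]
  simp [Ra]

end NakayamaIso

/-! ### Exactness of Nakayama functors -/

section Equivalence

variable {A : Type u} [Category.{v} A] [MonoidalCategory A] [RigidCategory A]
variable {M : Type u'} [Category.{v'} M] [MonoidalLeftAction A M]
variable {H : InnerHom A M}

open InnerHom

lemma isEquivalence_of_bijective {C : Type u} [Category.{v} C] {D : Type u'} [Category.{v'} D]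
    (F : C ⥤ D) (h : ∀ x y, Function.Bijective (F.map : (x ⟶ y) → _))
    (h' : ∀ y, ∃ x, Nonempty (F.obj x ≅ y)) : F.IsEquivalence where
  faithful := ⟨fun hfg => (h _ _).1 hfg⟩
  full := ⟨fun f => (h _ _).2 f⟩
  essSurj := ⟨h'⟩

/-- The left relative Serre functor is an equivalence with quasi-inverse the right one: a perfect
trace on `IHom(S n, n)` identifies `Hom(n, n')` and `Hom(S n, S n')` with `Hom(IHom(S n', n), 𝟙)`,
and a perfect trace on `IHom(m, S' m)` gives `S(S' m) ≅ m`. -/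
lemma LeftRelativeSerre.IsTrace.isEquivalence {S : LeftRelativeSerre H} {S' : RightRelativeSerre H}
    {τ : ∀ n, H.hom (S.functor.obj n) n ⟶ 𝟙_ A} {τ' : ∀ m, H.hom m (S'.functor.obj m) ⟶ 𝟙_ A}
    (hτ : S.IsTrace τ) (hτ' : S'.IsTrace τ') : S.functor.IsEquivalence :=
  isEquivalence_of_bijective _
    (fun n n' => by
      refine (Function.Bijective.of_comp_iff' ((hτ.perfect n).bijective_pre _) _).1 ?_
      convert (hτ.perfect n').bijective_post n using 1
      exact funext fun g => hτ.naturality g)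
    fun m => by
      obtain ⟨i, -⟩ := (hτ.perfect (S'.functor.obj m)).exists_iso_of_pre (hτ'.perfect m)
      exact ⟨_, ⟨i⟩⟩

lemma RightRelativeSerre.IsTrace.isEquivalence {S : LeftRelativeSerre H}
    {S' : RightRelativeSerre H} {τ : ∀ n, H.hom (S.functor.obj n) n ⟶ 𝟙_ A}
    {τ' : ∀ m, H.hom m (S'.functor.obj m) ⟶ 𝟙_ A} (hτ' : S'.IsTrace τ') (hτ : S.IsTrace τ) :
    S'.functor.IsEquivalence :=
  isEquivalence_of_bijective _
    (fun m m' => by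
      refine (Function.Bijective.of_comp_iff' ((hτ'.perfect m').bijective_post _) _).1 ?_
      convert (hτ'.perfect m).bijective_pre m' using 1
      exact funext fun g => hτ'.naturality g)
    fun n => by
      obtain ⟨i, -⟩ := (hτ'.perfect (S.functor.obj n)).exists_iso_of_post (hτ.perfect n)
      exact ⟨_, ⟨i.symm⟩⟩

end Equivalence

section Exact

variable {k : Type w} [Field k]
variable {A : Type u} [Category.{v} A] [Abelian A] [Linear k A] [MonoidalCategory A]
  [RigidCategory A] [MonoidalPreadditive A] [MonoidalLinear k A] [IsFiniteLinear k A]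
variable {M : Type u'} [Category.{v'} M] [Abelian M] [Linear k M] [IsFiniteLinear k M]
  [MonoidalLeftAction A M] [ModuleCategory k A M]

variable (A) in
include A in
/-- The left exact Nakayama functor of an exact module category is also right exact, being
isomorphic to `m ↦ D.S(m)` for an equivalence `S`. -/
theorem LeftNakayama.preservesFiniteColimits (hM : IsExactModuleCategory A M)
    (N : LeftNakayama k M) : PreservesFiniteColimits N.functor := by
  obtain ⟨H⟩ := nonempty_innerHom k A M
  obtain ⟨NA⟩ := nonempty_leftNakayama k A
  obtain ⟨S, hS⟩ := LeftRelativeSerre.exists_isModuleNatural k hM H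
  obtain ⟨S', hS'⟩ := RightRelativeSerre.exists_isModuleNatural k hM H
  obtain ⟨τ, hτ⟩ := S.exists_isTrace hS
  obtain ⟨τ', hτ'⟩ := S'.exists_isTrace hS'
  obtain ⟨θ, -⟩ := hτ.exists_iso NA N
  have := hτ.isEquivalence hτ'
  have : PreservesColimits (actComp NA.dist S.functor) :=
    (Adjunction.ofIsLeftAdjoint (actComp NA.dist S.functor)).leftAdjoint_preservesColimits
  exact preservesFiniteColimits_of_natIso θ.symm

variable (A) in
include A in
/-- The right exact Nakayama functor of an exact module category, as `m ↦ D⁻¹.S(m)` for an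
equivalence `S`. -/
theorem RightNakayama.preservesFiniteColimits (hM : IsExactModuleCategory A M)
    (N : RightNakayama k M) : PreservesFiniteColimits N.functor := by
  obtain ⟨H⟩ := nonempty_innerHom k A M
  obtain ⟨NA⟩ := nonempty_rightNakayama k A
  obtain ⟨S, hS⟩ := LeftRelativeSerre.exists_isModuleNatural k hM H
  obtain ⟨S', hS'⟩ := RightRelativeSerre.exists_isModuleNatural k hM H
  obtain ⟨τ, hτ⟩ := S.exists_isTrace hS
  obtain ⟨τ', hτ'⟩ := S'.exists_isTrace hS'
  obtain ⟨θ, -⟩ := hτ'.exists_iso NA N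
  have := hτ'.isEquivalence hτ
  have : PreservesColimits (actComp NA.distInv S'.functor) :=
    (Adjunction.ofIsLeftAdjoint (actComp NA.distInv S'.functor)).leftAdjoint_preservesColimits
  exact preservesFiniteColimits_of_natIso θ.symm

variable (k A) in
lemma moduleCategory_self : ModuleCategory k A A where
  preservesFiniteLimits m := by
    have := (Adjunction.ofIsRightAdjoint (tensorRight m)).rightAdjoint_preservesLimits
    exact (inferInstance : PreservesFiniteLimits (tensorRight m))
  preservesFiniteColimits m := by
    have := (Adjunction.ofIsLeftAdjoint (tensorRight m)).leftAdjoint_preservesColimits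
    exact (inferInstance : PreservesFiniteColimits (tensorRight m))

omit [Linear k A] [MonoidalPreadditive A] [MonoidalLinear k A] [IsFiniteLinear k A] in
variable (A) in
lemma isExactModuleCategory_self : IsExactModuleCategory A A := fun p hp m =>
  (tensorAdjunction m (HasRightDual.rightDual m)).map_projective p hp

end Exact

/-! ### Nakayama functors on projective objects -/

section Projective

variable {k : Type w} [Field k] {C : Type u} [Category.{v} C] [Abelian C] [Linear k C]
  [IsFiniteLinear k C]

/-- For projective `P`, both `N^r(P)` and the Serre dual of `P` represent `x ↦ Hom(P, x)^*`. -/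
lemma RightNakayama.bijective_component (N : RightNakayama k C) (P x : C) [Projective P] :
    Function.Bijective fun φ : Module.Dual k (P ⟶ x) => N.component φ := by
  obtain ⟨G, hG⟩ := exists_isProjectiveSeparator k C
  obtain ⟨I, τ, hτ⟩ := hG.exists_serreDual (k := k) P
  let e (x : C) : (x ⟶ I) ≃ₗ[k] Module.Dual k (P ⟶ x) := LinearEquiv.ofBijective
    { toFun := fun f => τ.comp (Linear.rightComp k P f)
      map_add' := fun f g => by ext; simp
      map_smul' := fun c f => by ext; simp } (hτ x)
  have he {x y : C} (f : x ⟶ y) (φ : Module.Dual k (P ⟶ y)) :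
      f ≫ (e y).symm φ = (e x).symm (φ.comp (Linear.rightComp k P f)) := by
    obtain ⟨g, rfl⟩ := (e y).surjective φ
    rw [LinearEquiv.symm_apply_apply, LinearEquiv.eq_symm_apply]
    ext p
    simp [e]
  have heτ : (e I).symm τ = 𝟙 I := by
    rw [LinearEquiv.symm_apply_eq]
    ext p
    simp [e]
  obtain ⟨p, hp⟩ := N.exists_desc ⟨fun x => (e x).symm.toLinearMap, fun x x' f φ => he f φ⟩
  replace hp (x : C) (φ : Module.Dual k (P ⟶ x)) : N.component φ ≫ p = (e x).symm φ := hp x φ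
  have hq {x : C} (f : x ⟶ I) : f ≫ N.component τ = N.component (e x f) := N.comp_component _ _
  let i : I ≅ N.functor.obj P := ⟨N.component τ, p, by rw [hp, heτ], N.hom_ext fun x φ => by
    rw [reassoc_of% (hp x φ), hq, LinearEquiv.apply_symm_apply, Category.comp_id]⟩
  have h : (fun φ : Module.Dual k (P ⟶ x) => N.component φ) =
      ((Iso.refl x).homCongr i) ∘ (e x).symm := by
    ext φ
    change _ = 𝟙 x ≫ (e x).symm φ ≫ N.component τ
    rw [hq, LinearEquiv.apply_symm_apply, Category.id_comp]
  rw [h]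
  exact (Equiv.bijective _).comp (e x).symm.bijective

/-- The canonical morphism `y ⟶ N^l(N^r(y))`: its component at a linear form `ξ` on
`Hom(x, N^r(y))` corresponds to the linear form `φ ↦ ξ(N^r.component φ)` on `Hom(y, x)^*`. -/
lemma exists_nakayamaUnit (Nl : LeftNakayama k C) (Nr : RightNakayama k C) :
    ∃ η : 𝟭 C ⟶ Nr.functor ⋙ Nl.functor, ∀ (x y : C) (ξ : Module.Dual k (x ⟶ Nr.functor.obj y))
      (φ : Module.Dual k (y ⟶ x)),
        φ ((η.app y : y ⟶ Nl.functor.obj (Nr.functor.obj y)) ≫ Nl.component ξ) =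
          ξ (Nr.component φ) := by
  let c (x y : C) : Module.Dual k (x ⟶ Nr.functor.obj y) →ₗ[k] (y ⟶ x) :=
    (Module.evalEquiv k (y ⟶ x)).symm.toLinearMap.comp ((Nr.family y).1 x).dualMap
  have hc (x y : C) (ξ : Module.Dual k (x ⟶ Nr.functor.obj y)) (φ : Module.Dual k (y ⟶ x)) :
      φ (c x y ξ) = ξ (Nr.component φ) := by
    exact LinearMap.congr_fun ((Module.evalEquiv k (y ⟶ x)).apply_symm_apply
      (ξ.comp ((Nr.family y).1 x))) φ
  have ext {x y : C} {f g : y ⟶ x} (h : ∀ φ : Module.Dual k (y ⟶ x), φ f = φ g) : f = g := by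
    rw [← sub_eq_zero, ← Module.forall_dual_apply_eq_zero_iff k]
    intro φ
    rw [map_sub, h, sub_self]
  choose η hη using fun y => Nl.exists_lift (y := Nr.functor.obj y) (z := y)
    ⟨fun x => c x y, fun x x' f ξ => ext fun φ => by
      refine (hc x y ξ (φ.comp (Linear.rightComp k y f))).trans ?_
      rw [hc, ← Nr.comp_component]
      rfl⟩
  replace hη (x y : C) (ξ : Module.Dual k (x ⟶ Nr.functor.obj y)) :
    η y ≫ Nl.component ξ = c x y ξ := hη y x ξ
  refine ⟨{ app := η, naturality := fun y y' g => Nl.hom_ext fun x ξ => ext fun φ => ?_ },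
    fun x y ξ φ => ?_⟩
  · change φ ((g ≫ η y') ≫ Nl.component ξ) =
      φ ((η y ≫ Nl.functor.map (Nr.functor.map g)) ≫ Nl.component ξ)
    rw [Category.assoc, Category.assoc, Nl.map_component]
    refine Eq.trans ?_ (congr_arg φ (hη x y (ξ.comp (Linear.rightComp k x _)))).symm
    rw [hη]
    refine Eq.trans ?_ (hc x y _ φ).symm
    refine (hc x y' ξ (φ.comp (Linear.leftComp k x g))).trans ?_
    rw [← Nr.component_map]
    rfl
  · rw [← hc, ← hη]

/-- On a projective object `P` the canonical morphism `P ⟶ N^l(N^r(P))` is invertible. As `N^r(P)`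
is the Serre dual of `P`, the inverse is the component of `N^l(N^r(P))` at the trace on
`Hom(P, N^r(P))`. -/
lemma isIso_nakayamaUnit (Nl : LeftNakayama k C) (Nr : RightNakayama k C)
    {η : 𝟭 C ⟶ Nr.functor ⋙ Nl.functor}
    (hη : ∀ (x y : C) (ξ : Module.Dual k (x ⟶ Nr.functor.obj y)) (φ : Module.Dual k (y ⟶ x)),
      φ ((η.app y : y ⟶ Nl.functor.obj (Nr.functor.obj y)) ≫ Nl.component ξ) =
        ξ (Nr.component φ)) (P : C) [Projective P] : IsIso (η.app P) := by
  let κ (x : C) : Module.Dual k (P ⟶ x) ≃ₗ[k] (x ⟶ Nr.functor.obj P) :=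
    LinearEquiv.ofBijective ((Nr.family P).1 x) (Nr.bijective_component P x)
  have hκ (x : C) (φ : Module.Dual k (P ⟶ x)) : κ x φ = Nr.component φ := rfl
  have ext {x : C} {f g : P ⟶ x} (h : ∀ φ : Module.Dual k (P ⟶ x), φ f = φ g) : f = g := by
    rw [← sub_eq_zero, ← Module.forall_dual_apply_eq_zero_iff k]
    intro φ
    rw [map_sub, h, sub_self]
  -- the linear form on `Hom(P, N^r(P)) ≅ Hom(P, P)^*` given by evaluation at the identity
  let ξ₀ : Module.Dual k (P ⟶ Nr.functor.obj P) :=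
    (Module.Dual.eval k (P ⟶ P) (𝟙 P)).comp (κ P).symm.toLinearMap
  have hξ₀ (φ : Module.Dual k (P ⟶ P)) : ξ₀ (Nr.component φ) = φ (𝟙 P) := by
    change Module.Dual.eval k (P ⟶ P) (𝟙 P) ((κ P).symm (κ P φ)) = φ (𝟙 P)
    rw [LinearEquiv.symm_apply_apply]
    rfl
  let u : P ⟶ Nl.functor.obj (Nr.functor.obj P) := η.app P
  change IsIso u
  refine ⟨Nl.component ξ₀, ext fun φ => (hη P P ξ₀ φ).trans (hξ₀ φ), Nl.hom_ext fun x ξ => ?_⟩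
  rw [Category.assoc, Category.id_comp, Nl.component_comp]
  congr 1
  ext v
  obtain ⟨φ, rfl⟩ := (κ x).surjective v
  rw [hκ]
  change ξ₀ ((u ≫ Nl.component ξ) ≫ Nr.component φ) = _
  rw [Nr.comp_component, hξ₀]
  refine Eq.trans ?_ (hη x P ξ φ)
  simp [u]

/-- A morphism of right exact functors that is invertible on projective objects is invertible. -/
lemma nonempty_iso_of_projective [EnoughProjectives C] {F : C ⥤ C}
    [PreservesFiniteColimits F] (η : 𝟭 C ⟶ F) (h : ∀ P : C, Projective P → IsIso (η.app P))
    (x : C) : Nonempty (x ≅ F.obj x) := by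
  have := F.preservesZeroMorphisms_of_preserves_initial_object
  let p := Projective.π x
  let q := Projective.d p
  have hx := (exact_d_f p).gIsCokernel
  have : IsIso (η.app (Projective.over x)) := h _ inferInstance
  have : IsIso (η.app (Projective.syzygies p)) := h _ inferInstance
  exact ⟨(hx.coconePointUniqueUpToIso (cokernelIsCokernel q)).trans
    ((cokernel.mapIso q (F.map q) (asIso (η.app (Projective.syzygies p)))
      (asIso (η.app (Projective.over x))) (η.naturality q)).trans
      ((PreservesCokernel.iso F q).symm.trans (F.mapIso
        ((cokernelIsCokernel q).coconePointUniqueUpToIso hx))))⟩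

end Projective

/-! ### Invertibility of the distinguished object -/

section Invertible

variable {A : Type u} [Category.{v} A] [MonoidalCategory A] [RigidCategory A]

/-- The dual of an invertible object is its inverse. -/
lemma nonempty_rightDual_iso {x y : A} (e : x ⊗ y ≅ 𝟙_ A) (e' : y ⊗ x ≅ 𝟙_ A) :
    Nonempty (HasRightDual.rightDual x ≅ y) := by
  let E : A ≌ A := CategoryTheory.Equivalence.mk (tensorRight x) (tensorRight y)
    ((rightUnitorNatIso A).symm ≪≫ (tensoringRight A).mapIso e.symm ≪≫ tensorRightTensor x y)
    ((tensorRightTensor y x).symm ≪≫ (tensoringRight A).mapIso e' ≪≫ rightUnitorNatIso A)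
  let i := Adjunction.rightAdjointUniq (tensorAdjunction x (HasRightDual.rightDual x))
    E.toAdjunction
  exact ⟨(λ_ _).symm ≪≫ i.app (𝟙_ A) ≪≫ λ_ y⟩

variable {k : Type w} [Field k] [Abelian A] [Linear k A] [MonoidalPreadditive A]
  [MonoidalLinear k A] [IsFiniteLinear k A]

/-- The distinguished object is invertible: `𝟙 ≅ N^l(N^r(𝟙)) ≅ D ⊗ ^∨∨(D⁻¹)`, and `^∨∨(D⁻¹)` is
also a left inverse of `D` because of `D ⊗ ^∨∨(D⁻¹) ≅ (D⁻¹)^∨∨ ⊗ D`. The dual of an invertible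
object being its inverse, `^∨∨(D⁻¹) ≅ D⁻¹`. -/
theorem nonempty_dist_tensor_distInv (N : LeftNakayama k A) (N' : RightNakayama k A) :
    Nonempty (N.dist ⊗ N'.distInv ≅ 𝟙_ A) ∧ Nonempty (N'.distInv ⊗ N.dist ≅ 𝟙_ A) := by
  have := moduleCategory_self k A
  have := N.preservesFiniteColimits A (isExactModuleCategory_self A)
  have := N'.preservesFiniteColimits A (isExactModuleCategory_self A)
  obtain ⟨P, hP⟩ := exists_isProjectiveSeparator k A
  have := hP.enoughProjectives k
  obtain ⟨η, hη⟩ := exists_nakayamaUnit N N'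
  obtain ⟨i⟩ := nonempty_iso_of_projective η (fun P _ => isIso_nakayamaUnit N N' hη P) (𝟙_ A)
  obtain ⟨r⟩ := N.nonempty_radford
  let D := N.dist
  let D' := N'.distInv
  let E := ll D'
  -- `D ⊗ ^∨∨D' ≅ N^l(𝟙 ⊗ D') ≅ N^l(N^r(𝟙)) ≅ 𝟙`
  let e₁ : D ⊗ E ≅ 𝟙_ A := r.right.iso (𝟙_ A) D' ≪≫ N.functor.mapIso (λ_ D') ≪≫ i.symm
  let e₂ : rr D' ⊗ D ≅ 𝟙_ A := r.iso D' ≪≫ e₁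
  let e₃ : rr D' ≅ E := (ρ_ _).symm ≪≫ whiskerLeftIso _ e₁.symm ≪≫ (α_ _ _ _).symm ≪≫
    whiskerRightIso e₂ E ≪≫ λ_ E
  let e₄ : E ⊗ D ≅ 𝟙_ A := whiskerRightIso e₃.symm D ≪≫ e₂
  have dual (x : A) : @HasRightDual.rightDual A _ _ (HasLeftDual.leftDual x)
      (RightRigidCategory.rightDual _) ≅ x :=
    rightDualIso (RightRigidCategory.rightDual (HasLeftDual.leftDual x)).exact HasLeftDual.exact
  obtain ⟨e₅⟩ := nonempty_rightDual_iso e₄ e₁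
  let e₆ : HasLeftDual.leftDual D' ≅ D := (dual (HasLeftDual.leftDual D')).symm ≪≫ e₅
  obtain ⟨e₇⟩ := nonempty_rightDual_iso (whiskerRightIso e₆ E ≪≫ e₁) (whiskerLeftIso E e₆ ≪≫ e₄)
  let e₈ : D' ≅ E := (dual D').symm ≪≫ e₇
  exact ⟨⟨whiskerLeftIso D e₈ ≪≫ e₁⟩, ⟨whiskerRightIso e₈ D ≪≫ e₄⟩⟩

end Invertible

end NakayamaSerre

end

theorem theorem4p14 {k : Type*} [Field k] [IsAlgClosed k]
    {A : Type*} [Category* A] [Abelian A] [Linear k A] [MonoidalCategory A]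
    [MonoidalPreadditive A] [MonoidalLinear k A] [RigidCategory A] [FiniteTensorCategory k A]
    {M : Type*} [Category* M] [Abelian M] [Linear k M] [IsFiniteLinear k M]
    [MonoidalLeftAction A M] [ModuleCategory k A M] (hM : IsExactModuleCategory A M) :
    -- the objects in question exist
    (Nonempty (LeftNakayama k A) ∧ Nonempty (RightNakayama k A) ∧
      Nonempty (LeftNakayama k M) ∧ Nonempty (RightNakayama k M) ∧
      Nonempty (InnerHom A M) ∧
      ∀ H : InnerHom A M, (∃ S : LeftRelativeSerre H, S.IsModuleNatural) ∧
        ∃ S : RightRelativeSerre H, S.IsModuleNatural) ∧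
    -- the distinguished object is invertible
    (∀ (N : LeftNakayama k A) (N' : RightNakayama k A),
      Nonempty (N.dist ⊗ N'.distInv ≅ 𝟙_ A) ∧ Nonempty (N'.distInv ⊗ N.dist ≅ 𝟙_ A)) ∧
    -- `N^l ≅ D.S^l` as (twisted) module functors
    (∀ (NA : LeftNakayama k A) (N : LeftNakayama k M) (H : InnerHom A M)
      (S : LeftRelativeSerre H),
      Nonempty (N.functor ≅ actComp NA.dist S.functor) ∧
      (S.IsModuleNatural →
        ∃ (μ : N.ModuleStr A) (r : NA.Radford) (σ : S.ModuleStr)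
          (θ : N.functor ≅ actComp NA.dist S.functor), IsLeftModuleIso μ r σ θ)) ∧
    -- `N^r ≅ D⁻¹.S^r` as (twisted) module functors
    (∀ (NA : RightNakayama k A) (N : RightNakayama k M) (H : InnerHom A M)
      (S : RightRelativeSerre H),
      Nonempty (N.functor ≅ actComp NA.distInv S.functor) ∧
      (S.IsModuleNatural →
        ∃ (δ : N.ModuleStr A) (r : NA.Radford) (σ : S.ModuleStr)
          (θ : N.functor ≅ actComp NA.distInv S.functor), IsRightModuleIso δ r σ θ)) := by
  obtain ⟨H⟩ := nonempty_innerHom k A M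
  refine ⟨⟨nonempty_leftNakayama k A, nonempty_rightNakayama k A, nonempty_leftNakayama k M,
    nonempty_rightNakayama k M, ⟨H⟩, fun H => ⟨LeftRelativeSerre.exists_isModuleNatural k hM H,
      RightRelativeSerre.exists_isModuleNatural k hM H⟩⟩,
    nonempty_dist_tensor_distInv, fun NA N H S => ⟨?_, fun hS => ?_⟩,
    fun NA N H S => ⟨?_, fun hS => ?_⟩⟩
  · obtain ⟨S₀, hS₀⟩ := LeftRelativeSerre.exists_isModuleNatural k hM H
    obtain ⟨τ, hτ⟩ := LeftRelativeSerre.exists_isTrace S₀ hS₀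
    obtain ⟨θ, -⟩ := hτ.exists_iso NA N
    obtain ⟨i⟩ := S₀.nonempty_iso S
    exact ⟨θ ≪≫ Functor.isoWhiskerRight i _⟩
  · obtain ⟨τ, hτ⟩ := LeftRelativeSerre.exists_isTrace S hS
    exact hτ.exists_moduleIso NA N
  · obtain ⟨S₀, hS₀⟩ := RightRelativeSerre.exists_isModuleNatural k hM H
    obtain ⟨τ, hτ⟩ := RightRelativeSerre.exists_isTrace S₀ hS₀
    obtain ⟨θ, -⟩ := hτ.exists_iso NA N
    obtain ⟨i⟩ := S₀.nonempty_iso S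
    exact ⟨θ ≪≫ Functor.isoWhiskerRight i _⟩
  · obtain ⟨τ, hτ⟩ := RightRelativeSerre.exists_isTrace S hS
    exact hτ.exists_moduleIso NA N
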